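/- **Setting.** Let $m>0$ and $|a|=m$. On the half plane $\{\rho>0,\ z\in\mathbb R\}$ put $r=\sqrt{\rho^2+z^2}$, $\sin\theta=\rho/r$, $\cos\theta=z/r$, $\tilde r=r+m$, $\Sigma=\tilde r^2+a^2\cos^2\theta$, $\Xi=\tilde r^2+a^2-2m\tilde r$, and let $$\eta_0=\frac{(\tilde r^2+a^2)^2-\Xi a^2\sin^2\theta}{\Sigma}\sin^2\theta,\qquad \omega_0=2ma(\cos^3\theta-3\cos\theta)-\frac{2ma^3\cos\theta\sin^4\theta}{\Sigma},$$ $\sigma_0=\log(\eta_0/\rho^2)$, $e^{2u_0}=\eta_0\Sigma/r^2$ be the extreme Kerr background in the maximal-isothermal gauge (lapse $\alpha_0=\rho$, zero shift, zero second fundamental form). Indices $A,B$ run over $\rho,z$ and are moved with the flat metric $\delta_{AB}$; a dot is $\partial_t$; $\Delta=\partial_\rho^2+\partial_z^2$, ${}^{(3)}\Delta=\Delta+\rho^{-1}\partial_\rho$. Let $I\subseteq\mathbb R$ be an open interval. A perturbation consists of functions $\sigma_1,\omega_1,q_1$, a shift $\beta_1^A$ and a symmetric trace-free tensor $\chi_{1AB}$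 depending on $(t,\rho,z)$, $t\in I$; the first order lapse is zero. Put $u_1=\sigma_1+q_1$, $\eta_1=\eta_0\sigma_1$, $\bar\omega_1=\omega_1/\eta_0^2$, and $$p=\dot\sigma_1-\frac{2\beta_1^\rho}{\rho}-\beta_1^A\partial_A\sigma_0,\qquad d=\dot\omega_1-\beta_1^A\partial_A\omega_0 ,$$ $$\varepsilon_1=\Big(2\partial_A\sigma_0\partial^A\sigma_1+\frac{2\partial_A\omega_0\partial^A\omega_1}{\eta_0^2}-\frac{2\sigma_1|\partial\omega_0|^2}{\eta_0^2}\Big)\rho .$$ The linearized Einstein equations are, for $\rho>0$, $$-\frac{e^{2u_0}}{\rho^2}\dot p+{}^{(3)}\Delta\sigma_1=\frac{2}{\eta_0^2}\big(\sigma_1|\partial\omega_0|^2-\partial_A\omega_1\partial^A\omega_0\big),$$ $$-\frac{e^{2u_0}}{\rho^2}\dot d+{}^{(3)}\Delta\omega_1=\frac{4\partial_\rho\omega_1}{\rho}+2\partial_A\omega_1\partial^A\sigma_0+2\partial_A\omega_0\partial^A\sigma_1,$$ $$2\dot u_1=\partial_A\beta_1^A+2\beta_1^A\partial_Au_0,\qquad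 \dot\chi_{1AB}=-(F_{1AB}+\rho\, G_{1AB}),$$ $$\partial^B\chi_{1AB}=-\frac{e^{2u_0}}{2\rho}\Big(p\Big(\frac{2\partial_A\rho}{\rho}+\partial_A\sigma_0\Big)+\frac{\partial_A\omega_0}{\eta_0^2}d\Big),\qquad {}^{(3)}\Delta\sigma_1+\Delta q_1=-\frac{\varepsilon_1}{4\rho},$$ $$\partial_A\beta_{1B}+\partial_B\beta_{1A}-\delta_{AB}\partial_C\beta_1^C=2e^{-2u_0}\rho\,\chi_{1AB},$$ where $F_{1AB}=-\partial_A\rho\,\partial_Bu_1-\partial_B\rho\,\partial_Au_1+\delta_{AB}\,\partial_\rho u_1$ and $G_{1AB}$ is the trace-free part of $$\frac{1}{2\eta_0^2}\big(\partial_A\eta_1\partial_B\eta_0+\partial_A\eta_0\partial_B\eta_1+\partial_A\omega_1\partial_B\omega_0+\partial_A\omega_0\partial_B\omega_1\big)-\frac{\sigma_1}{\eta_0^2}\big(\partial_A\eta_0\partial_B\eta_0+\partial_A\omega_0\partial_B\omega_0\big).$$ Put $$K=\frac{2e^{2u_0}}{\rho^2}p^2+\frac{2e^{2u_0}}{\rho^2\eta_0^2}d^2+4e^{-2u_0}\chi_1^{AB}\chi_{1AB},$$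 $$\varepsilon_2=\Big(K+2|\partial\sigma_1|^2+\frac{2|\partial\omega_1|^2}{\eta_0^2}+\frac{4|\partial\omega_0|^2}{\eta_0^2}\sigma_1^2-\frac{8\sigma_1\partial_A\omega_0\partial^A\omega_1}{\eta_0^2}\Big)\rho,$$ $$\bar\varepsilon_2=\Big(K+2\Big|\partial\sigma_1+\frac{\omega_1}{\eta_0^2}\partial\omega_0\Big|^2+2\Big|\partial\Big(\frac{\omega_1}{\eta_0}\Big)-\frac{\sigma_1}{\eta_0}\partial\omega_0\Big|^2+2\Big|\frac{\sigma_1}{\eta_0}\partial\omega_0-\frac{\omega_1}{\eta_0^2}\partial\eta_0\Big|^2\Big)\rho .$$ At either end ($r\to\infty$ or $r\to0$), $f=o_1(r^k)$ means $f=o(r^k)$ and $\partial_Af=o(r^{k-1})$, uniformly in the direction and locally uniformly in $t$. **Theorem 2.** Consider a solution of these equations whose unknowns are smooth on the half plane with the axis $\rho=0$ included and the origin removed, such that * $\sigma_1,\omega_1,q_1,\chi_{1\rho\rho},\beta_1^z$ are even and $\chi_{1\rho z},\beta_1^\rho$ are odd functions of $\rho$; * $\sigma_1,\beta_1^A,\chi_{1AB},\dot\sigma_1,\dot\beta_1^A,\dot\chi_{1AB}=o_1(r^{-1/2})$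 both as $r\to\infty$ and as $r\to0$; * $\bar\omega_1,\dot{\bar\omega}_1=O_1(1)$ at the axis outside the origin (that is, $O(1)$ with first derivatives $O(\rho^{-1})$ as $\rho\to0$ for fixed $t$ and $z\ne0$), $\bar\omega_1,\dot{\bar\omega}_1=o_1(r^{-5/2})$ as $r\to\infty$, and $\bar\omega_1,\dot{\bar\omega}_1=o_1(r^{-1/2})$ as $r\to0$. The second order mass $m_2=\frac1{16}\int\varepsilon_2\,d\rho\,dz\in[0,\infty]$ is understood as the limit of the integrals over the half annuli $\delta<r<L$ as $\delta\to0$, $L\to\infty$ (this is the usual integral whenever $\varepsilon_2$ is integrable). Then, at every $t\in I$: (i) $\varepsilon_1$ is integrable on the half plane and $m_1=\frac1{16}\int\varepsilon_1\,d\rho\,dz=0$. The limit defining $m_2$ exists and $$m_2=\frac1{16}\int_{\{\rho>0\}}\bar\varepsilon_2\,d\rho\,dz .$$ In particular $m_2\ge0$, and $m_2=0$ at a time $t$ if and only if $\sigma_1,\omega_1,p,d,\chi_{1AB}$ all vanish at that time. If $\varepsilon_2$ is integrable, then so is $\bar\varepsilon_2$, and the same holds with ordinary integrals. (ii) $m_2$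 does not depend on $t\in I$. -/

import Mathlib

open Filter MeasureTheory Asymptotics
open scoped Topology ENNReal

noncomputable section

namespace KerrPert

/-! ### Calculus on the half plane -/

/-- Functions of the cylindrical coordinates `(ρ, z)`. -/
abbrev Scal := ℝ → ℝ → ℝ

/-- Time dependent functions, of `(t, ρ, z)`. -/
abbrev Field := ℝ → Scal

/-- The open half plane `ρ > 0` (the axis `ρ = 0` is a null set). -/
def halfPlane : Set (ℝ × ℝ) := {x | 0 < x.1}

/-- Partial derivatives; the index `0` is `ρ`, the index `1` is `z`. -/
def pd (A : Fin 2) (f : Scal) : Scal := fun ρ z =>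
  ![deriv (fun s => f s z) ρ, deriv (fun s => f ρ s) z] A

/-- Time derivative. -/
def tdot (f : Field) : Field := fun t ρ z => deriv (fun s => f s ρ z) t

/-- `∂_A f ∂^A g` with the flat metric. -/
def gdot (f g : Scal) : Scal := fun ρ z => ∑ A, pd A f ρ z * pd A g ρ z

/-- The two dimensional Laplacian. -/
def lap2 (f : Scal) : Scal := fun ρ z => ∑ A, pd A (pd A f) ρ z

/-- The flat three dimensional Laplacian on axially symmetric functions. -/
def lap3 (f : Scal) : Scal := fun ρ z => lap2 f ρ z + pd 0 f ρ z / ρ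

/-- The coordinate function `ρ`. -/
def rhoC : Scal := fun ρ _ => ρ

/-- The spherical radius `r`. -/
def rad (ρ z : ℝ) : ℝ := Real.sqrt (ρ ^ 2 + z ^ 2)

/-- The flat metric `δ_{AB}`. -/
def delta (A B : Fin 2) : ℝ := if A = B then 1 else 0

/-! ### The extreme Kerr background (`|a| = m`), with `sin θ = ρ / r`, `cos θ = z / r` -/

/-- The Boyer-Lindquist radius; in the extreme case it is `r + m`. -/
def blRad (m : ℝ) : Scal := fun ρ z => rad ρ z + m

/-- `Σ`. -/
def kerrSig (m a : ℝ) : Scal := fun ρ z => blRad m ρ z ^ 2 + a ^ 2 * (z / rad ρ z) ^ 2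

/-- `Ξ`. -/
def kerrXi (m a : ℝ) : Scal := fun ρ z => blRad m ρ z ^ 2 + a ^ 2 - 2 * m * blRad m ρ z

/-- `η₀`, the square norm of the axial Killing vector. -/
def eta0 (m a : ℝ) : Scal := fun ρ z =>
  ((blRad m ρ z ^ 2 + a ^ 2) ^ 2 - kerrXi m a ρ z * a ^ 2 * (ρ / rad ρ z) ^ 2)
    / kerrSig m a ρ z * (ρ / rad ρ z) ^ 2

/-- `ω₀`, the twist potential of the axial Killing vector. -/
def omega0 (m a : ℝ) : Scal := fun ρ z =>
  2 * m * a * ((z / rad ρ z) ^ 3 - 3 * (z / rad ρ z))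
    - 2 * m * a ^ 3 * (z / rad ρ z) * (ρ / rad ρ z) ^ 4 / kerrSig m a ρ z

/-- `σ₀`, defined by `η₀ = ρ² exp σ₀`. -/
def sigma0 (m a : ℝ) : Scal := fun ρ z => Real.log (eta0 m a ρ z / ρ ^ 2)

/-- `u₀`, defined by `exp (2 u₀) = η₀ Σ / r²`. -/
def u0 (m a : ℝ) : Scal := fun ρ z =>
  Real.log (eta0 m a ρ z * kerrSig m a ρ z / rad ρ z ^ 2) / 2

/-! ### Linear perturbations -/

/-- The first order unknowns `σ₁, ω₁, q₁`, the shift `β₁^A` and the second fundamental form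
`χ₁_{AB}`; the first order lapse is zero. -/
structure Pert where
  sig : Field
  om : Field
  q : Field
  beta : Fin 2 → Field
  chi : Fin 2 → Fin 2 → Field

namespace Pert

/-- `u₁ = σ₁ + q₁`. -/
def u (φ : Pert) : Field := fun t ρ z => φ.sig t ρ z + φ.q t ρ z

/-- `η₁ = η₀ σ₁`. -/
def eta (m a : ℝ) (φ : Pert) : Field := fun t ρ z => eta0 m a ρ z * φ.sig t ρ z

/-- `ω̄₁ = ω₁ / η₀²`. -/
def omBar (m a : ℝ) (φ : Pert) : Field := fun t ρ z => φ.om t ρ z / eta0 m a ρ z ^ 2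

/-- `p = σ̇₁ - 2 β₁^ρ / ρ - β₁^A ∂_A σ₀`. -/
def p (m a : ℝ) (φ : Pert) : Field := fun t ρ z =>
  tdot φ.sig t ρ z - 2 * φ.beta 0 t ρ z / ρ - ∑ A, φ.beta A t ρ z * pd A (sigma0 m a) ρ z

/-- `d = ω̇₁ - β₁^A ∂_A ω₀`. -/
def d (m a : ℝ) (φ : Pert) : Field := fun t ρ z =>
  tdot φ.om t ρ z - ∑ A, φ.beta A t ρ z * pd A (omega0 m a) ρ z

/-- `∂_C β₁^C`. -/
def divBeta (φ : Pert) : Field := fun t ρ z => ∑ C, pd C (φ.beta C t) ρ z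

/-- The flat conformal Killing operator applied to the shift. -/
def confKill (φ : Pert) (A B : Fin 2) : Field := fun t ρ z =>
  pd A (φ.beta B t) ρ z + pd B (φ.beta A t) ρ z - delta A B * φ.divBeta t ρ z

/-- `χ₁^{AB} χ₁_{AB}`. -/
def chiSq (φ : Pert) : Field := fun t ρ z => ∑ A, ∑ B, φ.chi A B t ρ z ^ 2

/-- `F₁_{AB}`, with `α₀ = ρ`. -/
def F1 (φ : Pert) (A B : Fin 2) : Field := fun t ρ z =>
  -(pd A rhoC ρ z * pd B (φ.u t) ρ z + pd B rhoC ρ z * pd A (φ.u t) ρ z)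
    + delta A B * gdot rhoC (φ.u t) ρ z

/-- `G₁_{AB}`. -/
def G1 (m a : ℝ) (φ : Pert) (A B : Fin 2) : Field := fun t ρ z =>
  1 / (2 * eta0 m a ρ z ^ 2) *
      (pd A (φ.eta m a t) ρ z * pd B (eta0 m a) ρ z + pd A (eta0 m a) ρ z * pd B (φ.eta m a t) ρ z
        + pd A (φ.om t) ρ z * pd B (omega0 m a) ρ z + pd A (omega0 m a) ρ z * pd B (φ.om t) ρ z)
    - φ.sig t ρ z / eta0 m a ρ z ^ 2 *
      (pd A (eta0 m a) ρ z * pd B (eta0 m a) ρ z + pd A (omega0 m a) ρ z * pd B (omega0 m a) ρ z)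
    - delta A B / 2 *
      (1 / eta0 m a ρ z ^ 2 *
          (gdot (eta0 m a) (φ.eta m a t) ρ z + gdot (omega0 m a) (φ.om t) ρ z)
        - φ.sig t ρ z / eta0 m a ρ z ^ 2 *
          (gdot (eta0 m a) (eta0 m a) ρ z + gdot (omega0 m a) (omega0 m a) ρ z))

/-! ### Energy densities and masses -/

/-- The first order energy density `ε₁`. -/
def eps1 (m a : ℝ) (φ : Pert) : Field := fun t ρ z =>
  (2 * gdot (sigma0 m a) (φ.sig t) ρ z
    + 2 * gdot (omega0 m a) (φ.om t) ρ z / eta0 m a ρ z ^ 2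
    - 2 * φ.sig t ρ z * gdot (omega0 m a) (omega0 m a) ρ z / eta0 m a ρ z ^ 2) * ρ

/-- The terms `2 e^{2u₀}/ρ² p² + 2 e^{2u₀}/(ρ² η₀²) d² + 4 e^{-2u₀} χ₁^{AB} χ₁_{AB}`. -/
def kin (m a : ℝ) (φ : Pert) : Field := fun t ρ z =>
  2 * (Real.exp (2 * u0 m a ρ z) / ρ ^ 2) * φ.p m a t ρ z ^ 2
    + 2 * (Real.exp (2 * u0 m a ρ z) / (ρ ^ 2 * eta0 m a ρ z ^ 2)) * φ.d m a t ρ z ^ 2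
    + 4 * Real.exp (-(2 * u0 m a ρ z)) * φ.chiSq t ρ z

/-- The second order energy density `ε₂`. -/
def eps2 (m a : ℝ) (φ : Pert) : Field := fun t ρ z =>
  (φ.kin m a t ρ z
    + 2 * gdot (φ.sig t) (φ.sig t) ρ z
    + 2 * gdot (φ.om t) (φ.om t) ρ z / eta0 m a ρ z ^ 2
    + 4 * (gdot (omega0 m a) (omega0 m a) ρ z / eta0 m a ρ z ^ 2) * φ.sig t ρ z ^ 2
    - 8 * gdot (omega0 m a) (φ.om t) ρ z * φ.sig t ρ z / eta0 m a ρ z ^ 2) * ρ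

/-- The sum of squares `ε̄₂`. -/
def eps2Bar (m a : ℝ) (φ : Pert) : Field := fun t ρ z =>
  (φ.kin m a t ρ z
    + 2 * ∑ A, (pd A (φ.sig t) ρ z
        + φ.om t ρ z / eta0 m a ρ z ^ 2 * pd A (omega0 m a) ρ z) ^ 2
    + 2 * ∑ A, (pd A (fun ρ' z' => φ.om t ρ' z' / eta0 m a ρ' z') ρ z
        - φ.sig t ρ z / eta0 m a ρ z * pd A (omega0 m a) ρ z) ^ 2
    + 2 * ∑ A, (φ.sig t ρ z / eta0 m a ρ z * pd A (omega0 m a) ρ z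
        - φ.om t ρ z / eta0 m a ρ z ^ 2 * pd A (eta0 m a) ρ z) ^ 2) * ρ

end Pert

/-- The mass `(1/16) ∫ ε dρ dz` of an energy density, as an absolutely convergent integral. -/
def mass (e : Scal) : ℝ := 1 / 16 * ∫ x in halfPlane, e x.1 x.2

/-- The mass of a non-negative energy density as an extended number; it is always defined. -/
def posMass (e : Scal) : ℝ≥0∞ :=
  ENNReal.ofReal (1 / 16) * ∫⁻ x in halfPlane, ENNReal.ofReal (e x.1 x.2)

/-- The half annulus `δ < r < L`. -/
def halfAnnulus (δ L : ℝ) : Set (ℝ × ℝ) :=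
  {x | x ∈ halfPlane ∧ δ < rad x.1 x.2 ∧ rad x.1 x.2 < L}

/-- The energy density `e` has the (possibly infinite) mass `M` as an improper integral: it is
integrable over every half annulus `δ < r < L`, and `(1/16) ∫ e` over the half annulus tends to
`M` as `δ → 0` and `L → ∞`, independently of each other. -/
def HasMass (e : Scal) (M : EReal) : Prop :=
  (∀ δ L : ℝ, 0 < δ → δ < L → IntegrableOn (fun x : ℝ × ℝ => e x.1 x.2) (halfAnnulus δ L)) ∧
  Tendsto (fun y : ℝ × ℝ => ((1 / 16 * ∫ x in halfAnnulus y.1 y.2, e x.1 x.2 : ℝ) : EReal))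
    (𝓝[>] (0 : ℝ) ×ˢ atTop) (𝓝 M)

/-! ### The hypotheses on a perturbation, on a time interval `I` -/

/-- Smoothness on the whole half plane with the axis included and the origin removed, for a
function that is extended to `ρ < 0` by parity. -/
def SmoothField (I : Set ℝ) (f : Field) : Prop :=
  ContDiffOn ℝ ((⊤ : ℕ∞) : WithTop ℕ∞) (fun x : ℝ × ℝ × ℝ => f x.1 x.2.1 x.2.2)
    {x | x.1 ∈ I ∧ x.2 ≠ (0, 0)}

def EvenField (I : Set ℝ) (f : Field) : Prop :=
  ∀ t ∈ I, ∀ ρ z : ℝ, (ρ, z) ≠ (0, 0) → f t (-ρ) z = f t ρ z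

def OddField (I : Set ℝ) (f : Field) : Prop :=
  ∀ t ∈ I, ∀ ρ z : ℝ, (ρ, z) ≠ (0, 0) → f t (-ρ) z = -f t ρ z

/-- All the unknowns are smooth. -/
structure IsSmooth (I : Set ℝ) (φ : Pert) : Prop where
  sig : SmoothField I φ.sig
  om : SmoothField I φ.om
  q : SmoothField I φ.q
  beta : ∀ A, SmoothField I (φ.beta A)
  chi : ∀ A B, SmoothField I (φ.chi A B)

/-- The parity conditions at the axis. -/
structure HasParity (I : Set ℝ) (φ : Pert) : Prop where
  sig : EvenField I φ.sig
  om : EvenField I φ.om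
  q : EvenField I φ.q
  chi_rho_rho : EvenField I (φ.chi 0 0)
  beta_z : EvenField I (φ.beta 1)
  chi_rho_z : OddField I (φ.chi 0 1)
  beta_rho : OddField I (φ.beta 0)

/-- The linearized Einstein equations on the extreme Kerr background in the maximal-isothermal
gauge. -/
structure IsSolution (m a : ℝ) (I : Set ℝ) (φ : Pert) : Prop where
  /-- `χ₁` is symmetric and, by the maximal condition, trace free -/
  chi_symm : ∀ t ∈ I, ∀ ρ > 0, ∀ z, ∀ A B, φ.chi A B t ρ z = φ.chi B A t ρ z
  chi_trace : ∀ t ∈ I, ∀ ρ > 0, ∀ z, ∑ A, φ.chi A A t ρ z = 0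
  /-- evolution equations for `σ₁` and `ω₁` -/
  evol_sig : ∀ t ∈ I, ∀ ρ > 0, ∀ z,
    -(Real.exp (2 * u0 m a ρ z) / ρ ^ 2) * tdot (φ.p m a) t ρ z + lap3 (φ.sig t) ρ z
      = 2 / eta0 m a ρ z ^ 2 * (φ.sig t ρ z * gdot (omega0 m a) (omega0 m a) ρ z
          - gdot (φ.om t) (omega0 m a) ρ z)
  evol_om : ∀ t ∈ I, ∀ ρ > 0, ∀ z,
    -(Real.exp (2 * u0 m a ρ z) / ρ ^ 2) * tdot (φ.d m a) t ρ z + lap3 (φ.om t) ρ z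
      = 4 * pd 0 (φ.om t) ρ z / ρ + 2 * gdot (φ.om t) (sigma0 m a) ρ z
          + 2 * gdot (omega0 m a) (φ.sig t) ρ z
  /-- evolution equations for the metric and the second fundamental form -/
  evol_u : ∀ t ∈ I, ∀ ρ > 0, ∀ z,
    2 * tdot φ.u t ρ z = φ.divBeta t ρ z + 2 * ∑ A, φ.beta A t ρ z * pd A (u0 m a) ρ z
  evol_chi : ∀ t ∈ I, ∀ ρ > 0, ∀ z, ∀ A B,
    tdot (φ.chi A B) t ρ z = -(φ.F1 A B t ρ z + ρ * φ.G1 m a A B t ρ z)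
  /-- momentum constraint -/
  momentum : ∀ t ∈ I, ∀ ρ > 0, ∀ z, ∀ A,
    ∑ B, pd B (φ.chi A B t) ρ z
      = -(Real.exp (2 * u0 m a ρ z) / (2 * ρ)) *
          (φ.p m a t ρ z * (2 * pd A rhoC ρ z / ρ + pd A (sigma0 m a) ρ z)
            + pd A (omega0 m a) ρ z / eta0 m a ρ z ^ 2 * φ.d m a t ρ z)
  /-- Hamiltonian constraint -/
  hamiltonian : ∀ t ∈ I, ∀ ρ > 0, ∀ z,
    lap3 (φ.sig t) ρ z + lap2 (φ.q t) ρ z = -(φ.eps1 m a t ρ z / (4 * ρ))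
  /-- gauge equation for the shift -/
  shift : ∀ t ∈ I, ∀ ρ > 0, ∀ z, ∀ A B,
    φ.confKill A B t ρ z = 2 * Real.exp (-(2 * u0 m a ρ z)) * ρ * φ.chi A B t ρ z

/-- `r → ∞` in the half plane. -/
def endInfinity : Filter (ℝ × ℝ) :=
  comap (fun x : ℝ × ℝ => rad x.1 x.2) atTop ⊓ 𝓟 halfPlane

/-- `r → 0` in the half plane. -/
def endOrigin : Filter (ℝ × ℝ) := 𝓝[halfPlane] (0, 0)

/-- `f = o₁(r^k)` at the end `E`, locally uniformly in time: `f = o(r^k)` and the first space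
derivatives are `o(r^(k-1))`. -/
def LittleO1 (I : Set ℝ) (E : Filter (ℝ × ℝ)) (k : ℝ) (f : Field) : Prop :=
  ∀ t₀ ∈ I,
    ((fun x : ℝ × ℝ × ℝ => f x.1 x.2.1 x.2.2)
      =o[𝓝 t₀ ×ˢ E] fun x => rad x.2.1 x.2.2 ^ k) ∧
    ∀ A, (fun x : ℝ × ℝ × ℝ => pd A (f x.1) x.2.1 x.2.2)
      =o[𝓝 t₀ ×ˢ E] fun x => rad x.2.1 x.2.2 ^ (k - 1)

/-- The fall-off of `σ₁, β₁, χ₁` and of their time derivatives at an end. -/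
structure HasFallOff (I : Set ℝ) (E : Filter (ℝ × ℝ)) (φ : Pert) : Prop where
  sig : LittleO1 I E (-1 / 2) φ.sig
  beta : ∀ A, LittleO1 I E (-1 / 2) (φ.beta A)
  chi : ∀ A B, LittleO1 I E (-1 / 2) (φ.chi A B)
  sig_dot : LittleO1 I E (-1 / 2) (tdot φ.sig)
  beta_dot : ∀ A, LittleO1 I E (-1 / 2) (tdot (φ.beta A))
  chi_dot : ∀ A B, LittleO1 I E (-1 / 2) (tdot (φ.chi A B))

/-- `f = O₁(1)` at the axis, outside the origin: `f = O(1)` and the first space derivatives are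
`O(ρ⁻¹)` as `ρ → 0`, for every fixed `t` and every fixed `z ≠ 0`. -/
def BigO1Axis (I : Set ℝ) (f : Field) : Prop :=
  ∀ t ∈ I, ∀ z : ℝ, z ≠ 0 →
    ((fun ρ => f t ρ z) =O[𝓝[>] (0 : ℝ)] fun _ => (1 : ℝ)) ∧
    ∀ A, (fun ρ => pd A (f t) ρ z) =O[𝓝[>] (0 : ℝ)] fun ρ => ρ⁻¹

/-- The conditions on the twist, for `ω̄₁ = ω₁ / η₀²` and its time derivative. Since `η₀` behaves
like `ρ²` at infinity and like `ρ² / r²` at the origin, both decay conditions say that `ω₁ / η₀` is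
`o(r^(-1/2))` away from the axis. -/
structure TwistConditions (m a : ℝ) (I : Set ℝ) (φ : Pert) : Prop where
  axis : BigO1Axis I (φ.omBar m a)
  axis_dot : BigO1Axis I (tdot (φ.omBar m a))
  infinity : LittleO1 I endInfinity (-5 / 2) (φ.omBar m a)
  infinity_dot : LittleO1 I endInfinity (-5 / 2) (tdot (φ.omBar m a))
  origin : LittleO1 I endOrigin (-1 / 2) (φ.omBar m a)
  origin_dot : LittleO1 I endOrigin (-1 / 2) (tdot (φ.omBar m a))

/-- The data `(σ₁, ω₁, p, d, χ₁)` on which the second order mass depends vanish at the time `t`. -/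
def VanishesAt (m a : ℝ) (φ : Pert) (t : ℝ) : Prop :=
  ∀ ρ > 0, ∀ z, φ.sig t ρ z = 0 ∧ φ.om t ρ z = 0 ∧ φ.p m a t ρ z = 0 ∧ φ.d m a t ρ z = 0 ∧
    ∀ A B, φ.chi A B t ρ z = 0

end KerrPert

end

open KerrPert

/-!
The proof rests on three divergence identities on the half plane. The density `ε₁` is the divergence
of a vector field that is linear in the perturbation (`div_eps1Flux`), since `σ₀` and `ω₀` solve the
stationary axially symmetric equations (`lap3_sigma0`, `lap3_omega0`). The difference `ε̄₂ - ε₂` is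
the divergence of a quadratic field (`div_carterFlux`); this is the linearized form of Carter's
identity. For a solution the time derivative of `ε₂` is a divergence as well (`div_energyFlux`): the
wave equations turn the terms with `σ̇₁` and `ω̇₁` into a divergence, and what remains is the
divergence of `8 β₁^B χ̇₁_{BA}`, by the gauge equation of the shift and the time derivative of the
momentum constraint.

All three vector fields `V` are admissible fluxes (`IsFlux`): `V = O(ρ)` at the axis and
`V = o(r⁻¹)` at both ends, so that the integral of the divergence over the half annulus `δ < r < L` tends to zero
(`IsFlux.eventually_le`), by the divergence theorem in polar coordinates (`abs_setIntegral_div_le`).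
For the behaviour at the axis it is used that the even function `ω₁ = η₀² ω̄₁` vanishes to fourth
order there, that `β₁^ρ` is odd, and that the gauge equation of the shift makes `χ₁` vanish at the
axis. At the ends the fields are written in terms of `σ₁`, `ω₁/η₀`, `β₁` and `χ₁`, which are
`o(r^(-1/2))`, and of bounds for the background (`abs_pd_sigma0_le`,
`abs_pd_omega0_div_eta0_le`, `abs_pd_eta0_le`).

The identity for `ε₁` gives `m₁ = 0`, that for `ε̄₂ - ε₂` identifies `m₂` with the integral of the
non-negative density `ε̄₂`, and that for the time derivative of `ε₂`, whose integrals over half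
annuli tend to zero uniformly on compact time intervals, gives conservation. If `ε̄₂` vanishes then
`∂σ₁ = -(ω₁/η₀) ∂ω₀/η₀` and `∂(ω₁/η₀) = σ₁ ∂ω₀/η₀`; so `σ₁² + (ω₁/η₀)²` is constant, and it tends to
zero at infinity.
-/

open Filter MeasureTheory Asymptotics
open scoped Topology ENNReal


namespace KerrPert

section
/-! ### Calculus of smooth fields -/

/-- Smoothness of a time dependent function on a set of `ℝ × ℝ × ℝ`, with coordinates
`(t, ρ, z)`. -/
def Sm (U : Set (ℝ × ℝ × ℝ)) (f : Field) : Prop :=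
  ContDiffOn ℝ ((⊤ : ℕ∞) : WithTop ℕ∞) (fun x : ℝ × ℝ × ℝ => f x.1 x.2.1 x.2.2) U

/-- Joint differentiability in `(ρ, z)`. -/
def DiffS (f : Scal) (ρ z : ℝ) : Prop :=
  DifferentiableAt ℝ (fun y : ℝ × ℝ => f y.1 y.2) (ρ, z)

namespace DiffS

variable {f g : Scal} {ρ z : ℝ}

lemma slice0 (h : DiffS f ρ z) : HasDerivAt (fun s => f s z) (pd 0 f ρ z) ρ := by
  have h2 : DifferentiableAt ℝ (fun s : ℝ => ((s, z) : ℝ × ℝ)) ρ := by fun_prop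
  exact (DifferentiableAt.comp (g := fun y : ℝ × ℝ => f y.1 y.2)
    (f := fun s : ℝ => ((s, z) : ℝ × ℝ)) ρ h h2).hasDerivAt

lemma slice1 (h : DiffS f ρ z) : HasDerivAt (fun s => f ρ s) (pd 1 f ρ z) z := by
  have h2 : DifferentiableAt ℝ (fun s : ℝ => ((ρ, s) : ℝ × ℝ)) z := by fun_prop
  exact (DifferentiableAt.comp (g := fun y : ℝ × ℝ => f y.1 y.2)
    (f := fun s : ℝ => ((ρ, s) : ℝ × ℝ)) z h h2).hasDerivAt

lemma mul (hf : DiffS f ρ z) (hg : DiffS g ρ z) : DiffS (fun ρ z => f ρ z * g ρ z) ρ z :=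
  DifferentiableAt.mul hf hg

lemma const_mul (hf : DiffS f ρ z) (c : ℝ) : DiffS (fun ρ z => c * f ρ z) ρ z :=
  DifferentiableAt.const_mul hf c

lemma pow (hf : DiffS f ρ z) (n : ℕ) : DiffS (fun ρ z => f ρ z ^ n) ρ z :=
  DifferentiableAt.fun_pow hf n

lemma div (hf : DiffS f ρ z) (hg : DiffS g ρ z) (h0 : g ρ z ≠ 0) :
    DiffS (fun ρ z => f ρ z / g ρ z) ρ z := by
  unfold DiffS at *
  simp only [div_eq_mul_inv]
  exact hf.mul (hg.fun_inv h0)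

end DiffS

variable {f g : Scal} {ρ z : ℝ}

lemma pd_zero_eq {c : ℝ} (h : HasDerivAt (fun s => f s z) c ρ) : pd 0 f ρ z = c := h.deriv

lemma pd_one_eq {c : ℝ} (h : HasDerivAt (fun s => f ρ s) c z) : pd 1 f ρ z = c := h.deriv

lemma pd_mul (hf : DiffS f ρ z) (hg : DiffS g ρ z) (A : Fin 2) :
    pd A (fun ρ z => f ρ z * g ρ z) ρ z = pd A f ρ z * g ρ z + f ρ z * pd A g ρ z := by
  fin_cases A
  · exact pd_zero_eq (hf.slice0.mul hg.slice0)
  · exact pd_one_eq (hf.slice1.mul hg.slice1)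

lemma pd_add (hf : DiffS f ρ z) (hg : DiffS g ρ z) (A : Fin 2) :
    pd A (fun ρ z => f ρ z + g ρ z) ρ z = pd A f ρ z + pd A g ρ z := by
  fin_cases A
  · exact pd_zero_eq (hf.slice0.add hg.slice0)
  · exact pd_one_eq (hf.slice1.add hg.slice1)

lemma pd_const_mul (hf : DiffS f ρ z) (c : ℝ) (A : Fin 2) :
    pd A (fun ρ z => c * f ρ z) ρ z = c * pd A f ρ z := by
  fin_cases A
  · exact pd_zero_eq (hf.slice0.const_mul c)
  · exact pd_one_eq (hf.slice1.const_mul c)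

lemma pd_div (hf : DiffS f ρ z) (hg : DiffS g ρ z) (h0 : g ρ z ≠ 0) (A : Fin 2) :
    pd A (fun ρ z => f ρ z / g ρ z) ρ z
      = (pd A f ρ z * g ρ z - f ρ z * pd A g ρ z) / g ρ z ^ 2 := by
  fin_cases A
  · exact pd_zero_eq (hf.slice0.div hg.slice0 h0)
  · exact pd_one_eq (hf.slice1.div hg.slice1 h0)

lemma pd_pow (hf : DiffS f ρ z) (n : ℕ) (A : Fin 2) :
    pd A (fun ρ z => f ρ z ^ n) ρ z = n * f ρ z ^ (n - 1) * pd A f ρ z := by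
  fin_cases A
  · exact pd_zero_eq (hf.slice0.fun_pow n)
  · exact pd_one_eq (hf.slice1.fun_pow n)

lemma pd_rhoC_zero : pd 0 rhoC ρ z = 1 := pd_zero_eq (hasDerivAt_id ρ)

lemma pd_rhoC_one : pd 1 rhoC ρ z = 0 := pd_one_eq (hasDerivAt_const z ρ)

lemma diffS_rhoC : DiffS rhoC ρ z := by unfold DiffS rhoC; fun_prop

/-- `pd A` depends on the germ only. -/
lemma pd_congr (h : (fun y : ℝ × ℝ => f y.1 y.2) =ᶠ[𝓝 (ρ, z)] fun y => g y.1 y.2) (A : Fin 2) :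
    pd A f ρ z = pd A g ρ z := by
  fin_cases A
  · have : Tendsto (fun s : ℝ => ((s, z) : ℝ × ℝ)) (𝓝 ρ) (𝓝 (ρ, z)) :=
      (Continuous.tendsto (by fun_prop) ρ)
    exact Filter.EventuallyEq.deriv_eq (this.eventually h)
  · have : Tendsto (fun s : ℝ => ((ρ, s) : ℝ × ℝ)) (𝓝 z) (𝓝 (ρ, z)) :=
      (Continuous.tendsto (by fun_prop) z)
    exact Filter.EventuallyEq.deriv_eq (this.eventually h)

/-- The coordinate vectors `∂_ρ, ∂_z` of `ℝ × ℝ × ℝ`. -/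
def eDir (A : Fin 2) : ℝ × ℝ × ℝ := (0, ![(1, 0), (0, 1)] A)

lemma two_le_infty : (2 : WithTop ℕ∞) ≤ ((⊤ : ℕ∞) : WithTop ℕ∞) :=
  show (((2 : ℕ∞)) : WithTop ℕ∞) ≤ _ from WithTop.coe_le_coe.2 le_top

namespace Sm

variable {U : Set (ℝ × ℝ × ℝ)} {f g : Field}

lemma mono {V : Set (ℝ × ℝ × ℝ)} (h : Sm U f) (hV : V ⊆ U) : Sm V f := ContDiffOn.mono h hV

lemma congr (h : Sm U f) (hfg : ∀ x ∈ U, g x.1 x.2.1 x.2.2 = f x.1 x.2.1 x.2.2) : Sm U g :=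
  ContDiffOn.congr h hfg

lemma const (c : ℝ) : Sm U (fun _ _ _ => c) := contDiffOn_const

lemma rho : Sm U (fun _ => rhoC) := by unfold Sm rhoC; fun_prop

lemma mul (hf : Sm U f) (hg : Sm U g) : Sm U (fun t ρ z => f t ρ z * g t ρ z) :=
  ContDiffOn.mul hf hg

lemma add (hf : Sm U f) (hg : Sm U g) : Sm U (fun t ρ z => f t ρ z + g t ρ z) :=
  ContDiffOn.add hf hg

lemma sub (hf : Sm U f) (hg : Sm U g) : Sm U (fun t ρ z => f t ρ z - g t ρ z) :=
  ContDiffOn.sub hf hg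

lemma pow (hf : Sm U f) (n : ℕ) : Sm U (fun t ρ z => f t ρ z ^ n) := ContDiffOn.pow hf n

lemma div (hf : Sm U f) (hg : Sm U g) (h0 : ∀ x ∈ U, g x.1 x.2.1 x.2.2 ≠ 0) :
    Sm U (fun t ρ z => f t ρ z / g t ρ z) := ContDiffOn.div hf hg h0

lemma log (hf : Sm U f) (h0 : ∀ x ∈ U, f x.1 x.2.1 x.2.2 ≠ 0) :
    Sm U (fun t ρ z => Real.log (f t ρ z)) := ContDiffOn.log hf h0

lemma sum {f : Fin 2 → Field} (hf : ∀ A, Sm U (f A)) :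
    Sm U (fun t ρ z => ∑ A, f A t ρ z) := ContDiffOn.sum fun A _ => hf A

variable {t ρ z : ℝ}

lemma differentiableAt (hU : IsOpen U) (hf : Sm U f) (hx : (t, ρ, z) ∈ U) :
    DifferentiableAt ℝ (fun x : ℝ × ℝ × ℝ => f x.1 x.2.1 x.2.2) (t, ρ, z) :=
  (ContDiffOn.contDiffAt hf (hU.mem_nhds hx)).differentiableAt (by simp)

lemma diffS (hU : IsOpen U) (hf : Sm U f) (hx : (t, ρ, z) ∈ U) : DiffS (f t) ρ z := by
  have h2 : DifferentiableAt ℝ (fun y : ℝ × ℝ => ((t, y) : ℝ × ℝ × ℝ)) (ρ, z) := by fun_prop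
  exact DifferentiableAt.comp (g := fun x : ℝ × ℝ × ℝ => f x.1 x.2.1 x.2.2) (ρ, z)
    (hf.differentiableAt hU hx) h2

lemma hasDerivAt_tdot (hU : IsOpen U) (hf : Sm U f) (hx : (t, ρ, z) ∈ U) :
    HasDerivAt (fun s => f s ρ z) (tdot f t ρ z) t := by
  have h2 : DifferentiableAt ℝ (fun s : ℝ => ((s, ρ, z) : ℝ × ℝ × ℝ)) t := by fun_prop
  exact (DifferentiableAt.comp (g := fun x : ℝ × ℝ × ℝ => f x.1 x.2.1 x.2.2) t
    (hf.differentiableAt hU hx) h2).hasDerivAt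

lemma tdot_eq (hU : IsOpen U) (hf : Sm U f) (hx : (t, ρ, z) ∈ U) :
    tdot f t ρ z = fderiv ℝ (fun x : ℝ × ℝ × ℝ => f x.1 x.2.1 x.2.2) (t, ρ, z) (1, 0, 0) := by
  have h1 := (hf.differentiableAt hU hx).hasFDerivAt
  have h2 : HasDerivAt (fun s : ℝ => ((s, ρ, z) : ℝ × ℝ × ℝ)) (1, 0, 0) t :=
    (hasDerivAt_id t).prodMk (hasDerivAt_const t (ρ, z))
  exact (h1.comp_hasDerivAt t h2).deriv

lemma pd_eq (hU : IsOpen U) (hf : Sm U f) (hx : (t, ρ, z) ∈ U) (A : Fin 2) :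
    pd A (f t) ρ z
      = fderiv ℝ (fun x : ℝ × ℝ × ℝ => f x.1 x.2.1 x.2.2) (t, ρ, z) (eDir A) := by
  have h1 := (hf.differentiableAt hU hx).hasFDerivAt
  fin_cases A
  · have h2 : HasDerivAt (fun s : ℝ => ((t, s, z) : ℝ × ℝ × ℝ)) (0, 1, 0) ρ :=
      (hasDerivAt_const ρ t).prodMk ((hasDerivAt_id ρ).prodMk (hasDerivAt_const ρ z))
    exact (h1.comp_hasDerivAt ρ h2).deriv
  · have h2 : HasDerivAt (fun s : ℝ => ((t, ρ, s) : ℝ × ℝ × ℝ)) (0, 0, 1) z :=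
      (hasDerivAt_const z t).prodMk ((hasDerivAt_const z ρ).prodMk (hasDerivAt_id z))
    exact (h1.comp_hasDerivAt z h2).deriv

lemma fderiv_dir (hU : IsOpen U) (hf : Sm U f) (v : ℝ × ℝ × ℝ) :
    ContDiffOn ℝ ((⊤ : ℕ∞) : WithTop ℕ∞)
      (fun x => fderiv ℝ (fun x : ℝ × ℝ × ℝ => f x.1 x.2.1 x.2.2) x v) U :=
  (ContDiffOn.fderiv_of_isOpen hf hU (by simp)).clm_apply contDiffOn_const

lemma tdot (hU : IsOpen U) (hf : Sm U f) : Sm U (tdot f) :=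
  ContDiffOn.congr (hf.fderiv_dir hU (1, 0, 0)) fun _ hx => hf.tdot_eq hU hx

lemma pd (hU : IsOpen U) (hf : Sm U f) (A : Fin 2) : Sm U (fun t => pd A (f t)) :=
  ContDiffOn.congr (hf.fderiv_dir hU (eDir A)) fun _ hx => hf.pd_eq hU hx A

lemma fderiv_comm (hU : IsOpen U) (hf : Sm U f) {x : ℝ × ℝ × ℝ} (hx : x ∈ U)
    (v w : ℝ × ℝ × ℝ) :
    fderiv ℝ (fun y => fderiv ℝ (fun x : ℝ × ℝ × ℝ => f x.1 x.2.1 x.2.2) y v) x w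
      = fderiv ℝ (fun y => fderiv ℝ (fun x : ℝ × ℝ × ℝ => f x.1 x.2.1 x.2.2) y w) x v := by
  have hc := ContDiffOn.contDiffAt hf (hU.mem_nhds hx)
  have hs := hc.isSymmSndFDerivAt (by simpa using two_le_infty)
  have hd : DifferentiableAt ℝ (fderiv ℝ (fun x : ℝ × ℝ × ℝ => f x.1 x.2.1 x.2.2)) x :=
    ((ContDiffOn.fderiv_of_isOpen (m := 1) hf hU
      (by simpa [one_add_one_eq_two] using two_le_infty)).contDiffAt
      (hU.mem_nhds hx)).differentiableAt (by simp)
  have key : ∀ v, fderiv ℝ (fun y => fderiv ℝ (fun x : ℝ × ℝ × ℝ => f x.1 x.2.1 x.2.2) y v) x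
      = (fderiv ℝ (fderiv ℝ (fun x : ℝ × ℝ × ℝ => f x.1 x.2.1 x.2.2)) x).flip v := by
    intro v
    have := (hd.hasFDerivAt.clm_apply (hasFDerivAt_const v x)).fderiv
    rw [this]
    ext <;> simp
  rw [key, key]
  exact hs w v

lemma tdot_pd (hU : IsOpen U) (hf : Sm U f) (hx : (t, ρ, z) ∈ U) (A : Fin 2) :
    KerrPert.tdot (fun t => KerrPert.pd A (f t)) t ρ z = KerrPert.pd A (KerrPert.tdot f t) ρ z := by
  rw [(hf.pd hU A).tdot_eq hU hx, (hf.tdot hU).pd_eq hU hx A]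
  have e1 : (fun x : ℝ × ℝ × ℝ => KerrPert.pd A (f x.1) x.2.1 x.2.2) =ᶠ[𝓝 (t, ρ, z)]
      fun y => fderiv ℝ (fun x : ℝ × ℝ × ℝ => f x.1 x.2.1 x.2.2) y (eDir A) :=
    eventually_of_mem (hU.mem_nhds hx) fun _ hy => hf.pd_eq hU hy A
  have e2 : (fun x : ℝ × ℝ × ℝ => KerrPert.tdot f x.1 x.2.1 x.2.2) =ᶠ[𝓝 (t, ρ, z)]
      fun y => fderiv ℝ (fun x : ℝ × ℝ × ℝ => f x.1 x.2.1 x.2.2) y (1, 0, 0) :=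
    eventually_of_mem (hU.mem_nhds hx) fun _ hy => hf.tdot_eq hU hy
  rw [e1.fderiv_eq, e2.fderiv_eq]
  exact hf.fderiv_comm hU hx _ _

lemma pd_comm (hU : IsOpen U) (hf : Sm U f) (hx : (t, ρ, z) ∈ U) (A B : Fin 2) :
    KerrPert.pd A (KerrPert.pd B (f t)) ρ z = KerrPert.pd B (KerrPert.pd A (f t)) ρ z := by
  rw [(hf.pd hU B).pd_eq hU hx A, (hf.pd hU A).pd_eq hU hx B]
  have e : ∀ A, (fun x : ℝ × ℝ × ℝ => KerrPert.pd A (f x.1) x.2.1 x.2.2) =ᶠ[𝓝 (t, ρ, z)]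
      fun y => fderiv ℝ (fun x : ℝ × ℝ × ℝ => f x.1 x.2.1 x.2.2) y (eDir A) := fun A =>
    eventually_of_mem (hU.mem_nhds hx) fun _ hy => hf.pd_eq hU hy A
  rw [(e A).fderiv_eq, (e B).fderiv_eq]
  exact hf.fderiv_comm hU hx _ _

end Sm

/-- The divergence of `ρ f ∇g` in terms of the axially symmetric Laplacian. -/
lemma div_smul_grad (hf : DiffS f ρ z) (hg : ∀ A, DiffS (pd A g) ρ z) (h0 : ρ ≠ 0) :
    ∑ A, pd A (fun ρ z => ρ * f ρ z * pd A g ρ z) ρ z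
      = ρ * gdot f g ρ z + ρ * f ρ z * lap3 g ρ z := by
  have hr : DiffS (fun ρ _ => ρ) ρ z := diffS_rhoC
  have hrf : DiffS (fun ρ z => ρ * f ρ z) ρ z := DifferentiableAt.mul hr hf
  have e0 : pd 0 (fun ρ _ => ρ) ρ z = 1 := pd_rhoC_zero
  have e1 : pd 1 (fun ρ _ => ρ) ρ z = 0 := pd_rhoC_one
  simp only [lap3, lap2, gdot, Fin.sum_univ_two]
  rw [pd_mul hrf (hg 0), pd_mul hrf (hg 1), pd_mul hr hf, pd_mul hr hf, e0, e1]
  field_simp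
  ring
end

section
/-! ### The extreme Kerr background -/

variable {ρ z m a : ℝ}

lemma rad_sq (ρ z : ℝ) : rad ρ z ^ 2 = ρ ^ 2 + z ^ 2 := Real.sq_sqrt (by positivity)

lemma rad_pos (h : 0 < ρ) : 0 < rad ρ z := Real.sqrt_pos.2 (by positivity)

lemma rad_nonneg : 0 ≤ rad ρ z := Real.sqrt_nonneg _

lemma abs_left_le_rad : |ρ| ≤ rad ρ z := Real.abs_le_sqrt (by nlinarith [sq_nonneg z])

lemma abs_right_le_rad : |z| ≤ rad ρ z := Real.abs_le_sqrt (by nlinarith [sq_nonneg ρ])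

lemma left_le_rad : ρ ≤ rad ρ z := (le_abs_self _).trans abs_left_le_rad

/-- The space-time domain `t ∈ I`, `ρ > 0`. -/
def dom (I : Set ℝ) : Set (ℝ × ℝ × ℝ) := {x | x.1 ∈ I ∧ 0 < x.2.1}

lemma isOpen_dom {I : Set ℝ} (hI : IsOpen I) : IsOpen (dom I) :=
  (hI.preimage continuous_fst).inter
    (isOpen_lt continuous_const (continuous_fst.comp continuous_snd))

lemma isOpen_halfPlane : IsOpen halfPlane := isOpen_lt continuous_const continuous_fst

lemma measurableSet_halfPlane : MeasurableSet halfPlane := isOpen_halfPlane.measurableSet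

lemma continuous_rad : Continuous fun x : ℝ × ℝ => rad x.1 x.2 := by
  unfold rad; fun_prop

lemma sm_rad {I : Set ℝ} : Sm (dom I) (fun _ => rad) := by
  have : ContDiffOn ℝ ((⊤ : ℕ∞) : WithTop ℕ∞)
      (fun x : ℝ × ℝ × ℝ => x.2.1 ^ 2 + x.2.2 ^ 2) (dom I) := by fun_prop
  exact this.sqrt fun x hx => by have := hx.2; positivity

lemma sm_z {I : Set ℝ} : Sm (dom I) (fun _ _ z => z) := by unfold Sm; fun_prop

/-- Evaluation at a point of a smooth, time independent field. -/
lemma Sm.diffS_static {f : Scal} (hf : Sm (dom Set.univ) (fun _ => f)) (h : 0 < ρ) :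
    DiffS f ρ z :=
  Sm.diffS (t := 0) (isOpen_dom isOpen_univ) hf ⟨trivial, h⟩

lemma diffS_rad (h : 0 < ρ) : DiffS rad ρ z := Sm.diffS_static sm_rad h

lemma pd_zero_rad (h : 0 < ρ) : pd 0 rad ρ z = ρ / rad ρ z := by
  have h0 : ρ ^ 2 + z ^ 2 ≠ 0 := by positivity
  refine pd_zero_eq ?_
  have := (((hasDerivAt_id ρ).pow 2).add_const (z ^ 2)).sqrt h0
  refine this.congr_deriv ?_
  simp [rad]
  field_simp

lemma pd_one_rad (h : 0 < ρ) : pd 1 rad ρ z = z / rad ρ z := by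
  have h0 : ρ ^ 2 + z ^ 2 ≠ 0 := by positivity
  refine pd_one_eq ?_
  have := (((hasDerivAt_id z).pow 2).const_add (ρ ^ 2)).sqrt h0
  refine this.congr_deriv ?_
  simp [rad]
  field_simp

lemma abs_pd_rad_le (h : 0 < ρ) (A : Fin 2) : |pd A rad ρ z| ≤ 1 := by
  have hr : 0 < rad ρ z := rad_pos h
  fin_cases A
  · simp only [Fin.zero_eta]
    rw [pd_zero_rad h, abs_div, abs_of_pos hr, div_le_one hr]; exact abs_left_le_rad
  · simp only [Fin.mk_one]
    rw [pd_one_rad h, abs_div, abs_of_pos hr, div_le_one hr]; exact abs_right_le_rad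

/-- Two time independent functions that agree on the half plane have the same derivatives there. -/
lemma pd_congr_halfPlane {f g : Scal} (hfg : ∀ ρ > 0, ∀ z, f ρ z = g ρ z) (h : 0 < ρ)
    (A : Fin 2) : pd A f ρ z = pd A g ρ z :=
  pd_congr (eventually_of_mem (isOpen_halfPlane.mem_nhds (x := (ρ, z)) h)
    fun y hy => hfg y.1 hy y.2) A

/-- The numerator `N` of `η₀ = ρ² N / S`. -/
noncomputable def kN (m : ℝ) : Scal := fun ρ z => ((rad ρ z + m) ^ 2 + m ^ 2) ^ 2 - m ^ 2 * ρ ^ 2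

/-- The denominator `S = r² Σ` of `η₀ = ρ² N / S`. -/
noncomputable def kS (m : ℝ) : Scal := fun ρ z => rad ρ z ^ 2 * (rad ρ z + m) ^ 2 + m ^ 2 * z ^ 2

/-- The angular velocity `W`, up to sign, of the dragging of inertial frames. It is the conjugate
potential of `ω₀`. -/
noncomputable def kW (m a : ℝ) : Scal := fun ρ z => 2 * m * a * (rad ρ z + m) / kN m ρ z

lemma le_kN (hm : 0 < m) (h : 0 < ρ) : (rad ρ z + m) ^ 4 ≤ kN m ρ z := by
  have hr := rad_pos (z := z) h
  have h1 : ρ ^ 2 ≤ rad ρ z ^ 2 := pow_le_pow_left₀ h.le left_le_rad 2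
  have h2 : m ^ 2 * ρ ^ 2 ≤ m ^ 2 * (rad ρ z + m) ^ 2 := by gcongr; nlinarith
  unfold kN
  nlinarith [sq_nonneg (m * (rad ρ z + m)), sq_nonneg (m ^ 2)]

lemma kN_le (hm : 0 < m) (h : 0 < ρ) : kN m ρ z ≤ 4 * (rad ρ z + m) ^ 4 := by
  have hr := rad_pos (z := z) h
  have h1 : m ^ 2 ≤ (rad ρ z + m) ^ 2 := by gcongr; linarith
  have h2 : ((rad ρ z + m) ^ 2 + m ^ 2) ^ 2 ≤ (2 * (rad ρ z + m) ^ 2) ^ 2 := by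
    gcongr; linarith
  unfold kN
  nlinarith [sq_nonneg (m * ρ)]

lemma kN_pos (hm : 0 < m) (h : 0 < ρ) : 0 < kN m ρ z := by
  have hr := rad_pos (z := z) h
  exact lt_of_lt_of_le (by positivity) (le_kN hm h)

lemma le_kS : rad ρ z ^ 2 * (rad ρ z + m) ^ 2 ≤ kS m ρ z := by
  unfold kS; nlinarith [sq_nonneg (m * z)]

lemma kS_le (hm : 0 < m) : kS m ρ z ≤ 2 * (rad ρ z ^ 2 * (rad ρ z + m) ^ 2) := by
  have hr := rad_nonneg (ρ := ρ) (z := z)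
  have h1 : m ^ 2 ≤ (rad ρ z + m) ^ 2 := by gcongr; linarith
  have h2 : z ^ 2 ≤ rad ρ z ^ 2 := by nlinarith [rad_sq ρ z, sq_nonneg ρ]
  have : m ^ 2 * z ^ 2 ≤ (rad ρ z + m) ^ 2 * rad ρ z ^ 2 := by gcongr
  unfold kS; linarith

lemma kS_pos (hm : 0 < m) (h : 0 < ρ) : 0 < kS m ρ z := by
  have hr := rad_pos (z := z) h
  exact lt_of_lt_of_le (by positivity) le_kS

lemma sm_kN {I : Set ℝ} (m : ℝ) : Sm (dom I) (fun _ => kN m) :=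
  ((((sm_rad.add (Sm.const m)).pow 2).add (Sm.const (m ^ 2))).pow 2).sub
    ((Sm.const (m ^ 2)).mul (Sm.rho.pow 2))

lemma sm_kS {I : Set ℝ} (m : ℝ) : Sm (dom I) (fun _ => kS m) :=
  ((sm_rad.pow 2).mul ((sm_rad.add (Sm.const m)).pow 2)).add ((Sm.const (m ^ 2)).mul (sm_z.pow 2))

lemma sm_kW {I : Set ℝ} (hm : 0 < m) (a : ℝ) : Sm (dom I) (fun _ => kW m a) :=
  ((Sm.const (2 * m * a)).mul (sm_rad.add (Sm.const m))).div (sm_kN m)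
    fun _ hx => (kN_pos hm hx.2).ne'

lemma sq_of_abs_eq (ha : |a| = m) : a ^ 2 = m ^ 2 := by rw [← ha, sq_abs]

lemma kerrSig_eq (ha : |a| = m) (h : 0 < ρ) : kerrSig m a ρ z = kS m ρ z / rad ρ z ^ 2 := by
  have hr := rad_pos (z := z) h
  rw [kerrSig, kS, blRad, sq_of_abs_eq ha]
  field_simp

lemma eta0_eq (hm : 0 < m) (ha : |a| = m) (h : 0 < ρ) :
    eta0 m a ρ z = ρ ^ 2 * kN m ρ z / kS m ρ z := by
  have hr := rad_pos (z := z) h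
  have hS := kS_pos (z := z) hm h
  rw [eta0, kerrSig_eq ha h, kerrXi, blRad, sq_of_abs_eq ha, kN]
  field_simp
  ring

lemma omega0_eq (hm : 0 < m) (ha : |a| = m) (h : 0 < ρ) :
    omega0 m a ρ z = 2 * m * a * ((z / rad ρ z) ^ 3 - 3 * (z / rad ρ z)
      - m ^ 2 * (z * (rad ρ z ^ 2 - z ^ 2) ^ 2) / (rad ρ z ^ 3 * kS m ρ z)) := by
  have hr := rad_pos (z := z) h
  have hS := kS_pos (z := z) hm h
  have e : 2 * m * a ^ 3 = 2 * m * a * m ^ 2 := by rw [← sq_of_abs_eq ha]; ring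
  have e2 : rad ρ z ^ 2 - z ^ 2 = ρ ^ 2 := by rw [rad_sq]; ring
  rw [omega0, kerrSig_eq ha h, e, e2]
  field_simp

lemma sigma0_eq (hm : 0 < m) (ha : |a| = m) (h : 0 < ρ) :
    sigma0 m a ρ z = Real.log (kN m ρ z) - Real.log (kS m ρ z) := by
  rw [sigma0, eta0_eq hm ha h, ← Real.log_div (kN_pos hm h).ne' (kS_pos hm h).ne']
  congr 1
  field_simp

lemma exp_two_u0 (hm : 0 < m) (ha : |a| = m) (h : 0 < ρ) :
    Real.exp (2 * u0 m a ρ z) = ρ ^ 2 * kN m ρ z / rad ρ z ^ 4 := by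
  have hr := rad_pos (z := z) h
  have hS := kS_pos (z := z) hm h
  have hN := kN_pos (z := z) hm h
  have : eta0 m a ρ z * kerrSig m a ρ z / rad ρ z ^ 2 = ρ ^ 2 * kN m ρ z / rad ρ z ^ 4 := by
    rw [eta0_eq hm ha h, kerrSig_eq ha h]; field_simp
  rw [u0, this, mul_div_cancel₀ _ two_ne_zero, Real.exp_log (by positivity)]

lemma eta0_pos (hm : 0 < m) (ha : |a| = m) (h : 0 < ρ) : 0 < eta0 m a ρ z := by
  have hS := kS_pos (z := z) hm h
  have hN := kN_pos (z := z) hm h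
  rw [eta0_eq hm ha h]; positivity

section Smooth
variable {I : Set ℝ}

lemma sm_eta0 (hm : 0 < m) (ha : |a| = m) : Sm (dom I) (fun _ => eta0 m a) :=
  (((Sm.rho.pow 2).mul (sm_kN m)).div (sm_kS m) fun _ hx => (kS_pos hm hx.2).ne').congr
    fun _ hx => eta0_eq hm ha hx.2

lemma sm_omega0 (hm : 0 < m) (ha : |a| = m) : Sm (dom I) (fun _ => omega0 m a) := by
  have hc : Sm (dom I) (fun _ ρ z => z / rad ρ z) :=
    sm_z.div sm_rad fun _ hx => (rad_pos hx.2).ne'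
  refine Sm.congr ((Sm.const (2 * m * a)).mul (((hc.pow 3).sub ((Sm.const 3).mul hc)).sub
    (((Sm.const (m ^ 2)).mul (sm_z.mul (((sm_rad.pow 2).sub (sm_z.pow 2)).pow 2))).div
      ((sm_rad.pow 3).mul (sm_kS m)) ?_)))
    fun _ hx => omega0_eq hm ha hx.2
  intro x hx
  have := rad_pos (z := x.2.2) hx.2
  have := kS_pos (z := x.2.2) hm hx.2
  positivity

lemma sm_sigma0 (hm : 0 < m) (ha : |a| = m) : Sm (dom I) (fun _ => sigma0 m a) :=
  (((sm_kN m).log fun _ hx => (kN_pos hm hx.2).ne').sub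
    ((sm_kS m).log fun _ hx => (kS_pos hm hx.2).ne')).congr fun _ hx => sigma0_eq hm ha hx.2

lemma sm_exp_two_u0 (hm : 0 < m) (ha : |a| = m) :
    Sm (dom I) (fun _ ρ z => Real.exp (2 * u0 m a ρ z)) :=
  (((Sm.rho.pow 2).mul (sm_kN m)).div (sm_rad.pow 4)
    fun _ hx => (pow_pos (rad_pos hx.2) 4).ne').congr fun _ hx => exp_two_u0 hm ha hx.2

end Smooth

/-! ### First derivatives of the background -/

lemma pd_kN (h : 0 < ρ) (A : Fin 2) :
    pd A (kN m) ρ z = 4 * ((rad ρ z + m) ^ 2 + m ^ 2) * (rad ρ z + m) * pd A rad ρ z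
      - 2 * m ^ 2 * ρ * pd A rhoC ρ z := by
  have hr := diffS_rad (z := z) h
  fin_cases A
  · refine pd_zero_eq ?_
    have := ((((hr.slice0.add_const m).pow 2).add_const (m ^ 2)).pow 2).sub
      (((hasDerivAt_id ρ).pow 2).const_mul (m ^ 2))
    refine this.congr_deriv ?_
    simp [pd_rhoC_zero]; ring
  · refine pd_one_eq ?_
    have := ((((hr.slice1.add_const m).pow 2).add_const (m ^ 2)).pow 2).sub_const (m ^ 2 * ρ ^ 2)
    refine this.congr_deriv ?_
    simp [pd_rhoC_one]; ring

lemma pd_kS_zero (h : 0 < ρ) :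
    pd 0 (kS m) ρ z = 2 * (rad ρ z + m) * (2 * rad ρ z + m) * ρ := by
  have hr := diffS_rad (z := z) h
  have hr0 := rad_pos (z := z) h
  refine pd_zero_eq ?_
  have := ((hr.slice0.pow 2).mul ((hr.slice0.add_const m).pow 2)).add_const (m ^ 2 * z ^ 2)
  refine this.congr_deriv ?_
  simp [pd_zero_rad h]; field_simp; ring

lemma pd_kS_one (h : 0 < ρ) :
    pd 1 (kS m) ρ z = 2 * (rad ρ z + m) * (2 * rad ρ z + m) * z + 2 * m ^ 2 * z := by
  have hr := diffS_rad (z := z) h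
  have hr0 := rad_pos (z := z) h
  refine pd_one_eq ?_
  have := ((hr.slice1.pow 2).mul ((hr.slice1.add_const m).pow 2)).add
    (((hasDerivAt_id z).pow 2).const_mul (m ^ 2))
  refine this.congr_deriv ?_
  simp [pd_one_rad h]; field_simp; ring

lemma pd_kN_zero (h : 0 < ρ) :
    pd 0 (kN m) ρ z
      = (4 * ((rad ρ z + m) ^ 2 + m ^ 2) * (rad ρ z + m) / rad ρ z - 2 * m ^ 2) * ρ := by
  rw [pd_kN h, pd_zero_rad h, pd_rhoC_zero]; ring

lemma pd_kN_one (h : 0 < ρ) :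
    pd 1 (kN m) ρ z
      = 4 * ((rad ρ z + m) ^ 2 + m ^ 2) * (rad ρ z + m) / rad ρ z * z := by
  rw [pd_kN h, pd_one_rad h, pd_rhoC_one]; ring

lemma pd_kW (hm : 0 < m) (h : 0 < ρ) (A : Fin 2) :
    pd A (kW m a) ρ z = 2 * m * a *
      (pd A rad ρ z * kN m ρ z - (rad ρ z + m) * pd A (kN m) ρ z) / kN m ρ z ^ 2 := by
  have hr := diffS_rad (z := z) h
  have hN := Sm.diffS_static (z := z) (sm_kN m) h
  have hN0 := (kN_pos (z := z) hm h).ne'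
  fin_cases A
  · refine pd_zero_eq ?_
    have := ((hr.slice0.add_const m).const_mul (2 * m * a)).div hN.slice0 hN0
    refine this.congr_deriv ?_
    simp; ring
  · refine pd_one_eq ?_
    have := ((hr.slice1.add_const m).const_mul (2 * m * a)).div hN.slice1 hN0
    refine this.congr_deriv ?_
    simp; ring

lemma pd_sigma0 (hm : 0 < m) (ha : |a| = m) (h : 0 < ρ) (A : Fin 2) :
    pd A (sigma0 m a) ρ z = pd A (kN m) ρ z / kN m ρ z - pd A (kS m) ρ z / kS m ρ z := by
  rw [pd_congr_halfPlane (fun ρ hρ z => sigma0_eq hm ha hρ) h]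
  have hN := Sm.diffS_static (z := z) (sm_kN m) h
  have hS := Sm.diffS_static (z := z) (sm_kS m) h
  have hN0 := (kN_pos (z := z) hm h).ne'
  have hS0 := (kS_pos (z := z) hm h).ne'
  fin_cases A
  · exact pd_zero_eq ((hN.slice0.log hN0).sub (hS.slice0.log hS0))
  · exact pd_one_eq ((hN.slice1.log hN0).sub (hS.slice1.log hS0))

lemma pd_eta0 (hm : 0 < m) (ha : |a| = m) (h : 0 < ρ) (A : Fin 2) :
    pd A (eta0 m a) ρ z
      = eta0 m a ρ z * (2 * pd A rhoC ρ z / ρ + pd A (sigma0 m a) ρ z) := by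
  rw [pd_congr_halfPlane (fun ρ hρ z => eta0_eq hm ha hρ) h, pd_sigma0 hm ha h, eta0_eq hm ha h]
  have hN := Sm.diffS_static (z := z) (sm_kN m) h
  have hS := Sm.diffS_static (z := z) (sm_kS m) h
  have hN0 := (kN_pos (z := z) hm h).ne'
  have hS0 := (kS_pos (z := z) hm h).ne'
  fin_cases A
  · refine pd_zero_eq (((((hasDerivAt_id ρ).pow 2).mul hN.slice0).div hS.slice0 hS0).congr_deriv ?_)
    simp [pd_rhoC_zero]; field_simp; ring
  · refine pd_one_eq (((hN.slice1.const_mul (ρ ^ 2)).div hS.slice1 hS0).congr_deriv ?_)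
    simp [pd_rhoC_one]; field_simp

/-- The twist potential `ω₀` and the angular velocity `W` are conjugate:
`∂_ρ ω₀ = -(η₀² / ρ) ∂_z W`. -/
lemma pd_zero_omega0 (hm : 0 < m) (ha : |a| = m) (h : 0 < ρ) :
    pd 0 (omega0 m a) ρ z = -(eta0 m a ρ z ^ 2 / ρ * pd 1 (kW m a) ρ z) := by
  rw [pd_congr_halfPlane (fun ρ hρ z => omega0_eq hm ha hρ) h, pd_kW hm h, eta0_eq hm ha h,
    pd_kN_one h, pd_one_rad h]
  have hr := diffS_rad (z := z) h
  have hr0 := rad_pos (z := z) h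
  have hS := Sm.diffS_static (z := z) (sm_kS m) h
  have hN0 := (kN_pos (z := z) hm h)
  have hS0 := (kS_pos (z := z) hm h)
  have hc := (hasDerivAt_const ρ z).div hr.slice0 hr0.ne'
  have hd := (((((hr.slice0.pow 2).sub_const (z ^ 2)).pow 2).const_mul z).const_mul
    (m ^ 2)).div ((hr.slice0.pow 3).mul hS.slice0)
    (by simp only [Pi.mul_apply, Pi.pow_apply]; positivity)
  refine pd_zero_eq (((((hc.pow 3).sub (hc.const_mul 3)).sub hd).const_mul
    (2 * m * a)).congr_deriv ?_)
  simp only [pd_zero_rad h, pd_kS_zero h, Pi.mul_apply, Pi.pow_apply, Pi.div_apply,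
    Nat.reduceSub, Nat.cast_ofNat]
  have hz : ρ ^ 2 = rad ρ z ^ 2 - z ^ 2 := by rw [rad_sq]; ring
  have e : (ρ ^ 2 * kN m ρ z / kS m ρ z) ^ 2 / ρ
      = ρ * (rad ρ z ^ 2 - z ^ 2) * (kN m ρ z / kS m ρ z) ^ 2 := by
    rw [← hz]; field_simp
  rw [e]
  field_simp
  simp only [kS, kN, hz]
  ring

lemma pd_one_omega0 (hm : 0 < m) (ha : |a| = m) (h : 0 < ρ) :
    pd 1 (omega0 m a) ρ z = eta0 m a ρ z ^ 2 / ρ * pd 0 (kW m a) ρ z := by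
  rw [pd_congr_halfPlane (fun ρ hρ z => omega0_eq hm ha hρ) h, pd_kW hm h, eta0_eq hm ha h,
    pd_kN_zero h, pd_zero_rad h]
  have hr := diffS_rad (z := z) h
  have hr0 := rad_pos (z := z) h
  have hS := Sm.diffS_static (z := z) (sm_kS m) h
  have hN0 := (kN_pos (z := z) hm h)
  have hS0 := (kS_pos (z := z) hm h)
  have hc := (hasDerivAt_id z).div hr.slice1 hr0.ne'
  have hd := (((hasDerivAt_id z).mul (((hr.slice1.pow 2).sub ((hasDerivAt_id z).pow 2)).pow
    2)).const_mul (m ^ 2)).div ((hr.slice1.pow 3).mul hS.slice1)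
    (by simp only [Pi.mul_apply, Pi.pow_apply]; positivity)
  refine pd_one_eq (((((hc.pow 3).sub (hc.const_mul 3)).sub hd).const_mul
    (2 * m * a)).congr_deriv ?_)
  simp only [pd_one_rad h, pd_kS_one h, Pi.mul_apply, Pi.pow_apply, Pi.div_apply, Pi.sub_apply,
    id, Nat.reduceSub, Nat.cast_ofNat]
  have hz : ρ ^ 2 = rad ρ z ^ 2 - z ^ 2 := by rw [rad_sq]; ring
  have e : ∀ x, (ρ ^ 2 * kN m ρ z / kS m ρ z) ^ 2 / ρ * (2 * m * a * x / kN m ρ z ^ 2)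
      = (rad ρ z ^ 2 - z ^ 2) ^ 2 * (2 * m * a * (x / ρ) / kS m ρ z ^ 2) := by
    intro x; rw [← hz]; field_simp
  rw [e]
  field_simp
  simp only [kS, kN, hz]
  ring

/-! ### The field equations of the background -/

/-- The equation of `ω₀` holds because `ρ ∂ω₀ / η₀²` is a rotated gradient. -/
lemma lap3_omega0 (hm : 0 < m) (ha : |a| = m) (h : 0 < ρ) :
    lap3 (omega0 m a) ρ z = 2 * gdot (omega0 m a) (eta0 m a) ρ z / eta0 m a ρ z := by
  have he := Sm.diffS_static (z := z) (sm_eta0 hm ha) h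
  have he0 := eta0_pos (z := z) hm ha h
  have hU := isOpen_dom isOpen_univ
  have hW := sm_kW (I := Set.univ) hm a
  have hW1 := Sm.diffS_static (z := z) (f := pd 1 (kW m a)) (hW.pd hU 1) h
  have hW0 := Sm.diffS_static (z := z) (f := pd 0 (kW m a)) (hW.pd hU 0) h
  have hc : pd 0 (pd 1 (kW m a)) ρ z = pd 1 (pd 0 (kW m a)) ρ z :=
    hW.pd_comm hU (show ((0 : ℝ), ρ, z) ∈ dom Set.univ from ⟨trivial, h⟩) 0 1
  have e0 : pd 0 (pd 0 (omega0 m a)) ρ z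
      = -((2 * eta0 m a ρ z * pd 0 (eta0 m a) ρ z * ρ - eta0 m a ρ z ^ 2) / ρ ^ 2
          * pd 1 (kW m a) ρ z + eta0 m a ρ z ^ 2 / ρ * pd 0 (pd 1 (kW m a)) ρ z) := by
    rw [pd_congr_halfPlane (fun ρ hρ z => pd_zero_omega0 hm ha hρ) h]
    refine pd_zero_eq (((((he.slice0.pow 2).div (hasDerivAt_id ρ) h.ne').mul
      hW1.slice0).neg).congr_deriv ?_)
    simp
  have e1 : pd 1 (pd 1 (omega0 m a)) ρ z
      = 2 * eta0 m a ρ z * pd 1 (eta0 m a) ρ z / ρ * pd 0 (kW m a) ρ z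
        + eta0 m a ρ z ^ 2 / ρ * pd 1 (pd 0 (kW m a)) ρ z := by
    rw [pd_congr_halfPlane (fun ρ hρ z => pd_one_omega0 hm ha hρ) h]
    refine pd_one_eq ((((he.slice1.pow 2).div_const ρ).mul hW0.slice1).congr_deriv ?_)
    simp
  simp only [lap3, lap2, gdot, Fin.sum_univ_two]
  rw [e0, e1, hc, pd_zero_omega0 hm ha h, pd_one_omega0 hm ha h]
  field_simp
  ring

lemma lap3_log {f : Scal} (hf : Sm (dom Set.univ) (fun _ => f)) (hpos : ∀ ρ > 0, ∀ z, 0 < f ρ z)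
    (h : 0 < ρ) : ∀ A, pd A (pd A fun ρ z => Real.log (f ρ z)) ρ z
      = pd A (pd A f) ρ z / f ρ z - pd A f ρ z ^ 2 / f ρ z ^ 2 := by
  intro A
  have e : ∀ ρ > 0, ∀ z, pd A (fun ρ z => Real.log (f ρ z)) ρ z = pd A f ρ z / f ρ z := by
    intro ρ h z
    have hd := Sm.diffS_static (z := z) hf h
    fin_cases A
    · exact pd_zero_eq (hd.slice0.log (hpos ρ h z).ne')
    · exact pd_one_eq (hd.slice1.log (hpos ρ h z).ne')
  have h0 := hpos ρ h z
  rw [pd_congr_halfPlane e h, pd_div (Sm.diffS_static (f := pd A f)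
    (hf.pd (isOpen_dom isOpen_univ) A) h) (Sm.diffS_static hf h) h0.ne']
  field_simp

/-- The equation of `σ₀`. -/
lemma lap3_sigma0 (hm : 0 < m) (ha : |a| = m) (h : 0 < ρ) :
    lap3 (sigma0 m a) ρ z
      = -(gdot (omega0 m a) (omega0 m a) ρ z / eta0 m a ρ z ^ 2) := by
  have hr := diffS_rad (z := z) h
  have hr0 := rad_pos (z := z) h
  have hN0 := kN_pos (z := z) hm h
  have hS0 := kS_pos (z := z) hm h
  have hU := isOpen_dom isOpen_univ
  have hlN := (sm_kN (I := Set.univ) m).log fun _ hx => (kN_pos hm hx.2).ne'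
  have hlS := (sm_kS (I := Set.univ) m).log fun _ hx => (kS_pos hm hx.2).ne'
  have e : ∀ A, pd A (pd A (sigma0 m a)) ρ z
      = (pd A (pd A (kN m)) ρ z / kN m ρ z - pd A (kN m) ρ z ^ 2 / kN m ρ z ^ 2)
        - (pd A (pd A (kS m)) ρ z / kS m ρ z - pd A (kS m) ρ z ^ 2 / kS m ρ z ^ 2) := by
    intro A
    rw [← lap3_log (sm_kN m) (fun ρ h z => kN_pos hm h) h A,
      ← lap3_log (sm_kS m) (fun ρ h z => kS_pos hm h) h A]
    have d1 : DiffS (pd A fun ρ z => Real.log (kN m ρ z)) ρ z :=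
      Sm.diffS_static (f := pd A fun ρ z => Real.log (kN m ρ z)) (hlN.pd hU A) h
    have d2 : DiffS (pd A fun ρ z => Real.log (kS m ρ z)) ρ z :=
      Sm.diffS_static (f := pd A fun ρ z => Real.log (kS m ρ z)) (hlS.pd hU A) h
    have e1 : ∀ ρ > 0, ∀ z, pd A (sigma0 m a) ρ z
        = pd A (fun ρ z => Real.log (kN m ρ z)) ρ z
          - pd A (fun ρ z => Real.log (kS m ρ z)) ρ z := by
      intro ρ h z
      rw [pd_congr_halfPlane (fun ρ hρ z => sigma0_eq hm ha hρ) h]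
      have f1 := Sm.diffS_static (z := z) hlN h
      have f2 := Sm.diffS_static (z := z) hlS h
      fin_cases A
      · exact pd_zero_eq (f1.slice0.sub f2.slice0)
      · exact pd_one_eq (f1.slice1.sub f2.slice1)
    rw [pd_congr_halfPlane e1 h]
    fin_cases A
    · exact pd_zero_eq (d1.slice0.sub d2.slice0)
    · exact pd_one_eq (d1.slice1.sub d2.slice1)
  have hQ0 := ((((hr.slice0.add_const m).pow 2).add_const (m ^ 2)).const_mul 4).mul
    (hr.slice0.add_const m)
  have hQ1 := ((((hr.slice1.add_const m).pow 2).add_const (m ^ 2)).const_mul 4).mul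
    (hr.slice1.add_const m)
  have hP0 := ((hr.slice0.add_const m).const_mul 2).mul ((hr.slice0.const_mul 2).add_const m)
  have hP1 := ((hr.slice1.add_const m).const_mul 2).mul ((hr.slice1.const_mul 2).add_const m)
  have n0 := pd_zero_eq (f := pd 0 (kN m)) ((((hQ0.div hr.slice0 hr0.ne').sub_const
    (2 * m ^ 2)).mul (hasDerivAt_id ρ)).congr_of_eventuallyEq
      (eventually_of_mem (Ioi_mem_nhds h) fun s hs => pd_kN_zero hs))
  have n1 := pd_one_eq (f := pd 1 (kN m)) (((hQ1.div hr.slice1 hr0.ne').mul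
    (hasDerivAt_id z)).congr_of_eventuallyEq (Eventually.of_forall fun s => pd_kN_one h))
  have s0 := pd_zero_eq (f := pd 0 (kS m)) ((hP0.mul (hasDerivAt_id ρ)).congr_of_eventuallyEq
      (eventually_of_mem (Ioi_mem_nhds h) fun s hs => pd_kS_zero hs))
  have s1 := pd_one_eq (f := pd 1 (kS m)) (((hP1.mul (hasDerivAt_id z)).add
    ((hasDerivAt_id z).const_mul (2 * m ^ 2))).congr_of_eventuallyEq
      (Eventually.of_forall fun s => pd_kS_one h))
  have ea := sq_of_abs_eq ha
  simp only [lap3, lap2, gdot, Fin.sum_univ_two]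
  rw [e, e, n0, n1, s0, s1, pd_zero_omega0 hm ha h, pd_one_omega0 hm ha h, pd_kW hm h, pd_kW hm h,
    pd_sigma0 hm ha h, eta0_eq hm ha h]
  simp only [pd_zero_rad h, pd_one_rad h, pd_kN_zero h, pd_kN_one h, pd_kS_zero h, pd_kS_one h,
    Pi.mul_apply, Pi.pow_apply, Pi.div_apply, id, Nat.reduceSub, Nat.cast_ofNat]
  have hz : ρ ^ 2 = rad ρ z ^ 2 - z ^ 2 := by rw [rad_sq]; ring
  field_simp
  simp only [kS, kN, hz, ea]
  ring
end

section
variable {ρ z m a : ℝ}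

/-! ### Bounds on the background -/

lemma kN_sub_kS : kN m ρ z - kS m ρ z
    = 2 * m * (rad ρ z + m) * ((rad ρ z + m) ^ 2 + m ^ 2) := by
  have hz : ρ ^ 2 = rad ρ z ^ 2 - z ^ 2 := by rw [rad_sq]; ring
  simp only [kN, kS, hz]; ring

lemma pd_kN_sub_pd_kS (h : 0 < ρ) (A : Fin 2) : pd A (kN m) ρ z - pd A (kS m) ρ z
    = 2 * m * (3 * (rad ρ z + m) ^ 2 + m ^ 2) * pd A rad ρ z := by
  have hr := rad_pos (z := z) h
  fin_cases A
  · simp only [Fin.zero_eta]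
    rw [pd_kN_zero h, pd_kS_zero h, pd_zero_rad h]; field_simp; ring
  · simp only [Fin.mk_one]
    rw [pd_kN_one h, pd_kS_one h, pd_one_rad h]; field_simp; ring

lemma abs_pd_kN_le (hm : 0 < m) (h : 0 < ρ) (A : Fin 2) :
    |pd A (kN m) ρ z| ≤ 10 * (rad ρ z + m) ^ 3 := by
  have hr := rad_pos (z := z) h
  have hy : m ≤ rad ρ z + m := by linarith
  have h1 := abs_pd_rad_le (z := z) h A
  have h2 : |pd A rhoC ρ z| ≤ 1 := by
    fin_cases A
    · simp [pd_rhoC_zero]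
    · simp [pd_rhoC_one]
  have h3 : m ^ 2 ≤ (rad ρ z + m) ^ 2 := by gcongr
  have h4 : ρ ≤ rad ρ z + m := by linarith [left_le_rad (ρ := ρ) (z := z)]
  rw [pd_kN h]
  refine (abs_sub _ _).trans ?_
  rw [abs_mul, abs_mul _ (pd A rhoC ρ z), abs_of_pos (by positivity :
    0 < 4 * ((rad ρ z + m) ^ 2 + m ^ 2) * (rad ρ z + m)), abs_of_pos (by positivity :
    0 < 2 * m ^ 2 * ρ)]
  calc _ ≤ 4 * ((rad ρ z + m) ^ 2 + (rad ρ z + m) ^ 2) * (rad ρ z + m) * 1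
        + 2 * (rad ρ z + m) ^ 2 * (rad ρ z + m) * 1 := by gcongr
    _ = _ := by ring

lemma abs_pd_kS_le (hm : 0 < m) (h : 0 < ρ) (A : Fin 2) :
    |pd A (kS m) ρ z| ≤ 6 * rad ρ z * (rad ρ z + m) ^ 2 := by
  have hr := rad_pos (z := z) h
  have hy : m ≤ rad ρ z + m := by linarith
  have hz := abs_right_le_rad (ρ := ρ) (z := z)
  have hl := left_le_rad (ρ := ρ) (z := z)
  have h3 : m ^ 2 ≤ (rad ρ z + m) ^ 2 := by gcongr
  fin_cases A
  · simp only [Fin.zero_eta]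
    rw [pd_kS_zero h, abs_of_pos (by positivity)]
    calc _ ≤ 2 * (rad ρ z + m) * (2 * (rad ρ z + m)) * rad ρ z := by gcongr; linarith
      _ ≤ _ := by nlinarith [mul_pos hr (pow_pos (by positivity : 0 < rad ρ z + m) 2)]
  · simp only [Fin.mk_one]
    rw [pd_kS_one h, show 2 * (rad ρ z + m) * (2 * rad ρ z + m) * z + 2 * m ^ 2 * z
      = (2 * (rad ρ z + m) * (2 * rad ρ z + m) + 2 * m ^ 2) * z by ring, abs_mul,
      abs_of_pos (by positivity)]
    calc _ ≤ (2 * (rad ρ z + m) * (2 * (rad ρ z + m)) + 2 * (rad ρ z + m) ^ 2) * rad ρ z := by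
          gcongr; linarith
      _ = _ := by ring

lemma eta0_le (hm : 0 < m) (ha : |a| = m) (h : 0 < ρ) :
    eta0 m a ρ z ≤ 4 * (ρ ^ 2 * (rad ρ z + m) ^ 2 / rad ρ z ^ 2) := by
  have hr := rad_pos (z := z) h
  rw [eta0_eq hm ha h]
  calc _ ≤ ρ ^ 2 * (4 * (rad ρ z + m) ^ 4) / (rad ρ z ^ 2 * (rad ρ z + m) ^ 2) := by
        gcongr
        · exact kN_le hm h
        · exact le_kS
    _ = _ := by field_simp

lemma le_eta0 (hm : 0 < m) (ha : |a| = m) (h : 0 < ρ) :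
    ρ ^ 2 * (rad ρ z + m) ^ 2 / rad ρ z ^ 2 ≤ 2 * eta0 m a ρ z := by
  have hr := rad_pos (z := z) h
  have hS := kS_pos (z := z) hm h
  rw [eta0_eq hm ha h]
  calc _ = 2 * (ρ ^ 2 * (rad ρ z + m) ^ 4 / (2 * (rad ρ z ^ 2 * (rad ρ z + m) ^ 2))) := by
        field_simp
    _ ≤ _ :=
        mul_le_mul_of_nonneg_left (div_le_div₀ (mul_nonneg (sq_nonneg ρ) (kN_pos hm h).le)
          (mul_le_mul_of_nonneg_left (le_kN hm h) (sq_nonneg ρ)) hS (kS_le hm)) two_pos.le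

/-- The leading terms of `log N` and of `log S` cancel in `σ₀`, which improves the decay of `∂σ₀`
at infinity by one order. -/
lemma abs_pd_sigma0_le (hm : 0 < m) (ha : |a| = m) (h : 0 < ρ) (A : Fin 2) :
    |pd A (sigma0 m a) ρ z| ≤ 32 * m / (rad ρ z * (rad ρ z + m)) := by
  have hr := rad_pos (z := z) h
  have hN := kN_pos (z := z) hm h
  have hS := kS_pos (z := z) hm h
  have hy : m ≤ rad ρ z + m := by linarith
  have hy2 : rad ρ z ≤ rad ρ z + m := by linarith
  have h3 : m ^ 2 ≤ (rad ρ z + m) ^ 2 := by gcongr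
  have e : pd A (sigma0 m a) ρ z = (pd A (kN m) ρ z - pd A (kS m) ρ z) / kN m ρ z
      - (kN m ρ z - kS m ρ z) * pd A (kS m) ρ z / (kN m ρ z * kS m ρ z) := by
    rw [pd_sigma0 hm ha h]; field_simp; ring
  rw [e, pd_kN_sub_pd_kS h, kN_sub_kS]
  refine (abs_sub _ _).trans ?_
  rw [abs_div, abs_div, abs_mul, abs_mul _ (pd A (kS m) ρ z), abs_of_pos hN,
    abs_of_pos (mul_pos hN hS), abs_of_pos (by positivity :
      0 < 2 * m * (3 * (rad ρ z + m) ^ 2 + m ^ 2)), abs_of_pos (by positivity :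
      0 < 2 * m * (rad ρ z + m) * ((rad ρ z + m) ^ 2 + m ^ 2))]
  calc _ ≤ 2 * m * (3 * (rad ρ z + m) ^ 2 + (rad ρ z + m) ^ 2) * 1 / (rad ρ z + m) ^ 4
        + 2 * m * (rad ρ z + m) * ((rad ρ z + m) ^ 2 + (rad ρ z + m) ^ 2)
          * (6 * rad ρ z * (rad ρ z + m) ^ 2)
          / ((rad ρ z + m) ^ 4 * (rad ρ z ^ 2 * (rad ρ z + m) ^ 2)) := by
        gcongr
        · exact abs_pd_rad_le h A
        · exact le_kN hm h
        · exact abs_pd_kS_le hm h A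
        · exact le_kN hm h
        · exact le_kS
    _ = 8 * m / ((rad ρ z + m) * (rad ρ z + m)) + 24 * m / (rad ρ z * (rad ρ z + m)) := by
        field_simp; ring
    _ ≤ 8 * m / (rad ρ z * (rad ρ z + m)) + 24 * m / (rad ρ z * (rad ρ z + m)) := by gcongr
    _ = _ := by ring

lemma abs_pd_eta0_le (hm : 0 < m) (ha : |a| = m) (h : 0 < ρ) (A : Fin 2) :
    |pd A (eta0 m a) ρ z| ≤ 34 * eta0 m a ρ z / ρ := by
  have hr := rad_pos (z := z) h
  have he := eta0_pos (z := z) hm ha h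
  have h1 := abs_pd_sigma0_le (z := z) hm ha h A
  have h2 : |2 * pd A rhoC ρ z / ρ| ≤ 2 / ρ := by
    fin_cases A
    · simp [pd_rhoC_zero, abs_of_pos (div_pos two_pos h)]
    · simp [pd_rhoC_one, (div_pos two_pos h).le]
  have h3 : 32 * m / (rad ρ z * (rad ρ z + m)) ≤ 32 / ρ := by
    calc _ ≤ 32 * (rad ρ z + m) / (ρ * (rad ρ z + m)) := by
          gcongr
          · linarith
          · exact left_le_rad
      _ = _ := by field_simp
  rw [pd_eta0 hm ha h, abs_mul, abs_of_pos he]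
  calc _ ≤ eta0 m a ρ z * (2 / ρ + 32 / ρ) := by
        gcongr; exact (abs_add_le _ _).trans (add_le_add h2 (h1.trans h3))
    _ = _ := by ring

lemma abs_pd_kW_le (hm : 0 < m) (ha : |a| = m) (h : 0 < ρ) (A : Fin 2) :
    |pd A (kW m a) ρ z| ≤ 28 * m ^ 2 * (rad ρ z + m) ^ 4 / kN m ρ z ^ 2 := by
  have hr := rad_pos (z := z) h
  have hN := kN_pos (z := z) hm h
  rw [pd_kW hm h, abs_div, abs_mul, abs_mul, ha, abs_of_pos (pow_pos hN 2), abs_of_pos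
    (by positivity : 0 < 2 * m)]
  have : |pd A rad ρ z * kN m ρ z - (rad ρ z + m) * pd A (kN m) ρ z|
      ≤ 14 * (rad ρ z + m) ^ 4 := by
    refine (abs_sub _ _).trans ?_
    rw [abs_mul, abs_mul, abs_of_pos hN, abs_of_pos (by positivity : 0 < rad ρ z + m)]
    calc _ ≤ 1 * (4 * (rad ρ z + m) ^ 4) + (rad ρ z + m) * (10 * (rad ρ z + m) ^ 3) := by
          gcongr
          · exact abs_pd_rad_le h A
          · exact kN_le hm h
          · exact abs_pd_kN_le hm h A
      _ = _ := by ring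
  calc _ ≤ 2 * m * m * (14 * (rad ρ z + m) ^ 4) / kN m ρ z ^ 2 := by gcongr
    _ = _ := by ring

lemma abs_pd_omega0_le (hm : 0 < m) (ha : |a| = m) (h : 0 < ρ) (A : Fin 2) :
    |pd A (omega0 m a) ρ z| ≤ 28 * m ^ 2 * ρ ^ 3 / rad ρ z ^ 4 := by
  have hr := rad_pos (z := z) h
  have hN := kN_pos (z := z) hm h
  have hS := kS_pos (z := z) hm h
  have he := eta0_pos (z := z) hm ha h
  have key : ∀ B, |eta0 m a ρ z ^ 2 / ρ * pd B (kW m a) ρ z|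
      ≤ 28 * m ^ 2 * ρ ^ 3 / rad ρ z ^ 4 := by
    intro B
    rw [abs_mul, abs_of_pos (by positivity)]
    calc _ ≤ eta0 m a ρ z ^ 2 / ρ * (28 * m ^ 2 * (rad ρ z + m) ^ 4 / kN m ρ z ^ 2) := by
          gcongr; exact abs_pd_kW_le hm ha h B
      _ = 28 * m ^ 2 * ρ ^ 3 * (rad ρ z + m) ^ 4 / kS m ρ z ^ 2 := by
          rw [eta0_eq hm ha h]; field_simp
      _ ≤ 28 * m ^ 2 * ρ ^ 3 * (rad ρ z + m) ^ 4 / (rad ρ z ^ 2 * (rad ρ z + m) ^ 2) ^ 2 := by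
          gcongr; exact le_kS
      _ = _ := by field_simp
  fin_cases A
  · simp only [Fin.zero_eta]; rw [pd_zero_omega0 hm ha h, abs_neg]; exact key 1
  · simp only [Fin.mk_one]; rw [pd_one_omega0 hm ha h]; exact key 0

/-- `∂ω₀ / η₀` is bounded by a multiple of `ρ / (r² (r + m)²)`. -/
lemma abs_pd_omega0_div_eta0_le (hm : 0 < m) (ha : |a| = m) (h : 0 < ρ) (A : Fin 2) :
    |pd A (omega0 m a) ρ z / eta0 m a ρ z|
      ≤ 56 * m ^ 2 * ρ / (rad ρ z ^ 2 * (rad ρ z + m) ^ 2) := by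
  have hr := rad_pos (z := z) h
  have he := eta0_pos (z := z) hm ha h
  rw [abs_div, abs_of_pos he, div_le_iff₀ he]
  calc _ ≤ 28 * m ^ 2 * ρ ^ 3 / rad ρ z ^ 4 := abs_pd_omega0_le hm ha h A
    _ = 28 * m ^ 2 * ρ / (rad ρ z ^ 2 * (rad ρ z + m) ^ 2)
        * (ρ ^ 2 * (rad ρ z + m) ^ 2 / rad ρ z ^ 2) := by field_simp
    _ ≤ 28 * m ^ 2 * ρ / (rad ρ z ^ 2 * (rad ρ z + m) ^ 2) * (2 * eta0 m a ρ z) := by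
        gcongr; exact le_eta0 hm ha h
    _ = _ := by ring
end

section
variable {ρ z : ℝ}

/-! ### The divergence theorem on half annuli -/

lemma rad_polar {r θ : ℝ} (hr : 0 ≤ r) : rad (r * Real.cos θ) (r * Real.sin θ) = r := by
  rw [rad, show (r * Real.cos θ) ^ 2 + (r * Real.sin θ) ^ 2 = r ^ 2 by
    linear_combination r ^ 2 * Real.cos_sq_add_sin_sq θ, Real.sqrt_sq hr]

lemma measurableSet_halfAnnulus (δ L : ℝ) : MeasurableSet (halfAnnulus δ L) :=
  measurableSet_halfPlane.inter
    ((isOpen_lt continuous_const continuous_rad).measurableSet.inter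
      (isOpen_lt continuous_rad continuous_const).measurableSet)

lemma halfAnnulus_subset {δ L : ℝ} : halfAnnulus δ L ⊆ halfPlane := fun _ hx => hx.1

lemma volume_halfAnnulus_lt_top (δ L : ℝ) : volume (halfAnnulus δ L) < ⊤ := by
  refine (measure_mono (t := Metric.closedBall (0 : ℝ × ℝ) L) fun x hx => ?_).trans_lt
    (isCompact_closedBall _ _).measure_lt_top
  rw [mem_closedBall_zero_iff, Prod.norm_def, max_le_iff]
  exact ⟨abs_left_le_rad.trans hx.2.2.le, abs_right_le_rad.trans hx.2.2.le⟩

lemma integrableOn_halfAnnulus {f : ℝ × ℝ → ℝ} {δ L D : ℝ} (hc : ContinuousOn f halfPlane)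
    (hD : ∀ x ∈ halfAnnulus δ L, |f x| ≤ D) : IntegrableOn f (halfAnnulus δ L) :=
  IntegrableOn.of_bound (volume_halfAnnulus_lt_top δ L)
    ((hc.mono halfAnnulus_subset).aestronglyMeasurable (measurableSet_halfAnnulus δ L)) D
    (ae_restrict_of_forall_mem (measurableSet_halfAnnulus δ L) hD)

/-- The integral over a half annulus in polar coordinates `ρ = r cos θ`, `z = r sin θ`. -/
lemma setIntegral_halfAnnulus_polar (f : ℝ × ℝ → ℝ) {δ L : ℝ} (hδ : 0 < δ) :
    ∫ x in halfAnnulus δ L, f x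
      = ∫ p in Set.Ioo δ L ×ˢ Set.Ioo (-(Real.pi / 2)) (Real.pi / 2),
          p.1 * f (p.1 * Real.cos p.2, p.1 * Real.sin p.2) := by
  rw [← integral_indicator (measurableSet_halfAnnulus δ L), ← integral_comp_polarCoord_symm,
    ← integral_indicator polarCoord.open_target.measurableSet,
    ← integral_indicator (measurableSet_Ioo.prod measurableSet_Ioo)]
  congr 1
  ext ⟨r, θ⟩
  have hpi := Real.pi_pos
  by_cases hp : (r, θ) ∈ Set.Ioo δ L ×ˢ Set.Ioo (-(Real.pi / 2)) (Real.pi / 2)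
  · have hr : 0 < r := hδ.trans hp.1.1
    have hmem : (r * Real.cos θ, r * Real.sin θ) ∈ halfAnnulus δ L := by
      refine ⟨mul_pos hr (Real.cos_pos_of_mem_Ioo ⟨by linarith [hp.2.1], hp.2.2⟩), ?_⟩
      simp only [rad_polar hr.le]
      exact hp.1
    rw [Set.indicator_of_mem hp, Set.indicator_of_mem, polarCoord_symm_apply,
      Set.indicator_of_mem hmem, smul_eq_mul]
    exact ⟨hr, by linarith [hp.2.1], by linarith [hp.2.2]⟩
  · rw [Set.indicator_of_notMem hp]
    by_cases ht : (r, θ) ∈ polarCoord.target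
    · have hr : 0 < r := ht.1
      rw [Set.indicator_of_mem ht, polarCoord_symm_apply, Set.indicator_of_notMem, smul_zero]
      rintro ⟨h1, h2⟩
      simp only [rad_polar hr.le] at h2
      refine hp ⟨h2, ?_⟩
      have hc : 0 < Real.cos θ := pos_of_mul_pos_right h1 hr.le
      by_contra hθ
      rw [Set.mem_Ioo, not_and_or, not_lt, not_lt] at hθ
      have ht2 : -Real.pi < θ ∧ θ < Real.pi := ht.2
      rcases hθ with hθ | hθ
      · have := Real.cos_nonpos_of_pi_div_two_le_of_le (x := -θ) (by simpa using (neg_le_neg hθ))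
          (by linarith)
        rw [Real.cos_neg] at this; linarith
      · exact absurd (Real.cos_nonpos_of_pi_div_two_le_of_le (x := θ) hθ (by linarith))
          (not_le.2 hc)
    · rw [Set.indicator_of_notMem ht]

/-- The flux of a vector field that is `O(ρ)` at the axis through the boundary of a half annulus
comes from the two arcs only. -/
lemma abs_setIntegral_div_le {V : Fin 2 → Scal} {δ L C D bδ bL : ℝ} (hδ : 0 < δ) (hL : δ < L)
    (hd : ∀ A, ∀ ρ > 0, ∀ z, DiffS (V A) ρ z)
    (hC : ∀ A, ∀ ρ > 0, ∀ z, δ ≤ rad ρ z → rad ρ z ≤ L → |V A ρ z| ≤ C * ρ)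
    (hcont : ContinuousOn (fun x : ℝ × ℝ => ∑ A, pd A (V A) x.1 x.2) halfPlane)
    (hD : ∀ x ∈ halfAnnulus δ L, |∑ A, pd A (V A) x.1 x.2| ≤ D)
    (hbδ : ∀ A, ∀ ρ > 0, ∀ z, rad ρ z = δ → δ * |V A ρ z| ≤ bδ)
    (hbL : ∀ A, ∀ ρ > 0, ∀ z, rad ρ z = L → L * |V A ρ z| ≤ bL) :
    |∫ x in halfAnnulus δ L, ∑ A, pd A (V A) x.1 x.2| ≤ 2 * Real.pi * (bδ + bL) := by
  have hpi := Real.pi_pos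
  -- the components of the field in polar coordinates, set to zero at the axis
  set v : Fin 2 → ℝ × ℝ → ℝ := fun A p => V A (p.1 * Real.cos p.2) (p.1 * Real.sin p.2) with hv
  set P₀ : ℝ × ℝ → ℝ := fun p => p.1 * (Real.cos p.2 * v 0 p + Real.sin p.2 * v 1 p) with hP₀
  set Q₀ : ℝ × ℝ → ℝ := fun p => -Real.sin p.2 * v 0 p + Real.cos p.2 * v 1 p with hQ₀
  set P : ℝ × ℝ → ℝ := fun p => if 0 < Real.cos p.2 then P₀ p else 0 with hP
  set Q : ℝ × ℝ → ℝ := fun p => if 0 < Real.cos p.2 then Q₀ p else 0 with hQ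
  have hcosopen : IsOpen {p : ℝ × ℝ | 0 < Real.cos p.2} :=
    isOpen_lt continuous_const (by fun_prop)
  have hPe : ∀ p : ℝ × ℝ, 0 < Real.cos p.2 → P =ᶠ[𝓝 p] P₀ := fun p hp =>
    eventually_of_mem (hcosopen.mem_nhds hp) fun q (hq : 0 < Real.cos q.2) => by simp [hP, hq]
  have hQe : ∀ p : ℝ × ℝ, 0 < Real.cos p.2 → Q =ᶠ[𝓝 p] Q₀ := fun p hp =>
    eventually_of_mem (hcosopen.mem_nhds hp) fun q (hq : 0 < Real.cos q.2) => by simp [hQ, hq]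
  have hvd : ∀ A (p : ℝ × ℝ), 0 < p.1 → 0 < Real.cos p.2 → DifferentiableAt ℝ (v A) p := by
    intro A p h1 h2
    have hp : DifferentiableAt ℝ (fun p : ℝ × ℝ => (p.1 * Real.cos p.2, p.1 * Real.sin p.2)) p := by
      fun_prop
    exact DifferentiableAt.comp (g := fun y : ℝ × ℝ => V A y.1 y.2)
      (f := fun p : ℝ × ℝ => (p.1 * Real.cos p.2, p.1 * Real.sin p.2)) p
      (hd A _ (mul_pos h1 h2) _) hp
  have hPd : ∀ p : ℝ × ℝ, 0 < p.1 → 0 < Real.cos p.2 → DifferentiableAt ℝ P p := by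
    intro p h1 h2
    have d0 := hvd 0 p h1 h2
    have d1 := hvd 1 p h1 h2
    have : DifferentiableAt ℝ P₀ p := by fun_prop
    exact this.congr_of_eventuallyEq (hPe p h2)
  have hQd : ∀ p : ℝ × ℝ, 0 < p.1 → 0 < Real.cos p.2 → DifferentiableAt ℝ Q p := by
    intro p h1 h2
    have d0 := hvd 0 p h1 h2
    have d1 := hvd 1 p h1 h2
    have : DifferentiableAt ℝ Q₀ p := by fun_prop
    exact this.congr_of_eventuallyEq (hQe p h2)
  -- the divergence in polar coordinates
  have hdiv : ∀ p : ℝ × ℝ, 0 < p.1 → 0 < Real.cos p.2 →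
      fderiv ℝ P p (1, 0) + fderiv ℝ Q p (0, 1)
        = p.1 * ∑ A, pd A (V A) (p.1 * Real.cos p.2) (p.1 * Real.sin p.2) := by
    rintro ⟨r, θ⟩ h1 h2
    simp only at h1 h2
    have hVA : ∀ A, HasFDerivAt (fun y : ℝ × ℝ => V A y.1 y.2)
        (fderiv ℝ (fun y : ℝ × ℝ => V A y.1 y.2) (r * Real.cos θ, r * Real.sin θ))
        (r * Real.cos θ, r * Real.sin θ) := fun A =>
      (show DifferentiableAt ℝ _ _ from hd A _ (mul_pos h1 h2) (r * Real.sin θ)).hasFDerivAt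
    have hlin : ∀ A (x y : ℝ), fderiv ℝ (fun y : ℝ × ℝ => V A y.1 y.2)
        (r * Real.cos θ, r * Real.sin θ) (x, y)
        = x * pd 0 (V A) (r * Real.cos θ) (r * Real.sin θ)
          + y * pd 1 (V A) (r * Real.cos θ) (r * Real.sin θ) := by
      intro A x y
      have h0 := (hVA A).comp_hasDerivAt (r * Real.cos θ)
        ((hasDerivAt_id (r * Real.cos θ)).prodMk (hasDerivAt_const _ (r * Real.sin θ)))
      have h1 := (hVA A).comp_hasDerivAt (r * Real.sin θ)
        ((hasDerivAt_const _ (r * Real.cos θ)).prodMk (hasDerivAt_id (r * Real.sin θ)))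
      have e0 : pd 0 (V A) (r * Real.cos θ) (r * Real.sin θ) = _ := h0.deriv
      have e1 : pd 1 (V A) (r * Real.cos θ) (r * Real.sin θ) = _ := h1.deriv
      have e2 : ((x, y) : ℝ × ℝ) = x • (1, 0) + y • (0, 1) := by simp
      rw [e0, e1, e2, map_add, map_smul, map_smul, smul_eq_mul, smul_eq_mul]
    have hvr : ∀ A, HasDerivAt (fun s => V A (s * Real.cos θ) (s * Real.sin θ))
        (Real.cos θ * pd 0 (V A) (r * Real.cos θ) (r * Real.sin θ)
          + Real.sin θ * pd 1 (V A) (r * Real.cos θ) (r * Real.sin θ)) r := by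
      intro A
      rw [← hlin]
      have := (hVA A).comp_hasDerivAt r (((hasDerivAt_id r).mul_const (Real.cos θ)).prodMk
        ((hasDerivAt_id r).mul_const (Real.sin θ)))
      simpa [Function.comp_def] using this
    have hvθ : ∀ A, HasDerivAt (fun s => V A (r * Real.cos s) (r * Real.sin s))
        (r * -Real.sin θ * pd 0 (V A) (r * Real.cos θ) (r * Real.sin θ)
          + r * Real.cos θ * pd 1 (V A) (r * Real.cos θ) (r * Real.sin θ)) θ := by
      intro A
      rw [← hlin]
      exact (hVA A).comp_hasDerivAt θ (((Real.hasDerivAt_cos θ).const_mul r).prodMk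
        ((Real.hasDerivAt_sin θ).const_mul r))
    have hP0d : DifferentiableAt ℝ P₀ (r, θ) :=
      (hPd (r, θ) h1 h2).congr_of_eventuallyEq (hPe (r, θ) h2).symm
    have hQ0d : DifferentiableAt ℝ Q₀ (r, θ) :=
      (hQd (r, θ) h1 h2).congr_of_eventuallyEq (hQe (r, θ) h2).symm
    have dP := hP0d.hasFDerivAt.comp_hasDerivAt r
      ((hasDerivAt_id r).prodMk (hasDerivAt_const r θ))
    have dQ := hQ0d.hasFDerivAt.comp_hasDerivAt θ
      ((hasDerivAt_const θ r).prodMk (hasDerivAt_id θ))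
    have eP := HasDerivAt.unique dP
      ((hasDerivAt_id r).mul (((hvr 0).const_mul (Real.cos θ)).add
        ((hvr 1).const_mul (Real.sin θ))))
    have eQ := HasDerivAt.unique dQ
      (((Real.hasDerivAt_sin θ).neg.mul (hvθ 0)).add ((Real.hasDerivAt_cos θ).mul (hvθ 1)))
    rw [(hPe (r, θ) h2).fderiv_eq, (hQe (r, θ) h2).fderiv_eq, eP, eQ]
    simp only [id, Fin.sum_univ_two, Pi.neg_apply]
    linear_combination r * (pd 0 (V 0) (r * Real.cos θ) (r * Real.sin θ)
      + pd 1 (V 1) (r * Real.cos θ) (r * Real.sin θ)) * Real.cos_sq_add_sin_sq θ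
  -- continuity up to the axis
  have hcos0 : ∀ θ ∈ Set.Icc (-(Real.pi / 2)) (Real.pi / 2), 0 ≤ Real.cos θ := fun θ hθ =>
    Real.cos_nonneg_of_mem_Icc ⟨by linarith [hθ.1], hθ.2⟩
  have hvb : ∀ A (p : ℝ × ℝ), p.1 ∈ Set.Icc δ L → 0 < Real.cos p.2 →
      |v A p| ≤ C * (p.1 * Real.cos p.2) := by
    intro A p h1 h2
    have hp : 0 < p.1 := hδ.trans_le h1.1
    refine hC A _ (mul_pos hp h2) _ ?_ ?_ <;> rw [rad_polar hp.le]
    exacts [h1.1, h1.2]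
  have hCC : ∀ p : ℝ × ℝ, p.1 ∈ Set.Icc δ L → 0 < Real.cos p.2 →
      |P p| ≤ L * (2 * (C * (p.1 * Real.cos p.2))) ∧ |Q p| ≤ 2 * (C * (p.1 * Real.cos p.2)) := by
    intro p h1 h2
    have hp : 0 < p.1 := hδ.trans_le h1.1
    have b0 := hvb 0 p h1 h2
    have b1 := hvb 1 p h1 h2
    have hc := Real.abs_cos_le_one p.2
    have hs := Real.abs_sin_le_one p.2
    have n0 := abs_nonneg (v 0 p)
    have n1 := abs_nonneg (v 1 p)
    simp only [hP, hQ, h2, if_true, hP₀, hQ₀]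
    constructor
    · rw [abs_mul, abs_of_pos hp]
      have hL0 : 0 ≤ L := hp.le.trans h1.2
      gcongr
      · exact h1.2
      · refine (abs_add_le _ _).trans ?_
        rw [abs_mul, abs_mul]; nlinarith [abs_nonneg (Real.cos p.2), abs_nonneg (Real.sin p.2)]
    · refine (abs_add_le _ _).trans ?_
      rw [abs_mul, abs_mul, abs_neg]
      nlinarith [abs_nonneg (Real.cos p.2), abs_nonneg (Real.sin p.2)]
  have hcontOn : ∀ F : ℝ × ℝ → ℝ, (∀ p : ℝ × ℝ, 0 < p.1 → 0 < Real.cos p.2 →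
      DifferentiableAt ℝ F p) → (∀ p : ℝ × ℝ, ¬ 0 < Real.cos p.2 → F p = 0) →
      (∃ K, ∀ p : ℝ × ℝ, p.1 ∈ Set.Icc δ L → 0 < Real.cos p.2 →
        |F p| ≤ K * (p.1 * Real.cos p.2)) →
      ContinuousOn F (Set.Icc δ L ×ˢ Set.Icc (-(Real.pi / 2)) (Real.pi / 2)) := by
    rintro F hF1 hF2 ⟨K, hK⟩ p ⟨hp1, hp2⟩
    have hp : 0 < p.1 := hδ.trans_le hp1.1
    by_cases hc : 0 < Real.cos p.2
    · exact (hF1 p hp hc).continuousAt.continuousWithinAt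
    have hc0 : Real.cos p.2 = 0 := le_antisymm (not_lt.1 hc) (hcos0 _ hp2)
    rw [ContinuousWithinAt, hF2 p hc]
    have hlim : Tendsto (fun q : ℝ × ℝ => K * (q.1 * Real.cos q.2))
        (𝓝[Set.Icc δ L ×ˢ Set.Icc (-(Real.pi / 2)) (Real.pi / 2)] p) (𝓝 0) := by
      have : Continuous fun q : ℝ × ℝ => K * (q.1 * Real.cos q.2) := by fun_prop
      have h2 := (this.tendsto p).mono_left (nhdsWithin_le_nhds
        (s := Set.Icc δ L ×ˢ Set.Icc (-(Real.pi / 2)) (Real.pi / 2)))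
      simpa [hc0] using h2
    refine squeeze_zero_norm' ?_ hlim
    filter_upwards [self_mem_nhdsWithin] with q hq
    by_cases hcq : 0 < Real.cos q.2
    · exact hK q hq.1 hcq
    · have : Real.cos q.2 = 0 := le_antisymm (not_lt.1 hcq) (hcos0 _ hq.2)
      simp [hF2 q hcq, this]
  have hcP := hcontOn P hPd (fun p hp => by simp [hP, hp])
    ⟨L * (2 * C), fun p h1 h2 => ((hCC p h1 h2).1).trans (by ring_nf; rfl)⟩
  have hcQ := hcontOn Q hQd (fun p hp => by simp [hQ, hp])
    ⟨2 * C, fun p h1 h2 => ((hCC p h1 h2).2).trans (by ring_nf; rfl)⟩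
  have hcos : ∀ θ ∈ Set.Ioo (-(Real.pi / 2)) (Real.pi / 2), 0 < Real.cos θ := fun θ hθ =>
    Real.cos_pos_of_mem_Ioo ⟨by linarith [hθ.1], hθ.2⟩
  have hEq : Set.EqOn (fun p : ℝ × ℝ => fderiv ℝ P p (1, 0) + fderiv ℝ Q p (0, 1))
      (fun p => p.1 * ∑ A, pd A (V A) (p.1 * Real.cos p.2) (p.1 * Real.sin p.2))
      (Set.Ioo δ L ×ˢ Set.Ioo (-(Real.pi / 2)) (Real.pi / 2)) := fun p hp =>
    hdiv p (hδ.trans hp.1.1) (hcos _ hp.2)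
  have hae : (Set.Ioo δ L ×ˢ Set.Ioo (-(Real.pi / 2)) (Real.pi / 2) : Set (ℝ × ℝ))
      =ᵐ[volume] Set.Icc δ L ×ˢ Set.Icc (-(Real.pi / 2)) (Real.pi / 2) :=
    Measure.set_prod_ae_eq Ioo_ae_eq_Icc Ioo_ae_eq_Icc
  have hopen : MeasurableSet (Set.Ioo δ L ×ˢ Set.Ioo (-(Real.pi / 2)) (Real.pi / 2)) :=
    measurableSet_Ioo.prod measurableSet_Ioo
  have hmem : ∀ p ∈ Set.Ioo δ L ×ˢ Set.Ioo (-(Real.pi / 2)) (Real.pi / 2),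
      ((p.1 * Real.cos p.2, p.1 * Real.sin p.2) : ℝ × ℝ) ∈ halfAnnulus δ L := by
    intro p hp
    have hr : 0 < p.1 := hδ.trans hp.1.1
    refine ⟨mul_pos hr (hcos _ hp.2), ?_⟩
    simp only [rad_polar hr.le]
    exact hp.1
  have hint : IntegrableOn (fun p : ℝ × ℝ => fderiv ℝ P p (1, 0) + fderiv ℝ Q p (0, 1))
      (Set.Icc δ L ×ˢ Set.Icc (-(Real.pi / 2)) (Real.pi / 2)) := by
    refine IntegrableOn.congr_set_ae ?_ hae.symm
    refine IntegrableOn.congr_fun (f := fun p : ℝ × ℝ =>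
      p.1 * ∑ A, pd A (V A) (p.1 * Real.cos p.2) (p.1 * Real.sin p.2)) ?_ hEq.symm hopen
    have hcv : ContinuousOn (fun p : ℝ × ℝ =>
        p.1 * ∑ A, pd A (V A) (p.1 * Real.cos p.2) (p.1 * Real.sin p.2))
        (Set.Ioo δ L ×ˢ Set.Ioo (-(Real.pi / 2)) (Real.pi / 2)) :=
      continuousOn_fst.mul (hcont.comp (f := fun p : ℝ × ℝ =>
        (p.1 * Real.cos p.2, p.1 * Real.sin p.2)) (by fun_prop) fun p hp => (hmem p hp).1)
    refine IntegrableOn.of_bound ?_ (hcv.aestronglyMeasurable hopen) (L * D)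
      (ae_restrict_of_forall_mem hopen fun p hp => ?_)
    · refine ((measure_mono (Set.prod_mono Set.Ioo_subset_Icc_self
        Set.Ioo_subset_Icc_self)).trans_lt
        (isCompact_Icc.prod isCompact_Icc).measure_lt_top)
    · have hr : 0 < p.1 := hδ.trans hp.1.1
      rw [norm_mul, Real.norm_eq_abs, Real.norm_eq_abs, abs_of_pos hr]
      have := hD _ (hmem p hp)
      exact mul_le_mul hp.1.2.le this (abs_nonneg _) (hr.le.trans hp.1.2.le)
  have hle : -(Real.pi / 2) ≤ Real.pi / 2 := by linarith
  have hdt := integral2_divergence_prod_of_hasFDerivAt_off_countable P Q (fderiv ℝ P) (fderiv ℝ Q)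
    δ (-(Real.pi / 2)) L (Real.pi / 2) ∅ Set.countable_empty
    (by rwa [Set.uIcc_of_le hL.le, Set.uIcc_of_le hle])
    (by rwa [Set.uIcc_of_le hL.le, Set.uIcc_of_le hle])
    (by
      rw [min_eq_left hL.le, max_eq_right hL.le, min_eq_left hle, max_eq_right hle]
      exact fun p hp => (hPd p (hδ.trans hp.1.1.1) (hcos _ hp.1.2)).hasFDerivAt)
    (by
      rw [min_eq_left hL.le, max_eq_right hL.le, min_eq_left hle, max_eq_right hle]
      exact fun p hp => (hQd p (hδ.trans hp.1.1.1) (hcos _ hp.1.2)).hasFDerivAt)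
    (by rwa [Set.uIcc_of_le hL.le, Set.uIcc_of_le hle])
  have hQ1 : ∀ x, Q (x, Real.pi / 2) = 0 := fun x => by simp [hQ]
  have hQ2 : ∀ x, Q (x, -(Real.pi / 2)) = 0 := fun x => by simp [hQ]
  simp only [hQ1, hQ2, intervalIntegral.integral_zero, sub_zero, zero_add] at hdt
  have hlhs : ∫ x in halfAnnulus δ L, ∑ A, pd A (V A) x.1 x.2
      = ∫ x in δ..L, ∫ y in -(Real.pi / 2)..Real.pi / 2,
          fderiv ℝ P (x, y) (1, 0) + fderiv ℝ Q (x, y) (0, 1) := by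
    rw [setIntegral_halfAnnulus_polar (fun x => ∑ A, pd A (V A) x.1 x.2) hδ,
      ← setIntegral_congr_fun hopen hEq, setIntegral_congr_set hae,
      Measure.volume_eq_prod, setIntegral_prod _ hint, intervalIntegral.integral_of_le hL.le,
      integral_Icc_eq_integral_Ioc]
    refine setIntegral_congr_fun measurableSet_Ioc fun x _ => ?_
    rw [intervalIntegral.integral_of_le hle, integral_Icc_eq_integral_Ioc]
  have hbound : ∀ R b : ℝ, 0 < R → (∀ A, ∀ ρ > 0, ∀ z, rad ρ z = R → R * |V A ρ z| ≤ b) →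
      |∫ y in -(Real.pi / 2)..Real.pi / 2, P (R, y)| ≤ 2 * Real.pi * b := by
    intro R b hR hb
    have hb0 : 0 ≤ b := (mul_nonneg hR.le (abs_nonneg _)).trans (hb 0 R hR 0 (by
      have := rad_polar (θ := 0) hR.le
      simpa using this))
    have := intervalIntegral.norm_integral_le_of_norm_le_const (a := -(Real.pi / 2))
      (b := Real.pi / 2) (C := 2 * b) (f := fun y => P (R, y)) (fun y _ => ?_)
    · rw [show Real.pi / 2 - -(Real.pi / 2) = Real.pi by ring, abs_of_pos hpi] at this
      exact this.trans (by ring_nf; rfl)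
    · by_cases hc : 0 < Real.cos y
      · have h0 := hb 0 _ (mul_pos hR hc) _ (rad_polar hR.le)
        have h1 := hb 1 _ (mul_pos hR hc) _ (rad_polar hR.le)
        simp only [hP, hP₀, hv, hc, if_true, Real.norm_eq_abs]
        rw [abs_mul, abs_of_pos hR]
        have h2 : |Real.cos y * V 0 (R * Real.cos y) (R * Real.sin y)
            + Real.sin y * V 1 (R * Real.cos y) (R * Real.sin y)|
            ≤ 1 * |V 0 (R * Real.cos y) (R * Real.sin y)|
              + 1 * |V 1 (R * Real.cos y) (R * Real.sin y)| := by
          refine (abs_add_le _ _).trans ?_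
          rw [abs_mul, abs_mul]
          gcongr
          · exact Real.abs_cos_le_one y
          · exact Real.abs_sin_le_one y
        nlinarith [mul_le_mul_of_nonneg_left h2 hR.le]
      · simp [hP, hc, hb0]
  rw [hlhs, hdt]
  refine (abs_sub _ _).trans ?_
  have e1 := hbound L bL (hδ.trans hL) hbL
  have e2 := hbound δ bδ hδ hbδ
  linarith
end

section
variable {I : Set ℝ} {f g : Field} {t ρ z : ℝ}

/-! ### Order of vanishing at the axis -/

/-- The domain `t ∈ I`, `(ρ, z) ≠ 0` of the smooth fields. -/
def fullDom (I : Set ℝ) : Set (ℝ × ℝ × ℝ) := {x | x.1 ∈ I ∧ x.2 ≠ (0, 0)}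

lemma isOpen_fullDom (hI : IsOpen I) : IsOpen (fullDom I) :=
  (hI.preimage continuous_fst).inter (isOpen_ne.preimage continuous_snd)

lemma dom_subset_fullDom : dom I ⊆ fullDom I := fun x hx =>
  ⟨hx.1, fun h => by have := hx.2; rw [h] at this; exact lt_irrefl _ this⟩

lemma mem_fullDom_of_ne (ht : t ∈ I) (hz : z ≠ 0) : (t, ρ, z) ∈ fullDom I :=
  ⟨ht, fun h => hz (congrArg Prod.snd h)⟩

/-- `f` vanishes on the axis outside the origin together with its first `k - 1` derivatives in
`ρ`. -/
def Flat (I : Set ℝ) : ℕ → Field → Prop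
  | 0, _ => True
  | k + 1, f => (∀ t ∈ I, ∀ z : ℝ, z ≠ 0 → f t 0 z = 0) ∧ Flat I k fun t => pd 0 (f t)

/-- Fields that agree on an open set have the same space derivatives there. -/
lemma pd_congr_on {U : Set (ℝ × ℝ × ℝ)} (hU : IsOpen U)
    (hfg : ∀ x ∈ U, f x.1 x.2.1 x.2.2 = g x.1 x.2.1 x.2.2) {x : ℝ × ℝ × ℝ} (hx : x ∈ U)
    (A : Fin 2) : pd A (f x.1) x.2.1 x.2.2 = pd A (g x.1) x.2.1 x.2.2 := by
  have hc : Continuous fun y : ℝ × ℝ => ((x.1, y) : ℝ × ℝ × ℝ) := by fun_prop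
  exact pd_congr (eventually_of_mem ((hU.preimage hc).mem_nhds (x := x.2) hx)
    fun y hy => hfg _ hy) A

/-- Fields that agree on an open set have the same time derivative there. -/
lemma tdot_congr_on {U : Set (ℝ × ℝ × ℝ)} (hU : IsOpen U)
    (hfg : ∀ x ∈ U, f x.1 x.2.1 x.2.2 = g x.1 x.2.1 x.2.2) {x : ℝ × ℝ × ℝ} (hx : x ∈ U) :
    tdot f x.1 x.2.1 x.2.2 = tdot g x.1 x.2.1 x.2.2 := by
  have hc : Continuous fun s : ℝ => ((s, x.2) : ℝ × ℝ × ℝ) := by fun_prop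
  exact Filter.EventuallyEq.deriv_eq (eventually_of_mem
    ((hU.preimage hc).mem_nhds (x := x.1) hx) fun s hs => hfg _ hs)

namespace Flat

lemma congr (hI : IsOpen I) (hfg : ∀ x ∈ fullDom I, f x.1 x.2.1 x.2.2 = g x.1 x.2.1 x.2.2)
    {k : ℕ} (h : Flat I k f) : Flat I k g := by
  induction k generalizing f g with
  | zero => trivial
  | succ k ih =>
    refine ⟨fun t ht z hz => ?_, ih (fun x hx => pd_congr_on (isOpen_fullDom hI) hfg hx 0) h.2⟩
    rw [← hfg (t, 0, z) (mem_fullDom_of_ne ht hz)]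
    exact h.1 t ht z hz

lemma of_succ {k : ℕ} (h : Flat I (k + 1) f) : Flat I k f := by
  induction k generalizing f with
  | zero => trivial
  | succ k ih => exact ⟨h.1, ih h.2⟩

lemma tdot (hI : IsOpen I) (hf : Sm (fullDom I) f) {k : ℕ} (h : Flat I k f) :
    Flat I k (tdot f) := by
  induction k generalizing f with
  | zero => trivial
  | succ k ih =>
    have hU := isOpen_fullDom hI
    refine ⟨fun t ht z hz => ?_, (ih (hf.pd hU 0) h.2).congr hI fun x hx => hf.tdot_pd hU hx 0⟩
    have : (fun s => f s 0 z) =ᶠ[𝓝 t] fun _ => 0 :=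
      eventually_of_mem (hI.mem_nhds ht) fun s hs => h.1 s hs z hz
    rw [KerrPert.tdot, this.deriv_eq, deriv_const]

lemma pd_one (hI : IsOpen I) (hf : Sm (fullDom I) f) {k : ℕ} (h : Flat I k f) :
    Flat I k (fun t => pd 1 (f t)) := by
  induction k generalizing f with
  | zero => trivial
  | succ k ih =>
    have hU := isOpen_fullDom hI
    refine ⟨fun t ht z hz => ?_, (ih (hf.pd hU 0) h.2).congr hI fun x hx =>
      hf.pd_comm hU hx 1 0⟩
    have : (fun s => f t 0 s) =ᶠ[𝓝 z] fun _ => 0 :=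
      eventually_of_mem (isOpen_ne.mem_nhds hz) fun s hs => h.1 t ht s hs
    change deriv (fun s => f t 0 s) z = 0
    rw [this.deriv_eq, deriv_const]

/-- On a box around a part of the axis, Taylor's theorem bounds a function that vanishes to order
`k` by a multiple of `ρ ^ k`. -/
lemma bound_box (hI : IsOpen I) {K : Set ℝ} (hK : IsCompact K) (hKI : K ⊆ I) {h R : ℝ}
    (hh : 0 < h) {k : ℕ} (hf : Sm (fullDom I) f) (hk : Flat I k f) :
    ∃ C, ∀ t ∈ K, ∀ ρ ∈ Set.Icc 0 R, ∀ z, h ≤ |z| → |z| ≤ R → |f t ρ z| ≤ C * ρ ^ k := by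
  induction k generalizing f with
  | zero =>
    have hZ : IsCompact {z : ℝ | h ≤ |z| ∧ |z| ≤ R} := by
      refine (isCompact_Icc (a := -R) (b := R)).of_isClosed_subset ?_ fun z hz => abs_le.1 hz.2
      exact (isClosed_le continuous_const continuous_abs).inter
        (isClosed_le continuous_abs continuous_const)
    have hc : ContinuousOn (fun x : ℝ × ℝ × ℝ => f x.1 x.2.1 x.2.2)
        (K ×ˢ (Set.Icc 0 R ×ˢ {z : ℝ | h ≤ |z| ∧ |z| ≤ R})) :=
      (ContDiffOn.continuousOn hf).mono fun x hx =>
        mem_fullDom_of_ne (hKI hx.1) (abs_pos.1 (hh.trans_le hx.2.2.1))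
    obtain ⟨C, hC⟩ := (hK.prod (isCompact_Icc.prod hZ)).exists_bound_of_continuousOn hc
    refine ⟨C, fun t ht ρ hρ z h1 h2 => ?_⟩
    simpa using hC (t, ρ, z) ⟨ht, hρ, h1, h2⟩
  | succ k ih =>
    have hU := isOpen_fullDom hI
    obtain ⟨C, hC⟩ := ih (hf.pd hU 0) hk.2
    refine ⟨C, fun t ht ρ hρ z h1 h2 => ?_⟩
    have hz : z ≠ 0 := abs_pos.1 (hh.trans_le h1)
    have hd : ∀ s ∈ Set.Icc 0 ρ, HasDerivWithinAt (fun s => f t s z) (pd 0 (f t) s z)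
        (Set.Icc 0 ρ) s := fun s _ =>
      (hf.diffS hU (mem_fullDom_of_ne (hKI ht) hz)).slice0.hasDerivWithinAt
    have hC0 : 0 ≤ C * ρ ^ k := (abs_nonneg _).trans (hC t ht ρ hρ z h1 h2)
    have hb : ∀ s ∈ Set.Ico 0 ρ, ‖pd 0 (f t) s z‖ ≤ C * ρ ^ k := fun s hs => by
      refine (hC t ht s ⟨hs.1, hs.2.le.trans hρ.2⟩ z h1 h2).trans ?_
      rcases hρ.1.eq_or_lt with h0 | h0
      · exact absurd hs.2 (by linarith [hs.1])
      · have : 0 ≤ C := nonneg_of_mul_nonneg_left hC0 (pow_pos h0 k)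
        exact mul_le_mul_of_nonneg_left (pow_le_pow_left₀ hs.1 hs.2.le k) this
    have := norm_image_sub_le_of_norm_deriv_le_segment' hd hb ρ ⟨hρ.1, le_rfl⟩
    rw [hk.1 t (hKI ht) z hz, sub_zero, sub_zero, Real.norm_eq_abs] at this
    rwa [pow_succ, ← mul_assoc]

end Flat

/-- The half annulus `δ ≤ r ≤ L` without the axis. -/
def annulus (δ L : ℝ) : Set (ℝ × ℝ) := {y | 0 < y.1 ∧ δ ≤ rad y.1 y.2 ∧ rad y.1 y.2 ≤ L}

/-- The filter that governs bounds on a half annulus, up to the axis, uniformly for times near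
`t₀`. -/
def nhdsAnnulus (t₀ δ L : ℝ) : Filter (ℝ × ℝ × ℝ) := 𝓝 t₀ ×ˢ 𝓟 (annulus δ L)

lemma eventually_nhdsAnnulus (hI : IsOpen I) {t₀ δ L : ℝ} (ht : t₀ ∈ I) :
    ∀ᶠ x in nhdsAnnulus t₀ δ L, x ∈ dom I ∧ x.2 ∈ annulus δ L := by
  have h1 : ∀ᶠ x in nhdsAnnulus t₀ δ L, x.1 ∈ I := tendsto_fst.eventually (hI.mem_nhds ht)
  have h2 : ∀ᶠ x in nhdsAnnulus t₀ δ L, x.2 ∈ annulus δ L :=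
    tendsto_snd.eventually (mem_principal_self _)
  filter_upwards [h1, h2] with x h1 h2 using ⟨⟨h1, h2.1⟩, h2⟩

lemma Flat.isBigO (hI : IsOpen I) {t₀ δ L : ℝ} (ht : t₀ ∈ I) (hδ : 0 < δ) {k : ℕ}
    (hf : Sm (fullDom I) f) (hk : Flat I k f) :
    (fun x : ℝ × ℝ × ℝ => f x.1 x.2.1 x.2.2) =O[nhdsAnnulus t₀ δ L] fun x => x.2.1 ^ k := by
  obtain ⟨ε, hε, hεI⟩ := Metric.nhds_basis_closedBall.mem_iff.1 (hI.mem_nhds ht)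
  have hK := isCompact_closedBall t₀ ε
  obtain ⟨C, hC⟩ := hk.bound_box hI hK hεI (R := L) (half_pos hδ) hf
  have hc : ContinuousOn (fun x : ℝ × ℝ × ℝ => f x.1 x.2.1 x.2.2)
      (Metric.closedBall t₀ ε ×ˢ (Set.Icc (δ / 2) L ×ˢ Set.Icc (-L) L)) :=
    (ContDiffOn.continuousOn hf).mono fun x hx =>
      dom_subset_fullDom ⟨hεI hx.1, (half_pos hδ).trans_le hx.2.1.1⟩
  obtain ⟨C', hC'⟩ := (hK.prod (isCompact_Icc.prod isCompact_Icc)).exists_bound_of_continuousOn hc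
  refine IsBigO.of_bound (max C (C' * (2 / δ) ^ k)) ?_
  have h1 : ∀ᶠ x in nhdsAnnulus t₀ δ L, x.1 ∈ Metric.closedBall t₀ ε :=
    tendsto_fst.eventually (Metric.closedBall_mem_nhds t₀ hε)
  have h2 : ∀ᶠ x in nhdsAnnulus t₀ δ L, x.2 ∈ annulus δ L :=
    tendsto_snd.eventually (mem_principal_self _)
  filter_upwards [h1, h2] with x h1 h2
  obtain ⟨t, ρ, z⟩ := x
  obtain ⟨hρ, hr1, hr2⟩ := h2
  simp only at h1 hρ hr1 hr2 ⊢
  have hρL : ρ ≤ L := left_le_rad.trans hr2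
  have hzL : |z| ≤ L := abs_right_le_rad.trans hr2
  rw [Real.norm_eq_abs, Real.norm_eq_abs, abs_of_pos (pow_pos hρ k)]
  by_cases hz : δ / 2 ≤ |z|
  · refine (hC t h1 ρ ⟨hρ.le, hρL⟩ z hz hzL).trans ?_
    gcongr; exact le_max_left _ _
  · have hρδ : δ / 2 ≤ ρ := by
      by_contra hcon
      have e := rad_sq ρ z
      have : δ ^ 2 ≤ rad ρ z ^ 2 := pow_le_pow_left₀ hδ.le hr1 2
      nlinarith [sq_abs z, abs_nonneg z]
    have hb := hC' (t, ρ, z) ⟨h1, ⟨hρδ, hρL⟩, abs_le.1 hzL⟩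
    have hC'0 : 0 ≤ C' := (norm_nonneg _).trans hb
    refine hb.trans ?_
    calc C' = C' * (2 / δ) ^ k * (δ / 2) ^ k := by
          rw [mul_assoc, ← mul_pow]; field_simp; simp
      _ ≤ max C (C' * (2 / δ) ^ k) * ρ ^ k :=
          mul_le_mul (le_max_right _ _) (pow_le_pow_left₀ (half_pos hδ).le hρδ k) (by positivity)
            (le_max_of_le_right (by positivity))

/-! ### The twist vanishes to fourth order at the axis -/

lemma deriv_neg_of_even {g : ℝ → ℝ} (h : ∀ s, g (-s) = g s) (s : ℝ) :
    deriv g (-s) = -deriv g s := by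
  have h1 := deriv_comp_neg g s
  rw [funext h] at h1
  rw [h1, neg_neg]

lemma deriv_neg_of_odd {g : ℝ → ℝ} (h : ∀ s, g (-s) = -g s) (s : ℝ) :
    deriv g (-s) = deriv g s := by
  have h1 := deriv_comp_neg g s
  rw [funext h, deriv.fun_neg] at h1
  linarith

lemma eta0_le_of_ne {m a : ℝ} (hm : 0 < m) (ha : |a| = m) (hz : z ≠ 0) (h : 0 < ρ) :
    eta0 m a ρ z ≤ 4 * (1 + m / |z|) ^ 2 * ρ ^ 2 := by
  have hr := rad_pos (z := z) h
  have hz' : 0 < |z| := abs_pos.2 hz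
  calc _ ≤ 4 * (ρ ^ 2 * (rad ρ z + m) ^ 2 / rad ρ z ^ 2) := eta0_le hm ha h
    _ = 4 * (1 + m / rad ρ z) ^ 2 * ρ ^ 2 := by field_simp
    _ ≤ _ := by gcongr; exact abs_right_le_rad

/-- Since `η₀ = O(ρ²)`, the condition on `ω̄₁` makes `ω₁ = O(ρ⁴)` and `∂_ρ ω₁ = O(ρ³)`. For an even
smooth function this forces the terms of order `0` and `2` of its expansion in `ρ` to vanish. -/
lemma flat_of_bigO1Axis {m a : ℝ} (hm : 0 < m) (ha : |a| = m) (hI : IsOpen I)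
    (hf : Sm (fullDom I) f) (heven : EvenField I f)
    (hax : BigO1Axis I fun t ρ z => f t ρ z / eta0 m a ρ z ^ 2) : Flat I 4 f := by
  have hU := isOpen_fullDom hI
  have hf1 := hf.pd hU 0
  have hf2 := hf1.pd hU 0
  have hbd : ∀ t ∈ I, ∀ z : ℝ, z ≠ 0 → ∃ C, ∀ᶠ ρ in 𝓝[>] (0 : ℝ),
      |f t ρ z| ≤ C * ρ ^ 4 ∧ |pd 0 (f t) ρ z| ≤ C * ρ ^ 3 := by
    intro t ht z hz
    obtain ⟨h1, h2⟩ := hax t ht z hz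
    obtain ⟨C₁, hC₁0, hC₁⟩ := h1.exists_pos
    obtain ⟨C₂, hC₂0, hC₂⟩ := (h2 0).exists_pos
    set e := 4 * (1 + m / |z|) ^ 2 with he
    have he0 : 0 ≤ e := by positivity
    refine ⟨max (e ^ 2 * C₁) (e ^ 2 * C₂ + 68 * (e ^ 2 * C₁)), ?_⟩
    filter_upwards [hC₁.bound, hC₂.bound, self_mem_nhdsWithin] with ρ b1 b2 (hρ : 0 < ρ)
    have hη := eta0_pos (z := z) hm ha hρ
    have hηe : eta0 m a ρ z ≤ e * ρ ^ 2 := eta0_le_of_ne hm ha hz hρ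
    have hdη := abs_pd_eta0_le (z := z) hm ha hρ 0
    have hF : Sm (dom I) f := hf.mono dom_subset_fullDom
    have hE := sm_eta0 (I := I) hm ha
    have hx : (t, ρ, z) ∈ dom I := ⟨ht, hρ⟩
    have hdF := hF.diffS (isOpen_dom hI) hx
    have hdE := Sm.diffS (isOpen_dom hI) (hE.pow 2) hx
    have hd1 := pd_div hdF hdE (pow_pos hη 2).ne' 0
    have hd2 := pd_pow (Sm.diffS (isOpen_dom hI) hE hx) 2 0
    set w := f t ρ z / eta0 m a ρ z ^ 2 with hw
    have e1 : f t ρ z = eta0 m a ρ z ^ 2 * w := by rw [hw]; field_simp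
    have e2 : pd 0 (f t) ρ z = eta0 m a ρ z ^ 2
        * pd 0 (fun ρ z => f t ρ z / eta0 m a ρ z ^ 2) ρ z
        + 2 * eta0 m a ρ z * pd 0 (eta0 m a) ρ z * w := by
      rw [hd1, hd2, hw]; push_cast; field_simp; ring
    simp only [norm_one, mul_one, Real.norm_eq_abs, abs_inv, abs_of_pos hρ] at b1 b2
    have hη2 : eta0 m a ρ z ^ 2 ≤ (e * ρ ^ 2) ^ 2 := pow_le_pow_left₀ hη.le hηe 2
    constructor
    · rw [e1, abs_mul, abs_of_pos (pow_pos hη 2)]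
      calc _ ≤ (e * ρ ^ 2) ^ 2 * C₁ := by gcongr
        _ = e ^ 2 * C₁ * ρ ^ 4 := by ring
        _ ≤ _ := by gcongr; exact le_max_left _ _
    · rw [e2]
      refine (abs_add_le _ _).trans ?_
      rw [abs_mul, abs_mul, abs_mul, abs_of_pos (pow_pos hη 2), abs_of_pos (mul_pos two_pos hη)]
      calc _ ≤ (e * ρ ^ 2) ^ 2 * (C₂ * ρ⁻¹)
            + 2 * eta0 m a ρ z * (34 * eta0 m a ρ z / ρ) * C₁ := by gcongr
        _ = (e * ρ ^ 2) ^ 2 * (C₂ * ρ⁻¹) + 68 * (eta0 m a ρ z ^ 2) / ρ * C₁ := by ring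
        _ ≤ (e * ρ ^ 2) ^ 2 * (C₂ * ρ⁻¹) + 68 * (e * ρ ^ 2) ^ 2 / ρ * C₁ := by gcongr
        _ = (e ^ 2 * C₂ + 68 * (e ^ 2 * C₁)) * ρ ^ 3 := by field_simp
        _ ≤ _ := by gcongr; exact le_max_right _ _
  have hsl : ∀ t ∈ I, ∀ z : ℝ, z ≠ 0 → ∀ s, f t (-s) z = f t s z := fun t ht z hz s =>
    heven t ht s z fun h => hz (congrArg Prod.snd h)
  have hsl1 : ∀ t ∈ I, ∀ z : ℝ, z ≠ 0 → ∀ s, pd 0 (f t) (-s) z = -pd 0 (f t) s z :=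
    fun t ht z hz s => deriv_neg_of_even (g := fun s => f t s z) (hsl t ht z hz) s
  have hsl2 : ∀ t ∈ I, ∀ z : ℝ, z ≠ 0 → ∀ s,
      pd 0 (pd 0 (f t)) (-s) z = pd 0 (pd 0 (f t)) s z :=
    fun t ht z hz s => deriv_neg_of_odd (g := fun s => pd 0 (f t) s z) (hsl1 t ht z hz) s
  have hsl3 : ∀ t ∈ I, ∀ z : ℝ, z ≠ 0 → ∀ s,
      pd 0 (pd 0 (pd 0 (f t))) (-s) z = -pd 0 (pd 0 (pd 0 (f t))) s z :=
    fun t ht z hz s => deriv_neg_of_even (g := fun s => pd 0 (pd 0 (f t)) s z) (hsl2 t ht z hz) s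
  have h1 : ∀ t ∈ I, ∀ z : ℝ, z ≠ 0 → pd 0 (f t) 0 z = 0 := fun t ht z hz => by
    have := hsl1 t ht z hz 0
    rw [neg_zero] at this; linarith
  refine ⟨fun t ht z hz => ?_, h1, fun t ht z hz => ?_, fun t ht z hz => ?_, trivial⟩
  · obtain ⟨C, hC⟩ := hbd t ht z hz
    have hc : Tendsto (fun s => f t s z) (𝓝[>] 0) (𝓝 (f t 0 z)) :=
      ((hf.diffS hU (mem_fullDom_of_ne ht hz)).slice0.continuousAt.tendsto).mono_left
        nhdsWithin_le_nhds
    refine tendsto_nhds_unique hc (squeeze_zero_norm' (hC.mono fun s hs => hs.1) ?_)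
    have : Continuous fun s : ℝ => C * s ^ 4 := by fun_prop
    simpa using (this.tendsto 0).mono_left nhdsWithin_le_nhds
  · obtain ⟨C, hC⟩ := hbd t ht z hz
    have hs := (hf1.diffS hU (mem_fullDom_of_ne (ρ := 0) ht hz)).slice0.tendsto_slope_zero_right
    refine tendsto_nhds_unique hs (squeeze_zero_norm' (a := fun s => C * s ^ 2) ?_ ?_)
    · filter_upwards [hC, self_mem_nhdsWithin] with s hs (h0 : 0 < s)
      rw [h1 t ht z hz, zero_add, sub_zero, norm_smul, norm_inv, Real.norm_eq_abs, Real.norm_eq_abs,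
        abs_of_pos h0, inv_mul_le_iff₀ h0]
      exact hs.2.trans (by ring_nf; rfl)
    · have : Continuous fun s : ℝ => C * s ^ 2 := by fun_prop
      simpa using (this.tendsto 0).mono_left nhdsWithin_le_nhds
  · have := hsl3 t ht z hz 0
    rw [neg_zero] at this
    change pd 0 (pd 0 (pd 0 (f t))) 0 z = 0
    linarith

lemma flat_of_odd (hodd : OddField I f) : Flat I 1 f := by
  refine ⟨fun t ht z hz => ?_, trivial⟩
  have := hodd t ht 0 z fun h => hz (congrArg Prod.snd h)
  rw [neg_zero] at this; linarith
end

section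
variable {m a : ℝ} {I : Set ℝ} {t₀ δ L : ℝ}

/-! ### Regular perturbations and their time derivative -/

/-- The time derivative of a perturbation, as a perturbation. All conditions that are linear and
independent of time are inherited by it. -/
noncomputable def Pert.dt (φ : Pert) : Pert where
  sig := tdot φ.sig
  om := tdot φ.om
  q := tdot φ.q
  beta A := tdot (φ.beta A)
  chi A B := tdot (φ.chi A B)

/-- The smoothness of a perturbation and its behaviour at the axis: `ω₁` vanishes to fourth order
and `β₁^ρ` to first order, and the gauge equation of the shift holds. -/
structure IsRegular (m a : ℝ) (I : Set ℝ) (φ : Pert) : Prop where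
  sig : Sm (fullDom I) φ.sig
  om : Sm (fullDom I) φ.om
  beta : ∀ A, Sm (fullDom I) (φ.beta A)
  chi : ∀ A B, Sm (fullDom I) (φ.chi A B)
  om_flat : Flat I 4 φ.om
  beta_flat : Flat I 1 (φ.beta 0)
  shift : ∀ t ∈ I, ∀ ρ > 0, ∀ z, ∀ A B,
    φ.confKill A B t ρ z = 2 * Real.exp (-(2 * u0 m a ρ z)) * ρ * φ.chi A B t ρ z

/-- Boundedness of a field along a filter. -/
def Bdd (l : Filter (ℝ × ℝ × ℝ)) (f : Field) : Prop :=
  (fun x : ℝ × ℝ × ℝ => f x.1 x.2.1 x.2.2) =O[l] fun _ => (1 : ℝ)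

namespace Bdd
variable {l : Filter (ℝ × ℝ × ℝ)} {f g : Field}

lemma const (c : ℝ) : Bdd l fun _ _ _ => c := isBigO_const_const c one_ne_zero l

lemma mul (hf : Bdd l f) (hg : Bdd l g) : Bdd l fun t ρ z => f t ρ z * g t ρ z := by
  simpa [Bdd] using IsBigO.mul hf hg

lemma add (hf : Bdd l f) (hg : Bdd l g) : Bdd l fun t ρ z => f t ρ z + g t ρ z := IsBigO.add hf hg

lemma sub (hf : Bdd l f) (hg : Bdd l g) : Bdd l fun t ρ z => f t ρ z - g t ρ z := IsBigO.sub hf hg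

lemma sum {f : Fin 2 → Field} (hf : ∀ A, Bdd l (f A)) : Bdd l fun t ρ z => ∑ A, f A t ρ z :=
  IsBigO.fun_sum fun A _ => hf A

lemma congr (hf : Bdd l f) (h : ∀ᶠ x in l, f x.1 x.2.1 x.2.2 = g x.1 x.2.1 x.2.2) : Bdd l g :=
  IsBigO.congr' hf h EventuallyEq.rfl

lemma of_bound (C : ℝ) (h : ∀ᶠ x in l, |f x.1 x.2.1 x.2.2| ≤ C) : Bdd l f :=
  IsBigO.of_bound C (h.mono fun x hx => by simpa using hx)

end Bdd

/-- `∂_A ω₀ / η₀`. -/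
noncomputable def domega0 (m a : ℝ) (A : Fin 2) : Scal := fun ρ z =>
  pd A (omega0 m a) ρ z / eta0 m a ρ z

/-- `ω₁ / η₀`. -/
noncomputable def Pert.tw (m a : ℝ) (φ : Pert) : Field := fun t ρ z =>
  φ.om t ρ z / eta0 m a ρ z

/-- `∂_A ω₁ / η₀`. -/
noncomputable def Pert.dtw (m a : ℝ) (φ : Pert) (A : Fin 2) : Field := fun t ρ z =>
  pd A (φ.om t) ρ z / eta0 m a ρ z

lemma bdd_rho (hI : IsOpen I) (ht : t₀ ∈ I) : Bdd (nhdsAnnulus t₀ δ L) fun _ ρ _ => ρ := by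
  refine Bdd.of_bound L ?_
  filter_upwards [eventually_nhdsAnnulus hI ht] with x hx
  rw [abs_of_pos hx.1.2]; exact left_le_rad.trans hx.2.2.2

lemma bdd_domega0 (hm : 0 < m) (ha : |a| = m) (hI : IsOpen I) (ht : t₀ ∈ I) (hδ : 0 < δ)
    (A : Fin 2) : Bdd (nhdsAnnulus t₀ δ L) fun _ => domega0 m a A := by
  refine Bdd.of_bound (56 * m ^ 2 * L / (δ ^ 2 * m ^ 2)) ?_
  filter_upwards [eventually_nhdsAnnulus hI ht] with x hx
  have hr := rad_pos (z := x.2.2) hx.1.2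
  refine (abs_pd_omega0_div_eta0_le hm ha hx.1.2 A).trans ?_
  have hL : 0 ≤ L := hr.le.trans hx.2.2.2
  gcongr
  · exact left_le_rad.trans hx.2.2.2
  · exact hx.2.2.1
  · linarith

lemma bdd_pd_sigma0 (hm : 0 < m) (ha : |a| = m) (hI : IsOpen I) (ht : t₀ ∈ I) (hδ : 0 < δ)
    (A : Fin 2) : Bdd (nhdsAnnulus t₀ δ L) fun _ => pd A (sigma0 m a) := by
  refine Bdd.of_bound (32 * m / (δ * m)) ?_
  filter_upwards [eventually_nhdsAnnulus hI ht] with x hx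
  have hr := rad_pos (z := x.2.2) hx.1.2
  refine (abs_pd_sigma0_le hm ha hx.1.2 A).trans ?_
  gcongr
  · exact hx.2.2.1
  · linarith

lemma bdd_exp_div (hm : 0 < m) (ha : |a| = m) (hI : IsOpen I) (ht : t₀ ∈ I) (hδ : 0 < δ) :
    Bdd (nhdsAnnulus t₀ δ L) fun _ ρ z => Real.exp (2 * u0 m a ρ z) / ρ ^ 2 := by
  refine Bdd.of_bound (4 * (L + m) ^ 4 / δ ^ 4) ?_
  filter_upwards [eventually_nhdsAnnulus hI ht] with x hx
  have hρ := hx.1.2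
  have hr := rad_pos (z := x.2.2) hρ
  have hN := kN_pos (z := x.2.2) hm hρ
  have e : x.2.1 ^ 2 * kN m x.2.1 x.2.2 / rad x.2.1 x.2.2 ^ 4 / x.2.1 ^ 2
      = kN m x.2.1 x.2.2 / rad x.2.1 x.2.2 ^ 4 := by field_simp
  rw [exp_two_u0 hm ha hρ, e, abs_of_pos (by positivity)]
  have hL : 0 ≤ L := hr.le.trans hx.2.2.2
  calc _ ≤ 4 * (rad x.2.1 x.2.2 + m) ^ 4 / rad x.2.1 x.2.2 ^ 4 := by gcongr; exact kN_le hm hρ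
    _ ≤ _ := by
      gcongr
      · exact hx.2.2.2
      · exact hx.2.2.1

lemma sq_div_eta0_le {ρ z : ℝ} (hm : 0 < m) (ha : |a| = m) (h : 0 < ρ) :
    ρ ^ 2 / eta0 m a ρ z ≤ 2 := by
  have hr := rad_pos (z := z) h
  rw [div_le_iff₀ (eta0_pos hm ha h)]
  refine le_trans ?_ (le_eta0 hm ha h)
  rw [le_div_iff₀ (by positivity)]
  gcongr; linarith

lemma bdd_sq_div_eta0 (hm : 0 < m) (ha : |a| = m) (hI : IsOpen I) (ht : t₀ ∈ I) :
    Bdd (nhdsAnnulus t₀ δ L) fun _ ρ z => ρ ^ 2 / eta0 m a ρ z := by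
  refine Bdd.of_bound 2 ?_
  filter_upwards [eventually_nhdsAnnulus hI ht] with x hx
  have hη := eta0_pos (z := x.2.2) hm ha hx.1.2
  rw [abs_of_nonneg (by positivity)]
  exact sq_div_eta0_le hm ha hx.1.2

lemma abs_rho_mul_pd_eta0_le {ρ z : ℝ} (hm : 0 < m) (ha : |a| = m) (h : 0 < ρ) (A : Fin 2) :
    |ρ * pd A (eta0 m a) ρ z / eta0 m a ρ z| ≤ 34 := by
  have hη := eta0_pos (z := z) hm ha h
  rw [abs_div, abs_mul, abs_of_pos h, abs_of_pos hη, div_le_iff₀ hη]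
  calc _ ≤ ρ * (34 * eta0 m a ρ z / ρ) := by gcongr; exact abs_pd_eta0_le hm ha h A
    _ = _ := by field_simp

lemma bdd_rho_mul_pd_eta0 (hm : 0 < m) (ha : |a| = m) (hI : IsOpen I) (ht : t₀ ∈ I) (A : Fin 2) :
    Bdd (nhdsAnnulus t₀ δ L) fun _ ρ z => ρ * pd A (eta0 m a) ρ z / eta0 m a ρ z := by
  refine Bdd.of_bound 34 ?_
  filter_upwards [eventually_nhdsAnnulus hI ht] with x hx
  exact abs_rho_mul_pd_eta0_le hm ha hx.1.2 A

lemma Flat.bdd (hI : IsOpen I) (ht : t₀ ∈ I) (hδ : 0 < δ) {k : ℕ} {f : Field}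
    (hf : Sm (fullDom I) f) (hk : Flat I k f) :
    Bdd (nhdsAnnulus t₀ δ L) fun t ρ z => f t ρ z / ρ ^ k := by
  obtain ⟨C, hC⟩ := (hk.isBigO hI ht hδ (L := L) hf).bound
  refine Bdd.of_bound C ?_
  filter_upwards [hC, eventually_nhdsAnnulus hI ht] with x h1 hx
  have hρ := pow_pos hx.1.2 k
  rw [abs_div, abs_of_pos hρ, div_le_iff₀ hρ]
  rwa [Real.norm_eq_abs, Real.norm_eq_abs, abs_of_pos hρ] at h1

lemma Sm.bdd {f : Field} (hI : IsOpen I) (ht : t₀ ∈ I) (hδ : 0 < δ) (hf : Sm (fullDom I) f) :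
    Bdd (nhdsAnnulus t₀ δ L) f := by
  simpa using Flat.bdd (k := 0) (L := L) hI ht hδ hf trivial

lemma confKill_dt (hI : IsOpen I) {φ : Pert} (hβ : ∀ A, Sm (fullDom I) (φ.beta A)) {t ρ z : ℝ}
    (hx : (t, ρ, z) ∈ fullDom I) (A B : Fin 2) :
    HasDerivAt (fun s => φ.confKill A B s ρ z) (φ.dt.confKill A B t ρ z) t := by
  have hU := isOpen_fullDom hI
  have h : ∀ A B, HasDerivAt (fun s => pd A (φ.beta B s) ρ z) (pd A (φ.dt.beta B t) ρ z) t := by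
    intro A B
    have := Sm.hasDerivAt_tdot hU ((hβ B).pd hU A) hx
    rwa [(hβ B).tdot_pd hU hx A] at this
  have hd : HasDerivAt (fun s => φ.divBeta s ρ z) (φ.dt.divBeta t ρ z) t := by
    unfold Pert.divBeta
    exact HasDerivAt.fun_sum fun C _ => h C C
  exact ((h A B).add (h B A)).sub (hd.const_mul _)

namespace IsRegular
variable {φ : Pert}

lemma dt (hI : IsOpen I) (h : IsRegular m a I φ) : IsRegular m a I φ.dt where
  sig := h.sig.tdot (isOpen_fullDom hI)
  om := h.om.tdot (isOpen_fullDom hI)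
  beta A := (h.beta A).tdot (isOpen_fullDom hI)
  chi A B := (h.chi A B).tdot (isOpen_fullDom hI)
  om_flat := h.om_flat.tdot hI h.om
  beta_flat := h.beta_flat.tdot hI (h.beta 0)
  shift t ht ρ hρ z A B := by
    have hx : (t, ρ, z) ∈ fullDom I := dom_subset_fullDom ⟨ht, hρ⟩
    have h1 := confKill_dt hI h.beta hx A B
    have h2 := (Sm.hasDerivAt_tdot (isOpen_fullDom hI) (h.chi A B) hx).const_mul
      (2 * Real.exp (-(2 * u0 m a ρ z)) * ρ)
    refine h1.unique (h2.congr_of_eventuallyEq ?_)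
    filter_upwards [hI.mem_nhds ht] with s hs using h.shift s hs ρ hρ z A B

lemma bdd_pd_sig (h : IsRegular m a I φ) (hI : IsOpen I) (ht : t₀ ∈ I) (hδ : 0 < δ) (A : Fin 2) :
    Bdd (nhdsAnnulus t₀ δ L) fun t => pd A (φ.sig t) :=
  (h.sig.pd (isOpen_fullDom hI) A).bdd hI ht hδ

lemma bdd_tw_div (h : IsRegular m a I φ) (hm : 0 < m) (ha : |a| = m) (hI : IsOpen I)
    (ht : t₀ ∈ I) (hδ : 0 < δ) :
    Bdd (nhdsAnnulus t₀ δ L) fun t ρ z => φ.tw m a t ρ z / ρ := by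
  refine (((h.om_flat.bdd hI ht hδ (L := L) h.om).mul (bdd_sq_div_eta0 hm ha hI ht)).mul
    (bdd_rho hI ht)).congr ?_
  filter_upwards [eventually_nhdsAnnulus hI ht] with x hx
  have hρ := hx.1.2
  have hη := eta0_pos (z := x.2.2) hm ha hρ
  rw [Pert.tw]; field_simp

lemma bdd_tw (h : IsRegular m a I φ) (hm : 0 < m) (ha : |a| = m) (hI : IsOpen I)
    (ht : t₀ ∈ I) (hδ : 0 < δ) : Bdd (nhdsAnnulus t₀ δ L) (φ.tw m a) := by
  refine ((h.bdd_tw_div hm ha hI ht hδ (L := L)).mul (bdd_rho hI ht)).congr ?_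
  filter_upwards [eventually_nhdsAnnulus hI ht] with x hx
  exact div_mul_cancel₀ _ hx.1.2.ne'

lemma bdd_dtw (h : IsRegular m a I φ) (hm : 0 < m) (ha : |a| = m) (hI : IsOpen I)
    (ht : t₀ ∈ I) (hδ : 0 < δ) (A : Fin 2) :
    Bdd (nhdsAnnulus t₀ δ L) (φ.dtw m a A) := by
  have hfl : Flat I 3 fun t => pd A (φ.om t) := by
    fin_cases A
    · exact h.om_flat.2
    · exact (h.om_flat.pd_one hI h.om).of_succ
  refine (((hfl.bdd hI ht hδ (L := L) (h.om.pd (isOpen_fullDom hI) A)).mul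
    (bdd_sq_div_eta0 hm ha hI ht)).mul (bdd_rho hI ht)).congr ?_
  filter_upwards [eventually_nhdsAnnulus hI ht] with x hx
  have hρ := hx.1.2
  have hη := eta0_pos (z := x.2.2) hm ha hρ
  rw [Pert.dtw]; field_simp

lemma bdd_confKill (h : IsRegular m a I φ) (hI : IsOpen I) (ht : t₀ ∈ I) (hδ : 0 < δ)
    (A B : Fin 2) : Bdd (nhdsAnnulus t₀ δ L) (φ.confKill A B) := by
  have hb : ∀ A B, Bdd (nhdsAnnulus t₀ δ L) fun t => pd A (φ.beta B t) := fun A B =>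
    ((h.beta B).pd (isOpen_fullDom hI) A).bdd hI ht hδ
  exact ((hb A B).add (hb B A)).sub ((Bdd.const _).mul (Bdd.sum fun C => hb C C))

/-- The gauge equation for the shift makes `χ₁` vanish at the axis. -/
lemma bdd_chi_div (h : IsRegular m a I φ) (hm : 0 < m) (ha : |a| = m) (hI : IsOpen I)
    (ht : t₀ ∈ I) (hδ : 0 < δ) (A B : Fin 2) :
    Bdd (nhdsAnnulus t₀ δ L) fun t ρ z => φ.chi A B t ρ z / ρ := by
  refine (((bdd_exp_div hm ha hI ht hδ).mul (h.bdd_confKill hI ht hδ A B)).mul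
    (Bdd.const (1 / 2))).congr ?_
  filter_upwards [eventually_nhdsAnnulus hI ht] with x hx
  have hρ := hx.1.2
  rw [h.shift _ hx.1.1 _ hρ, Real.exp_neg]
  have := Real.exp_pos (2 * u0 m a x.2.1 x.2.2)
  field_simp

lemma bdd_chi (h : IsRegular m a I φ) (hI : IsOpen I) (ht : t₀ ∈ I) (hδ : 0 < δ) (A B : Fin 2) :
    Bdd (nhdsAnnulus t₀ δ L) (φ.chi A B) := (h.chi A B).bdd hI ht hδ

lemma bdd_p (h : IsRegular m a I φ) (hm : 0 < m) (ha : |a| = m) (hI : IsOpen I)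
    (ht : t₀ ∈ I) (hδ : 0 < δ) : Bdd (nhdsAnnulus t₀ δ L) (φ.p m a) := by
  have hb := h.beta_flat.bdd hI ht hδ (L := L) (h.beta 0)
  refine ((((h.dt hI).sig.bdd hI ht hδ).sub ((Bdd.const 2).mul hb)).sub
    (Bdd.sum fun A => ((h.beta A).bdd hI ht hδ).mul (bdd_pd_sigma0 hm ha hI ht hδ A))).congr ?_
  refine Eventually.of_forall fun x => ?_
  simp only [Pert.p, Pert.dt, pow_one, mul_div_assoc]

lemma bdd_d_div (h : IsRegular m a I φ) (hm : 0 < m) (ha : |a| = m) (hI : IsOpen I)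
    (ht : t₀ ∈ I) (hδ : 0 < δ) :
    Bdd (nhdsAnnulus t₀ δ L) fun t ρ z => φ.d m a t ρ z / eta0 m a ρ z := by
  refine (((h.dt hI).bdd_tw hm ha hI ht hδ).sub (Bdd.sum fun A =>
    ((h.beta A).bdd hI ht hδ).mul (bdd_domega0 hm ha hI ht hδ A))).congr ?_
  refine Eventually.of_forall fun x => ?_
  simp only [Pert.d, Pert.tw, Pert.dt, domega0, sub_div, Finset.sum_div, mul_div_assoc]

end IsRegular
end

section
variable {m a : ℝ} {I : Set ℝ} {t₀ : ℝ} {E : Filter (ℝ × ℝ)}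

/-! ### Decay at the ends -/

/-- `f = o(r⁻¹)` along a filter. -/
def SmallFlux (l : Filter (ℝ × ℝ × ℝ)) (f : Field) : Prop :=
  (fun x : ℝ × ℝ × ℝ => rad x.2.1 x.2.2 * f x.1 x.2.1 x.2.2) =o[l] fun _ => (1 : ℝ)

namespace SmallFlux
variable {l : Filter (ℝ × ℝ × ℝ)} {f g : Field}

lemma add (hf : SmallFlux l f) (hg : SmallFlux l g) :
    SmallFlux l fun t ρ z => f t ρ z + g t ρ z := by
  simpa only [SmallFlux, mul_add] using IsLittleO.add hf hg

lemma const_mul (c : ℝ) (hf : SmallFlux l f) : SmallFlux l fun t ρ z => c * f t ρ z := by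
  simpa only [SmallFlux, mul_left_comm] using IsLittleO.const_mul_left hf c

lemma congr (hf : SmallFlux l f) (h : ∀ᶠ x in l, f x.1 x.2.1 x.2.2 = g x.1 x.2.1 x.2.2) :
    SmallFlux l g :=
  IsLittleO.congr' hf (h.mono fun x hx => by simp only [hx]) EventuallyEq.rfl

end SmallFlux

/-- `f = o(r^(-1/2))` along a filter. -/
def Small (l : Filter (ℝ × ℝ × ℝ)) (f : Field) : Prop :=
  (fun x : ℝ × ℝ × ℝ => √(rad x.2.1 x.2.2) * f x.1 x.2.1 x.2.2) =o[l] fun _ => (1 : ℝ)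

namespace Small
variable {l : Filter (ℝ × ℝ × ℝ)} {f g : Field}

lemma add (hf : Small l f) (hg : Small l g) : Small l fun t ρ z => f t ρ z + g t ρ z := by
  simpa only [Small, mul_add] using IsLittleO.add hf hg

lemma mul_bdd (hf : Small l f) (hg : Bdd l g) : Small l fun t ρ z => f t ρ z * g t ρ z := by
  simpa [Small, mul_assoc] using IsLittleO.mul_isBigO hf hg

lemma congr (hf : Small l f) (h : ∀ᶠ x in l, f x.1 x.2.1 x.2.2 = g x.1 x.2.1 x.2.2) :
    Small l g :=
  IsLittleO.congr' hf (h.mono fun x hx => by simp only [hx]) EventuallyEq.rfl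

/-- The product of two functions of size `o(r^(-1/2))` is `o(r⁻¹)`. -/
lemma mul (hf : Small l f) (hg : Small l g) :
    SmallFlux l fun t ρ z => f t ρ z * g t ρ z := by
  have := IsLittleO.mul hf hg
  simp only [mul_one] at this
  refine this.congr_left fun x => ?_
  calc _ = (√(rad x.2.1 x.2.2) * √(rad x.2.1 x.2.2)) * (f x.1 x.2.1 x.2.2 * g x.1 x.2.1 x.2.2) := by
        ring
    _ = _ := by rw [Real.mul_self_sqrt rad_nonneg]

lemma mul_sqrt (hf : Small l f)
    (hg : Bdd l fun t ρ z => √(rad ρ z) * g t ρ z) :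
    SmallFlux l fun t ρ z => f t ρ z * g t ρ z := by
  have := IsLittleO.mul_isBigO hf hg
  simp only [mul_one] at this
  refine this.congr_left fun x => ?_
  calc _ = (√(rad x.2.1 x.2.2) * √(rad x.2.1 x.2.2)) * (f x.1 x.2.1 x.2.2 * g x.1 x.2.1 x.2.2) := by
        ring
    _ = _ := by rw [Real.mul_self_sqrt rad_nonneg]

end Small

lemma eventually_end (hI : IsOpen I) (ht : t₀ ∈ I) (hE : E ≤ 𝓟 halfPlane) :
    ∀ᶠ x in 𝓝 t₀ ×ˢ E, x ∈ dom I := by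
  have h1 : ∀ᶠ x in 𝓝 t₀ ×ˢ E, x.1 ∈ I := tendsto_fst.eventually (hI.mem_nhds ht)
  have h2 : ∀ᶠ x in 𝓝 t₀ ×ˢ E, x.2 ∈ halfPlane :=
    tendsto_snd.eventually (hE (mem_principal_self _))
  filter_upwards [h1, h2] with x h1 h2 using ⟨h1, h2⟩

lemma endInfinity_le : endInfinity ≤ 𝓟 halfPlane := inf_le_right

lemma endOrigin_le : endOrigin ≤ 𝓟 halfPlane := inf_le_right

lemma isBigO_one_of_le {l : Filter (ℝ × ℝ × ℝ)} {F : ℝ × ℝ × ℝ → ℝ} (C : ℝ)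
    (h : ∀ᶠ x in l, |F x| ≤ C) : F =O[l] fun _ => (1 : ℝ) :=
  IsBigO.of_bound C (h.mono fun x hx => by simpa using hx)

lemma sqrt_mul_rpow {r : ℝ} (hr : 0 < r) : √r * r ^ (-1 / 2 : ℝ) = 1 := by
  rw [Real.sqrt_eq_rpow, ← Real.rpow_add hr]; norm_num

lemma LittleO1.small (hI : IsOpen I) (ht : t₀ ∈ I) (hE : E ≤ 𝓟 halfPlane) {f : Field}
    (h : LittleO1 I E (-1 / 2) f) : Small (𝓝 t₀ ×ˢ E) f := by
  refine ((isBigO_refl (fun x : ℝ × ℝ × ℝ => √(rad x.2.1 x.2.2)) _).mul_isLittleO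
    (h t₀ ht).1).trans_isBigO (isBigO_one_of_le 1 ?_)
  filter_upwards [eventually_end hI ht hE] with x hx
  rw [sqrt_mul_rpow (rad_pos hx.2), abs_one]

lemma LittleO1.small_pd (hI : IsOpen I) (ht : t₀ ∈ I) (hE : E ≤ 𝓟 halfPlane) {f : Field}
    (h : LittleO1 I E (-1 / 2) f) (A : Fin 2) :
    Small (𝓝 t₀ ×ˢ E) fun t ρ z => ρ * pd A (f t) ρ z := by
  refine IsLittleO.congr_left (((isBigO_refl (fun x : ℝ × ℝ × ℝ => √(rad x.2.1 x.2.2) * x.2.1)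
    _).mul_isLittleO ((h t₀ ht).2 A)).trans_isBigO (isBigO_one_of_le 1 ?_)) fun x => by ring
  filter_upwards [eventually_end hI ht hE] with x hx
  have hr := rad_pos (z := x.2.2) hx.2
  have hρ : 0 < x.2.1 := hx.2
  rw [Real.rpow_sub_one hr.ne', mul_div_assoc', mul_right_comm, sqrt_mul_rpow hr, one_mul,
    abs_of_pos (by positivity), div_le_one hr]
  exact left_le_rad

/-- The decay at an end that the linear perturbation and its time derivative have, in terms of
`ω₁ / η₀`. -/
structure IsDecaying (m a : ℝ) (I : Set ℝ) (E : Filter (ℝ × ℝ)) (φ : Pert) : Prop where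
  sig : ∀ t₀ ∈ I, Small (𝓝 t₀ ×ˢ E) φ.sig
  pd_sig : ∀ t₀ ∈ I, ∀ A, Small (𝓝 t₀ ×ˢ E) fun t ρ z => ρ * pd A (φ.sig t) ρ z
  tw : ∀ t₀ ∈ I, Small (𝓝 t₀ ×ˢ E) (φ.tw m a)
  dtw : ∀ t₀ ∈ I, ∀ A, Small (𝓝 t₀ ×ˢ E) fun t ρ z => ρ * φ.dtw m a A t ρ z
  beta : ∀ t₀ ∈ I, ∀ A, Small (𝓝 t₀ ×ˢ E) (φ.beta A)
  chi : ∀ t₀ ∈ I, ∀ A B, Small (𝓝 t₀ ×ˢ E) (φ.chi A B)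

/-- At both ends the weights of the twist conditions are such that `√r η₀ r^k` is bounded. -/
lemma IsDecaying.of_littleO1 (hm : 0 < m) (ha : |a| = m) (hI : IsOpen I) (hE : E ≤ 𝓟 halfPlane)
    {φ : Pert} (hom : Sm (fullDom I) φ.om) {k C : ℝ} (hC : ∀ᶠ x in E,
      √(rad x.1 x.2) * eta0 m a x.1 x.2 * rad x.1 x.2 ^ k ≤ C)
    (hsig : LittleO1 I E (-1 / 2) φ.sig) (hbeta : ∀ A, LittleO1 I E (-1 / 2) (φ.beta A))
    (hchi : ∀ A B, LittleO1 I E (-1 / 2) (φ.chi A B)) (htw : LittleO1 I E k (φ.omBar m a)) :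
    IsDecaying m a I E φ := by
  have hw : ∀ t₀ ∈ I, Small (𝓝 t₀ ×ˢ E) fun t ρ z => eta0 m a ρ z * φ.omBar m a t ρ z := by
    intro t₀ ht
    refine IsLittleO.congr_left (((isBigO_refl (fun x : ℝ × ℝ × ℝ => √(rad x.2.1 x.2.2)
      * eta0 m a x.2.1 x.2.2) _).mul_isLittleO (htw t₀ ht).1).trans_isBigO
      (isBigO_one_of_le C ?_)) fun x => by ring
    filter_upwards [eventually_end hI ht hE, tendsto_snd.eventually hC] with x hx h1
    have hη := eta0_pos (z := x.2.2) hm ha hx.2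
    have hr := rad_pos (z := x.2.2) hx.2
    rwa [abs_of_pos (by positivity)]
  refine ⟨fun t ht => hsig.small hI ht hE, fun t ht A => hsig.small_pd hI ht hE A,
    fun t ht => (hw t ht).congr ?_, fun t ht A => ?_, fun t ht A => (hbeta A).small hI ht hE,
    fun t ht A B => (hchi A B).small hI ht hE⟩
  · filter_upwards [eventually_end hI ht hE] with x hx
    have hη := eta0_pos (z := x.2.2) hm ha hx.2
    rw [Pert.omBar, Pert.tw]; field_simp
  · have h1 : Small (𝓝 t ×ˢ E) fun t ρ z => eta0 m a ρ z * (ρ * pd A (φ.omBar m a t) ρ z) := by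
      refine IsLittleO.congr_left (((isBigO_refl (fun x : ℝ × ℝ × ℝ => √(rad x.2.1 x.2.2)
        * eta0 m a x.2.1 x.2.2 * x.2.1) _).mul_isLittleO ((htw t ht).2 A)).trans_isBigO
        (isBigO_one_of_le C ?_)) fun x => by ring
      filter_upwards [eventually_end hI ht hE, tendsto_snd.eventually hC] with x hx h1
      have hη := eta0_pos (z := x.2.2) hm ha hx.2
      have hr := rad_pos (z := x.2.2) hx.2
      have hρ : 0 < x.2.1 := hx.2
      rw [abs_of_pos (by positivity), Real.rpow_sub_one hr.ne']
      calc _ = √(rad x.2.1 x.2.2) * eta0 m a x.2.1 x.2.2 * rad x.2.1 x.2.2 ^ k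
            * (x.2.1 / rad x.2.1 x.2.2) := by ring
        _ ≤ √(rad x.2.1 x.2.2) * eta0 m a x.2.1 x.2.2 * rad x.2.1 x.2.2 ^ k * 1 := by
            gcongr; rw [div_le_one hr]; exact left_le_rad
        _ ≤ C := by rwa [mul_one]
    have hT : Bdd (𝓝 t ×ˢ E) fun _ ρ z => 2 * (ρ * pd A (eta0 m a) ρ z / eta0 m a ρ z) := by
      refine Bdd.of_bound (2 * 34) ?_
      filter_upwards [eventually_end hI ht hE] with x hx
      rw [abs_mul, abs_two]
      gcongr
      exact abs_rho_mul_pd_eta0_le hm ha hx.2 A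
    refine (h1.add ((hw t ht).mul_bdd hT)).congr ?_
    filter_upwards [eventually_end hI ht hE] with x hx
    obtain ⟨t, ρ, z⟩ := x
    have hη := eta0_pos (z := z) hm ha hx.2
    have hρ : 0 < ρ := hx.2
    have hF : Sm (dom I) φ.om := hom.mono dom_subset_fullDom
    have hE := sm_eta0 (I := I) hm ha
    have hd1 := pd_div (hF.diffS (isOpen_dom hI) hx)
      (Sm.diffS (isOpen_dom hI) (hE.pow 2) hx) (pow_pos hη 2).ne' A
    have hd2 := pd_pow (Sm.diffS (isOpen_dom hI) hE hx) 2 A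
    have e : pd A (φ.omBar m a t) ρ z = _ := hd1
    simp only
    rw [e, hd2, Pert.omBar, Pert.dtw]
    push_cast
    field_simp
    ring

lemma eventually_endInfinity {P : ℝ × ℝ → Prop} : (∀ᶠ x in endInfinity, P x) ↔
    ∃ R : ℝ, ∀ x ∈ halfPlane, R ≤ rad x.1 x.2 → P x := by
  rw [endInfinity, eventually_inf_principal, eventually_comap, eventually_atTop]
  exact ⟨fun ⟨R, h⟩ => ⟨R, fun x hx hr => h _ hr x rfl hx⟩,
    fun ⟨R, h⟩ => ⟨R, fun b hb x hx hp => h x hp (hx ▸ hb)⟩⟩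

lemma eventually_endOrigin {P : ℝ × ℝ → Prop} : (∀ᶠ x in endOrigin, P x) ↔
    ∃ R > 0, ∀ x ∈ halfPlane, rad x.1 x.2 ≤ R → P x := by
  rw [endOrigin, eventually_nhdsWithin_iff, Metric.eventually_nhds_iff]
  constructor
  · rintro ⟨ε, hε, h⟩
    refine ⟨ε / 2, half_pos hε, fun x hx hr => h ?_ hx⟩
    rw [Prod.dist_eq, Real.dist_0_eq_abs, Real.dist_0_eq_abs, max_lt_iff]
    exact ⟨abs_left_le_rad.trans_lt (by linarith), abs_right_le_rad.trans_lt (by linarith)⟩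
  · rintro ⟨R, hR, h⟩
    refine ⟨R / 2, half_pos hR, fun x hd hx => h x hx ?_⟩
    rw [Prod.dist_eq, Real.dist_0_eq_abs, Real.dist_0_eq_abs, max_lt_iff] at hd
    refine Real.sqrt_le_iff.2 ⟨hR.le, ?_⟩
    have h1 : x.1 ^ 2 ≤ (R / 2) ^ 2 := sq_le_sq' (by linarith [(abs_lt.1 hd.1).1])
      (abs_lt.1 hd.1).2.le
    have h2 : x.2 ^ 2 ≤ (R / 2) ^ 2 := sq_le_sq' (by linarith [(abs_lt.1 hd.2).1])
      (abs_lt.1 hd.2).2.le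
    nlinarith

lemma eta0_le_four_mul {ρ z : ℝ} (hm : 0 < m) (ha : |a| = m) (h : 0 < ρ) :
    eta0 m a ρ z ≤ 4 * (rad ρ z + m) ^ 2 := by
  have hr := rad_pos (z := z) h
  refine (eta0_le hm ha h).trans ?_
  gcongr
  rw [div_le_iff₀ (by positivity), mul_comm]
  gcongr
  exact left_le_rad

lemma weight_infinity (hm : 0 < m) (ha : |a| = m) : ∀ᶠ x in endInfinity,
    √(rad x.1 x.2) * eta0 m a x.1 x.2 * rad x.1 x.2 ^ (-5 / 2 : ℝ) ≤ 16 := by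
  refine eventually_endInfinity.2 ⟨m, fun x hx hr => ?_⟩
  have h0 := rad_pos (z := x.2) hx
  have hη : eta0 m a x.1 x.2 ≤ 16 * rad x.1 x.2 ^ 2 := by
    refine (eta0_le_four_mul hm ha hx).trans ?_
    nlinarith
  have e : rad x.1 x.2 ^ (-5 / 2 : ℝ) = rad x.1 x.2 ^ (-1 / 2 : ℝ) / rad x.1 x.2 ^ 2 := by
    rw [← Real.rpow_natCast, ← Real.rpow_sub h0]; norm_num
  calc _ ≤ √(rad x.1 x.2) * (16 * rad x.1 x.2 ^ 2) * rad x.1 x.2 ^ (-5 / 2 : ℝ) := by gcongr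
    _ = 16 * (√(rad x.1 x.2) * rad x.1 x.2 ^ (-1 / 2 : ℝ)) := by rw [e]; field_simp
    _ = 16 := by rw [sqrt_mul_rpow h0, mul_one]
    _ ≤ 16 := le_rfl

lemma weight_origin (hm : 0 < m) (ha : |a| = m) : ∀ᶠ x in endOrigin,
    √(rad x.1 x.2) * eta0 m a x.1 x.2 * rad x.1 x.2 ^ (-1 / 2 : ℝ) ≤ 16 * m ^ 2 := by
  refine eventually_endOrigin.2 ⟨m, hm, fun x hx hr => ?_⟩
  have h0 := rad_pos (z := x.2) hx
  have hη : eta0 m a x.1 x.2 ≤ 16 * m ^ 2 := by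
    refine (eta0_le_four_mul hm ha hx).trans ?_
    nlinarith
  rw [mul_right_comm, sqrt_mul_rpow h0, one_mul]
  exact hη

lemma bdd_rho_mul_domega0 (hm : 0 < m) (ha : |a| = m) (hI : IsOpen I) (ht : t₀ ∈ I)
    (hE : E ≤ 𝓟 halfPlane) (A : Fin 2) :
    Bdd (𝓝 t₀ ×ˢ E) fun _ ρ z => ρ * domega0 m a A ρ z := by
  refine Bdd.of_bound 56 ?_
  filter_upwards [eventually_end hI ht hE] with x hx
  have hr := rad_pos (z := x.2.2) hx.2
  have hρ : 0 < x.2.1 := hx.2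
  have hl := left_le_rad (ρ := x.2.1) (z := x.2.2)
  rw [abs_mul, abs_of_pos hρ]
  calc _ ≤ x.2.1 * (56 * m ^ 2 * x.2.1 / (rad x.2.1 x.2.2 ^ 2 * (rad x.2.1 x.2.2 + m) ^ 2)) := by
        gcongr; exact abs_pd_omega0_div_eta0_le hm ha hρ A
    _ ≤ rad x.2.1 x.2.2 * (56 * (rad x.2.1 x.2.2 + m) ^ 2 * rad x.2.1 x.2.2
          / (rad x.2.1 x.2.2 ^ 2 * (rad x.2.1 x.2.2 + m) ^ 2)) := by gcongr; linarith
    _ = 56 := by field_simp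

lemma sqrt_mul_le {r m : ℝ} (hr : 0 < r) (hm : 0 < m) : √r * (m / (r + m)) ≤ √m := by
  rw [mul_div_assoc', div_le_iff₀ (by positivity)]
  have h1 := Real.mul_self_sqrt hr.le
  have h2 := Real.mul_self_sqrt hm.le
  have h3 := Real.sqrt_nonneg r
  have h4 := Real.sqrt_pos.2 hm
  have e : √r * m = √m * (√r * √m) := by linear_combination (-√r) * h2
  rw [e]
  gcongr
  nlinarith [sq_nonneg (√r - √m)]

lemma bdd_sqrt_mul_pd_sigma0 (hm : 0 < m) (ha : |a| = m) (hI : IsOpen I) (ht : t₀ ∈ I)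
    (hE : E ≤ 𝓟 halfPlane) (A : Fin 2) :
    Bdd (𝓝 t₀ ×ˢ E) fun _ ρ z => √(rad ρ z) * (ρ * pd A (sigma0 m a) ρ z) := by
  refine Bdd.of_bound (32 * √m) ?_
  filter_upwards [eventually_end hI ht hE] with x hx
  have hr := rad_pos (z := x.2.2) hx.2
  have hρ : 0 < x.2.1 := hx.2
  rw [abs_mul, abs_mul, abs_of_pos hρ, abs_of_nonneg (Real.sqrt_nonneg _)]
  calc _ ≤ √(rad x.2.1 x.2.2) * (rad x.2.1 x.2.2
          * (32 * m / (rad x.2.1 x.2.2 * (rad x.2.1 x.2.2 + m)))) := by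
        gcongr
        · exact left_le_rad
        · exact abs_pd_sigma0_le hm ha hρ A
    _ = 32 * (√(rad x.2.1 x.2.2) * (m / (rad x.2.1 x.2.2 + m))) := by field_simp
    _ ≤ _ := by gcongr; exact sqrt_mul_le hr hm

lemma bdd_sqrt_mul_domega0 (hm : 0 < m) (ha : |a| = m) (hI : IsOpen I) (ht : t₀ ∈ I)
    (hE : E ≤ 𝓟 halfPlane) (A : Fin 2) :
    Bdd (𝓝 t₀ ×ˢ E) fun _ ρ z => √(rad ρ z) * (ρ * domega0 m a A ρ z) := by
  refine Bdd.of_bound (56 * √m) ?_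
  filter_upwards [eventually_end hI ht hE] with x hx
  have hr := rad_pos (z := x.2.2) hx.2
  have hρ : 0 < x.2.1 := hx.2
  have hl := left_le_rad (ρ := x.2.1) (z := x.2.2)
  rw [abs_mul, abs_mul, abs_of_pos hρ, abs_of_nonneg (Real.sqrt_nonneg _)]
  calc _ ≤ √(rad x.2.1 x.2.2) * (x.2.1 * (56 * m ^ 2 * x.2.1
          / (rad x.2.1 x.2.2 ^ 2 * (rad x.2.1 x.2.2 + m) ^ 2))) := by
        gcongr; exact abs_pd_omega0_div_eta0_le hm ha hρ A
    _ ≤ √(rad x.2.1 x.2.2) * (rad x.2.1 x.2.2 * (56 * (m * (rad x.2.1 x.2.2 + m))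
          * rad x.2.1 x.2.2 / (rad x.2.1 x.2.2 ^ 2 * (rad x.2.1 x.2.2 + m) ^ 2))) := by
        gcongr; nlinarith
    _ = 56 * (√(rad x.2.1 x.2.2) * (m / (rad x.2.1 x.2.2 + m))) := by field_simp
    _ ≤ _ := by gcongr; exact sqrt_mul_le hr hm
end

section
variable {m a : ℝ} {I : Set ℝ} {t₀ t ρ z : ℝ}

/-! ### The three divergence identities -/

/-- The flux of `ε₁`. -/
noncomputable def eps1Flux (m a : ℝ) (φ : Pert) (A : Fin 2) : Field := fun t ρ z =>
  ρ * (2 * φ.sig t ρ z) * pd A (sigma0 m a) ρ z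
    + ρ * (2 * φ.om t ρ z / eta0 m a ρ z ^ 2) * pd A (omega0 m a) ρ z

/-- The flux of Carter's identity, whose divergence is `ε̄₂ - ε₂`. -/
noncomputable def carterFlux (m a : ℝ) (φ : Pert) (A : Fin 2) : Field := fun t ρ z =>
  ρ * (4 * (φ.sig t ρ z * φ.om t ρ z) / eta0 m a ρ z ^ 2) * pd A (omega0 m a) ρ z
    + ρ * (-2 * φ.om t ρ z ^ 2 / eta0 m a ρ z ^ 3) * pd A (eta0 m a) ρ z

/-- The part of the energy flux that comes from the wave equations of `σ₁` and `ω₁`. -/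
noncomputable def waveFlux (m a : ℝ) (φ : Pert) (A : Fin 2) : Field := fun t ρ z =>
  ρ * (4 * φ.dt.sig t ρ z) * pd A (φ.sig t) ρ z
    + ρ * (4 * φ.dt.om t ρ z / eta0 m a ρ z ^ 2) * pd A (φ.om t) ρ z
    + ρ * (-8 * (φ.sig t ρ z * φ.dt.om t ρ z) / eta0 m a ρ z ^ 2) * pd A (omega0 m a) ρ z

/-- The part of the energy flux that comes from the shift. -/
noncomputable def shiftFlux (φ : Pert) (A : Fin 2) : Field := fun t ρ z =>
  8 * ∑ B, φ.beta B t ρ z * φ.dt.chi B A t ρ z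

/-- The energy flux, whose divergence is the time derivative of `ε₂`. -/
noncomputable def energyFlux (m a : ℝ) (φ : Pert) (A : Fin 2) : Field := fun t ρ z =>
  waveFlux m a φ A t ρ z + shiftFlux φ A t ρ z

/-- The symmetric bilinear form of the quadratic form `ε₂`. -/
noncomputable def eps2Form (m a : ℝ) (φ ψ : Pert) : Field := fun t ρ z =>
  (2 * (Real.exp (2 * u0 m a ρ z) / ρ ^ 2) * (φ.p m a t ρ z * ψ.p m a t ρ z)
    + 2 * (Real.exp (2 * u0 m a ρ z) / (ρ ^ 2 * eta0 m a ρ z ^ 2))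
      * (φ.d m a t ρ z * ψ.d m a t ρ z)
    + 4 * Real.exp (-(2 * u0 m a ρ z)) * ∑ A, ∑ B, φ.chi A B t ρ z * ψ.chi A B t ρ z
    + 2 * gdot (φ.sig t) (ψ.sig t) ρ z
    + 2 * gdot (φ.om t) (ψ.om t) ρ z / eta0 m a ρ z ^ 2
    + 4 * (gdot (omega0 m a) (omega0 m a) ρ z / eta0 m a ρ z ^ 2)
      * (φ.sig t ρ z * ψ.sig t ρ z)
    - 4 * (gdot (omega0 m a) (ψ.om t) ρ z * φ.sig t ρ z
      + gdot (omega0 m a) (φ.om t) ρ z * ψ.sig t ρ z) / eta0 m a ρ z ^ 2) * ρ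

lemma eps2Form_self (φ : Pert) : eps2Form m a φ φ = φ.eps2 m a := by
  funext t ρ z
  simp only [eps2Form, Pert.eps2, Pert.kin, Pert.chiSq, Fin.sum_univ_two]
  ring

lemma lap3_eta0 (hm : 0 < m) (ha : |a| = m) (h : 0 < ρ) :
    lap3 (eta0 m a) ρ z = (gdot (eta0 m a) (eta0 m a) ρ z
      - gdot (omega0 m a) (omega0 m a) ρ z) / eta0 m a ρ z := by
  have hη := eta0_pos (z := z) hm ha h
  have hU := isOpen_dom isOpen_univ
  have hE := Sm.diffS_static (z := z) (sm_eta0 hm ha) h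
  have hs : ∀ A, DiffS (pd A (sigma0 m a)) ρ z := fun A =>
    Sm.diffS_static (f := pd A (sigma0 m a)) ((sm_sigma0 hm ha).pd hU A) h
  have hl := lap3_sigma0 (z := z) hm ha h
  have e0 := pd_zero_eq (f := pd 0 (eta0 m a)) (z := z) ((hE.slice0.mul
    (((hasDerivAt_const ρ (2 : ℝ)).div (hasDerivAt_id ρ) h.ne').add
      (hs 0).slice0)).congr_of_eventuallyEq (eventually_of_mem (Ioi_mem_nhds h) fun s hs => by
        beta_reduce
        rw [pd_eta0 hm ha hs, pd_rhoC_zero, mul_one]; rfl))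
  have e1 := pd_one_eq (f := pd 1 (eta0 m a)) (ρ := ρ) ((hE.slice1.mul
    (hs 1).slice1).congr_of_eventuallyEq (Eventually.of_forall fun s => by
        beta_reduce
        rw [pd_eta0 hm ha h, pd_rhoC_one, mul_zero, zero_div, zero_add]; rfl))
  simp only [lap3, lap2, gdot, Fin.sum_univ_two] at hl ⊢
  have f0 := pd_eta0 (z := z) hm ha h 0
  have f1 := pd_eta0 (z := z) hm ha h 1
  rw [pd_rhoC_zero] at f0
  rw [pd_rhoC_one] at f1
  rw [e0, e1]
  simp only [Pi.add_apply, Pi.div_apply, id]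
  rw [eq_div_iff hη.ne', f0, f1]
  have hl' : pd 0 (pd 0 (sigma0 m a)) ρ z = -((pd 0 (omega0 m a) ρ z * pd 0 (omega0 m a) ρ z +
      pd 1 (omega0 m a) ρ z * pd 1 (omega0 m a) ρ z) / eta0 m a ρ z ^ 2)
      - pd 1 (pd 1 (sigma0 m a)) ρ z - pd 0 (sigma0 m a) ρ z / ρ := by linarith
  rw [hl']
  field_simp
  ring

lemma sum_pd_add {F G : Fin 2 → Scal} (hF : ∀ A, DiffS (F A) ρ z) (hG : ∀ A, DiffS (G A) ρ z) :
    ∑ A, pd A (fun ρ z => F A ρ z + G A ρ z) ρ z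
      = ∑ A, pd A (F A) ρ z + ∑ A, pd A (G A) ρ z := by
  rw [← Finset.sum_add_distrib]
  exact Finset.sum_congr rfl fun A _ => pd_add (hF A) (hG A) A

section Smooth
variable {φ ψ : Pert}

lemma sm_flux_term {f g : Field} (hI : IsOpen I) (hf : Sm (dom I) f) (hg : Sm (dom I) g)
    (A : Fin 2) : Sm (dom I) fun t ρ z => ρ * f t ρ z * pd A (g t) ρ z :=
  (Sm.rho.mul hf).mul (hg.pd (isOpen_dom hI) A)

lemma sm_div_eta0 {f : Field} (hm : 0 < m) (ha : |a| = m) (hf : Sm (dom I) f) (n : ℕ) :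
    Sm (dom I) fun t ρ z => f t ρ z / eta0 m a ρ z ^ n :=
  hf.div ((sm_eta0 hm ha).pow n) fun _ hx => (pow_pos (eta0_pos hm ha hx.2) n).ne'

namespace IsRegular

lemma sm_sig (h : IsRegular m a I φ) : Sm (dom I) φ.sig := h.sig.mono dom_subset_fullDom

lemma sm_om (h : IsRegular m a I φ) : Sm (dom I) φ.om := h.om.mono dom_subset_fullDom

lemma sm_beta (h : IsRegular m a I φ) (A : Fin 2) : Sm (dom I) (φ.beta A) :=
  (h.beta A).mono dom_subset_fullDom

lemma sm_chi (h : IsRegular m a I φ) (A B : Fin 2) : Sm (dom I) (φ.chi A B) :=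
  (h.chi A B).mono dom_subset_fullDom

lemma sm_p (h : IsRegular m a I φ) (hm : 0 < m) (ha : |a| = m) (hI : IsOpen I) :
    Sm (dom I) (φ.p m a) :=
  ((h.sm_sig.tdot (isOpen_dom hI)).sub (((Sm.const 2).mul (h.sm_beta 0)).div Sm.rho
    fun _ hx => hx.2.ne')).sub (Sm.sum fun A => (h.sm_beta A).mul
      ((sm_sigma0 hm ha).pd (isOpen_dom hI) A))

lemma sm_d (h : IsRegular m a I φ) (hm : 0 < m) (ha : |a| = m) (hI : IsOpen I) :
    Sm (dom I) (φ.d m a) :=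
  (h.sm_om.tdot (isOpen_dom hI)).sub (Sm.sum fun A => (h.sm_beta A).mul
    ((sm_omega0 hm ha).pd (isOpen_dom hI) A))

lemma hasDerivAt_p (h : IsRegular m a I φ) (hI : IsOpen I) (hx : (t, ρ, z) ∈ dom I) :
    HasDerivAt (fun s => φ.p m a s ρ z) (φ.dt.p m a t ρ z) t := by
  have hU := isOpen_dom hI
  have hβ := fun A => Sm.hasDerivAt_tdot hU (h.sm_beta A) hx
  exact ((Sm.hasDerivAt_tdot hU (h.sm_sig.tdot hU) hx).sub
    (((hβ 0).const_mul 2).div_const ρ)).sub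
    (HasDerivAt.fun_sum fun A _ => (hβ A).mul_const (pd A (sigma0 m a) ρ z))

lemma hasDerivAt_d (h : IsRegular m a I φ) (hI : IsOpen I) (hx : (t, ρ, z) ∈ dom I) :
    HasDerivAt (fun s => φ.d m a s ρ z) (φ.dt.d m a t ρ z) t := by
  have hU := isOpen_dom hI
  exact (Sm.hasDerivAt_tdot hU (h.sm_om.tdot hU) hx).sub
    (HasDerivAt.fun_sum fun A _ => (Sm.hasDerivAt_tdot hU (h.sm_beta A) hx).mul_const
      (pd A (omega0 m a) ρ z))

lemma hasDerivAt_pd {f : Field} (hf : Sm (dom I) f) (hI : IsOpen I) (hx : (t, ρ, z) ∈ dom I)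
    (A : Fin 2) : HasDerivAt (fun s => pd A (f s) ρ z) (pd A (tdot f t) ρ z) t := by
  have hU := isOpen_dom hI
  have := Sm.hasDerivAt_tdot hU (hf.pd hU A) hx
  rwa [hf.tdot_pd hU hx A] at this

lemma hasDerivAt_eps2 (h : IsRegular m a I φ) (hI : IsOpen I) (hx : (t, ρ, z) ∈ dom I) :
    HasDerivAt (fun s => φ.eps2 m a s ρ z) (2 * eps2Form m a φ φ.dt t ρ z) t := by
  have hU := isOpen_dom hI
  have hs := Sm.hasDerivAt_tdot hU h.sm_sig hx
  have hp := h.hasDerivAt_p hI hx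
  have hd := h.hasDerivAt_d hI hx
  have hsp := hasDerivAt_pd h.sm_sig hI hx
  have hop := hasDerivAt_pd h.sm_om hI hx
  have hχ := fun A B => Sm.hasDerivAt_tdot hU (h.sm_chi A B) hx
  have h1 : HasDerivAt (fun s => φ.chiSq s ρ z)
      (∑ A, ∑ B, 2 * φ.chi A B t ρ z * φ.dt.chi A B t ρ z) t :=
    HasDerivAt.fun_sum fun A _ => HasDerivAt.fun_sum fun B _ =>
      ((hχ A B).fun_pow 2).congr_deriv (by simp [Pert.dt])
  have h2 : HasDerivAt (fun s => gdot (φ.sig s) (φ.sig s) ρ z)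
      (2 * gdot (φ.sig t) (φ.dt.sig t) ρ z) t := by
    refine (HasDerivAt.fun_sum (u := Finset.univ) fun A _ => (hsp A).mul (hsp A)).congr_deriv ?_
    simp only [gdot, Pert.dt, Fin.sum_univ_two]; ring
  have h3 : HasDerivAt (fun s => gdot (φ.om s) (φ.om s) ρ z)
      (2 * gdot (φ.om t) (φ.dt.om t) ρ z) t := by
    refine (HasDerivAt.fun_sum (u := Finset.univ) fun A _ => (hop A).mul (hop A)).congr_deriv ?_
    simp only [gdot, Pert.dt, Fin.sum_univ_two]; ring
  have h4 : HasDerivAt (fun s => gdot (omega0 m a) (φ.om s) ρ z)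
      (gdot (omega0 m a) (φ.dt.om t) ρ z) t :=
    HasDerivAt.fun_sum fun A _ => (hop A).const_mul (pd A (omega0 m a) ρ z)
  refine ((((((((hp.fun_pow 2).const_mul (2 * (Real.exp (2 * u0 m a ρ z) / ρ ^ 2))).add
    ((hd.fun_pow 2).const_mul (2 * (Real.exp (2 * u0 m a ρ z) / (ρ ^ 2 * eta0 m a ρ z ^ 2))))).add
    (h1.const_mul (4 * Real.exp (-(2 * u0 m a ρ z))))).add (h2.const_mul 2)).add
    ((h3.const_mul 2).div_const (eta0 m a ρ z ^ 2))).add ((hs.fun_pow 2).const_mul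
    (4 * (gdot (omega0 m a) (omega0 m a) ρ z / eta0 m a ρ z ^ 2)))).sub
    (((h4.const_mul 8).mul hs).div_const (eta0 m a ρ z ^ 2))).mul_const ρ |>.congr_deriv ?_
  simp only [eps2Form, Fin.sum_univ_two, Pert.dt]
  push_cast
  ring

end IsRegular
end Smooth

section Div
variable {φ : Pert}

lemma diffS_eta0_pow (hm : 0 < m) (ha : |a| = m) (h : 0 < ρ) (n : ℕ) :
    DiffS (fun ρ z => eta0 m a ρ z ^ n) ρ z :=
  Sm.diffS_static (f := fun ρ z => eta0 m a ρ z ^ n) ((sm_eta0 hm ha).pow n) h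

lemma div_eps1Flux (hm : 0 < m) (ha : |a| = m) (hI : IsOpen I) (h : IsRegular m a I φ)
    (hx : (t, ρ, z) ∈ dom I) :
    ∑ A, pd A (eps1Flux m a φ A t) ρ z = φ.eps1 m a t ρ z := by
  have hU := isOpen_dom hI
  have hρ : 0 < ρ := hx.2
  have hη := eta0_pos (z := z) hm ha hρ
  have sσ0 := sm_sigma0 (I := Set.univ) hm ha
  have sω0 := sm_omega0 (I := Set.univ) hm ha
  have hV := isOpen_dom isOpen_univ
  have hdσ : DiffS (φ.sig t) ρ z := Sm.diffS hU h.sm_sig hx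
  have hdω : DiffS (φ.om t) ρ z := Sm.diffS hU h.sm_om hx
  have hdη : DiffS (eta0 m a) ρ z := Sm.diffS_static (sm_eta0 hm ha) hρ
  have hdη2 := diffS_eta0_pow (z := z) hm ha hρ 2
  have hdσ2 : DiffS (fun ρ z => 2 * φ.sig t ρ z) ρ z := hdσ.const_mul 2
  have hdω2 : DiffS (fun ρ z => 2 * φ.om t ρ z) ρ z := hdω.const_mul 2
  have hdq : DiffS (fun ρ z => 2 * φ.om t ρ z / eta0 m a ρ z ^ 2) ρ z :=
    hdω2.div hdη2 (pow_pos hη 2).ne'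
  have hs0 : ∀ A, DiffS (pd A (sigma0 m a)) ρ z := fun A =>
    Sm.diffS_static (f := pd A (sigma0 m a)) (sσ0.pd hV A) hρ
  have hw0 : ∀ A, DiffS (pd A (omega0 m a)) ρ z := fun A =>
    Sm.diffS_static (f := pd A (omega0 m a)) (sω0.pd hV A) hρ
  have hr : DiffS (fun ρ _ => ρ) ρ z := diffS_rhoC
  have e : ∑ A, pd A (eps1Flux m a φ A t) ρ z = _ :=
    sum_pd_add (F := fun A ρ z => ρ * (2 * φ.sig t ρ z) * pd A (sigma0 m a) ρ z)
      (G := fun A ρ z => ρ * (2 * φ.om t ρ z / eta0 m a ρ z ^ 2) * pd A (omega0 m a) ρ z)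
      (fun A => (hr.mul hdσ2).mul (hs0 A))
      (fun A => (hr.mul hdq).mul (hw0 A))
  rw [e, div_smul_grad hdσ2 hs0 hρ.ne', div_smul_grad hdq hw0 hρ.ne', lap3_sigma0 hm ha hρ,
    lap3_omega0 hm ha hρ]
  simp only [gdot, Pert.eps1, Fin.sum_univ_two, pd_const_mul hdσ,
    pd_div hdω2 hdη2 (pow_pos hη 2).ne', pd_const_mul hdω, pd_pow hdη]
  push_cast
  field_simp
  ring

lemma div_carterFlux (hm : 0 < m) (ha : |a| = m) (hI : IsOpen I) (h : IsRegular m a I φ)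
    (hx : (t, ρ, z) ∈ dom I) :
    ∑ A, pd A (carterFlux m a φ A t) ρ z = φ.eps2Bar m a t ρ z - φ.eps2 m a t ρ z := by
  have hU := isOpen_dom hI
  have hρ : 0 < ρ := hx.2
  have hη := eta0_pos (z := z) hm ha hρ
  have sη := sm_eta0 (I := Set.univ) hm ha
  have sω0 := sm_omega0 (I := Set.univ) hm ha
  have hV := isOpen_dom isOpen_univ
  have hdσ : DiffS (φ.sig t) ρ z := Sm.diffS hU h.sm_sig hx
  have hdω : DiffS (φ.om t) ρ z := Sm.diffS hU h.sm_om hx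
  have hdη : DiffS (eta0 m a) ρ z := Sm.diffS_static sη hρ
  have hdη2 := diffS_eta0_pow (z := z) hm ha hρ 2
  have hdη3 := diffS_eta0_pow (z := z) hm ha hρ 3
  have hdσω : DiffS (fun ρ z => φ.sig t ρ z * φ.om t ρ z) ρ z := hdσ.mul hdω
  have hdωω : DiffS (fun ρ z => φ.om t ρ z ^ 2) ρ z := hdω.pow 2
  have hn1 : DiffS (fun ρ z => 4 * (φ.sig t ρ z * φ.om t ρ z)) ρ z :=
    hdσω.const_mul 4
  have hn2 : DiffS (fun ρ z => -2 * φ.om t ρ z ^ 2) ρ z := hdωω.const_mul (-2)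
  have hq1 : DiffS (fun ρ z => 4 * (φ.sig t ρ z * φ.om t ρ z) / eta0 m a ρ z ^ 2) ρ z :=
    hn1.div hdη2 (pow_pos hη 2).ne'
  have hq2 : DiffS (fun ρ z => -2 * φ.om t ρ z ^ 2 / eta0 m a ρ z ^ 3) ρ z :=
    hn2.div hdη3 (pow_pos hη 3).ne'
  have hη0 : ∀ A, DiffS (pd A (eta0 m a)) ρ z := fun A =>
    Sm.diffS_static (f := pd A (eta0 m a)) (sη.pd hV A) hρ
  have hw0 : ∀ A, DiffS (pd A (omega0 m a)) ρ z := fun A =>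
    Sm.diffS_static (f := pd A (omega0 m a)) (sω0.pd hV A) hρ
  have hr : DiffS (fun ρ _ => ρ) ρ z := diffS_rhoC
  have e : ∑ A, pd A (carterFlux m a φ A t) ρ z = _ :=
    sum_pd_add (F := fun A ρ z => ρ * (4 * (φ.sig t ρ z * φ.om t ρ z) / eta0 m a ρ z ^ 2)
        * pd A (omega0 m a) ρ z)
      (G := fun A ρ z => ρ * (-2 * φ.om t ρ z ^ 2 / eta0 m a ρ z ^ 3) * pd A (eta0 m a) ρ z)
      (fun A => (hr.mul hq1).mul (hw0 A))
      (fun A => (hr.mul hq2).mul (hη0 A))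
  rw [e, div_smul_grad hq1 hw0 hρ.ne', div_smul_grad hq2 hη0 hρ.ne', lap3_eta0 hm ha hρ,
    lap3_omega0 hm ha hρ]
  simp only [gdot, Pert.eps2, Pert.eps2Bar, Fin.sum_univ_two,
    pd_div hn1 hdη2 (pow_pos hη 2).ne', pd_div hn2 hdη3 (pow_pos hη 3).ne',
    pd_div hdω hdη hη.ne', pd_const_mul hdσω, pd_const_mul hdωω, pd_mul hdσ hdω, pd_pow hdη,
    pd_pow hdω]
  push_cast
  field_simp
  ring

end Div
end

section
variable {m a : ℝ} {I : Set ℝ} {t₀ t ρ z : ℝ} {φ : Pert}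

/-! ### The energy identity -/

lemma chi_symm_dt (hI : IsOpen I) (hsol : IsSolution m a I φ) (hx : (t, ρ, z) ∈ dom I)
    (A B : Fin 2) : φ.dt.chi A B t ρ z = φ.dt.chi B A t ρ z :=
  tdot_congr_on (isOpen_dom hI) (fun y hy => hsol.chi_symm y.1 hy.1 y.2.1 hy.2 y.2.2 A B) hx

lemma chi_trace_dt (hI : IsOpen I) (h : IsRegular m a I φ) (hsol : IsSolution m a I φ)
    (hx : (t, ρ, z) ∈ dom I) : ∑ A, φ.dt.chi A A t ρ z = 0 := by
  have h1 := HasDerivAt.fun_sum (u := Finset.univ) fun A _ =>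
    Sm.hasDerivAt_tdot (isOpen_dom hI) (h.sm_chi A A) hx
  refine h1.unique ((hasDerivAt_const t (0 : ℝ)).congr_of_eventuallyEq ?_)
  filter_upwards [hI.mem_nhds hx.1] with s hs using hsol.chi_trace s hs ρ hx.2 z

/-- The time derivative of the momentum constraint. -/
lemma momentum_dt (hI : IsOpen I) (h : IsRegular m a I φ) (hsol : IsSolution m a I φ)
    (hx : (t, ρ, z) ∈ dom I) (A : Fin 2) :
    ∑ B, pd B (φ.dt.chi A B t) ρ z = -(Real.exp (2 * u0 m a ρ z) / (2 * ρ)) *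
      (φ.dt.p m a t ρ z * (2 * pd A rhoC ρ z / ρ + pd A (sigma0 m a) ρ z)
        + pd A (omega0 m a) ρ z / eta0 m a ρ z ^ 2 * φ.dt.d m a t ρ z) := by
  have h1 := HasDerivAt.fun_sum (u := Finset.univ) fun B _ =>
    IsRegular.hasDerivAt_pd (h.sm_chi A B) hI hx B
  have h2 := (((h.hasDerivAt_p hI hx).mul_const
    (2 * pd A rhoC ρ z / ρ + pd A (sigma0 m a) ρ z)).add
    ((h.hasDerivAt_d hI hx).const_mul (pd A (omega0 m a) ρ z / eta0 m a ρ z ^ 2))).const_mul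
    (-(Real.exp (2 * u0 m a ρ z) / (2 * ρ)))
  refine h1.unique (h2.congr_of_eventuallyEq ?_)
  filter_upwards [hI.mem_nhds hx.1] with s hs using hsol.momentum s hs ρ hx.2 z A

lemma div_shiftFlux (hI : IsOpen I) (h : IsRegular m a I φ) (hx : (t, ρ, z) ∈ dom I) :
    ∑ A, pd A (shiftFlux φ A t) ρ z
      = 8 * ∑ B, ((∑ A, pd A (φ.beta B t) ρ z * φ.dt.chi B A t ρ z)
        + φ.beta B t ρ z * ∑ A, pd A (φ.dt.chi B A t) ρ z) := by
  have hU := isOpen_dom hI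
  have hβ : ∀ B, DiffS (φ.beta B t) ρ z := fun B => Sm.diffS hU (h.sm_beta B) hx
  have hχ : ∀ B A, DiffS (φ.dt.chi B A t) ρ z := fun B A => Sm.diffS hU ((h.dt hI).sm_chi B A) hx
  have e : ∀ A, pd A (shiftFlux φ A t) ρ z = 8 * ∑ B, (pd A (φ.beta B t) ρ z * φ.dt.chi B A t ρ z
      + φ.beta B t ρ z * pd A (φ.dt.chi B A t) ρ z) := by
    intro A
    have hs : DiffS (fun ρ z => φ.beta 0 t ρ z * φ.dt.chi 0 A t ρ z
        + φ.beta 1 t ρ z * φ.dt.chi 1 A t ρ z) ρ z :=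
      DifferentiableAt.add ((hβ 0).mul (hχ 0 A)) ((hβ 1).mul (hχ 1 A))
    have e1 : shiftFlux φ A t = fun ρ z => 8 * (φ.beta 0 t ρ z * φ.dt.chi 0 A t ρ z
        + φ.beta 1 t ρ z * φ.dt.chi 1 A t ρ z) := by
      funext ρ z; simp only [shiftFlux, Fin.sum_univ_two]
    rw [e1, pd_const_mul hs, pd_add ((hβ 0).mul (hχ 0 A)) ((hβ 1).mul (hχ 1 A)),
      pd_mul (hβ 0) (hχ 0 A), pd_mul (hβ 1) (hχ 1 A)]
    simp only [Fin.sum_univ_two]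
  simp only [e, Fin.sum_univ_two]
  ring

lemma div_waveFlux (hm : 0 < m) (ha : |a| = m) (hI : IsOpen I) (h : IsRegular m a I φ)
    (hx : (t, ρ, z) ∈ dom I) :
    ∑ A, pd A (waveFlux m a φ A t) ρ z
      = ρ * (4 * gdot (φ.sig t) (φ.dt.sig t) ρ z + 4 * φ.dt.sig t ρ z * lap3 (φ.sig t) ρ z
        + 4 / eta0 m a ρ z ^ 2 * (gdot (φ.om t) (φ.dt.om t) ρ z + φ.dt.om t ρ z *
          (lap3 (φ.om t) ρ z - 2 * gdot (eta0 m a) (φ.om t) ρ z / eta0 m a ρ z))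
        - 8 / eta0 m a ρ z ^ 2 * (φ.sig t ρ z * gdot (omega0 m a) (φ.dt.om t) ρ z
          + φ.dt.om t ρ z * gdot (omega0 m a) (φ.sig t) ρ z)) := by
  have hU := isOpen_dom hI
  have hρ : 0 < ρ := hx.2
  have hη := eta0_pos (z := z) hm ha hρ
  have sη := sm_eta0 (I := Set.univ) hm ha
  have sω0 := sm_omega0 (I := Set.univ) hm ha
  have hV := isOpen_dom isOpen_univ
  have hψ := h.dt hI
  have hdσ : DiffS (φ.sig t) ρ z := Sm.diffS hU h.sm_sig hx
  have hdω' : DiffS (φ.dt.om t) ρ z := Sm.diffS hU hψ.sm_om hx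
  have hdσ' : DiffS (φ.dt.sig t) ρ z := Sm.diffS hU hψ.sm_sig hx
  have hdη : DiffS (eta0 m a) ρ z := Sm.diffS_static sη hρ
  have hdη2 := diffS_eta0_pow (z := z) hm ha hρ 2
  have hdσω : DiffS (fun ρ z => φ.sig t ρ z * φ.dt.om t ρ z) ρ z := hdσ.mul hdω'
  have hn1 := hdσ'.const_mul 4
  have hn2 := hdω'.const_mul 4
  have hn3 := hdσω.const_mul (-8)
  have hq2 := hn2.div hdη2 (pow_pos hη 2).ne'
  have hq3 := hn3.div hdη2 (pow_pos hη 2).ne'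
  have hs0 : ∀ A, DiffS (pd A (φ.sig t)) ρ z := fun A =>
    Sm.diffS (f := fun t => pd A (φ.sig t)) hU (h.sm_sig.pd hU A) hx
  have ho0 : ∀ A, DiffS (pd A (φ.om t)) ρ z := fun A =>
    Sm.diffS (f := fun t => pd A (φ.om t)) hU (h.sm_om.pd hU A) hx
  have hw0 : ∀ A, DiffS (pd A (omega0 m a)) ρ z := fun A =>
    Sm.diffS_static (f := pd A (omega0 m a)) (sω0.pd hV A) hρ
  have hr : DiffS (fun ρ _ => ρ) ρ z := diffS_rhoC
  have e : ∑ A, pd A (waveFlux m a φ A t) ρ z = _ :=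
    sum_pd_add (F := fun A ρ z => ρ * (4 * φ.dt.sig t ρ z) * pd A (φ.sig t) ρ z
        + ρ * (4 * φ.dt.om t ρ z / eta0 m a ρ z ^ 2) * pd A (φ.om t) ρ z)
      (G := fun A ρ z => ρ * (-8 * (φ.sig t ρ z * φ.dt.om t ρ z) / eta0 m a ρ z ^ 2)
        * pd A (omega0 m a) ρ z)
      (fun A => DifferentiableAt.add ((hr.mul hn1).mul (hs0 A)) ((hr.mul hq2).mul (ho0 A)))
      (fun A => (hr.mul hq3).mul (hw0 A))
  have e' := sum_pd_add (F := fun A ρ z => ρ * (4 * φ.dt.sig t ρ z) * pd A (φ.sig t) ρ z)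
      (G := fun A ρ z => ρ * (4 * φ.dt.om t ρ z / eta0 m a ρ z ^ 2) * pd A (φ.om t) ρ z)
      (fun A => (hr.mul hn1).mul (hs0 A)) (fun A => (hr.mul hq2).mul (ho0 A))
  rw [e, e', div_smul_grad hn1 hs0 hρ.ne', div_smul_grad hq2 ho0 hρ.ne',
    div_smul_grad hq3 hw0 hρ.ne', lap3_omega0 hm ha hρ]
  simp only [gdot, Fin.sum_univ_two, pd_div hn2 hdη2 (pow_pos hη 2).ne',
    pd_div hn3 hdη2 (pow_pos hη 2).ne', pd_const_mul hdσ', pd_const_mul hdω', pd_const_mul hdσω,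
    pd_mul hdσ hdω', pd_pow hdη]
  push_cast
  field_simp
  ring

/-- The time derivative of `ε₂` is the divergence of the energy flux: the wave equations turn the
terms with `σ̇₁` and `ω̇₁` into a divergence, and the remaining terms, which contain the shift, are
a divergence by the gauge equation and the time derivative of the momentum constraint. -/
lemma div_energyFlux (hm : 0 < m) (ha : |a| = m) (hI : IsOpen I) (h : IsRegular m a I φ)
    (hsol : IsSolution m a I φ) (hx : (t, ρ, z) ∈ dom I) :
    ∑ A, pd A (energyFlux m a φ A t) ρ z = 2 * eps2Form m a φ φ.dt t ρ z := by
  have hU := isOpen_dom hI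
  have hρ : 0 < ρ := hx.2
  have hη := eta0_pos (z := z) hm ha hρ
  have hsmω : ∀ A, Sm (dom I) (waveFlux m a φ A) := fun A =>
    ((sm_flux_term hI ((Sm.const 4).mul (h.dt hI).sm_sig) h.sm_sig A).add
      (sm_flux_term hI (sm_div_eta0 hm ha ((Sm.const 4).mul (h.dt hI).sm_om) 2) h.sm_om A)).add
      (sm_flux_term hI (sm_div_eta0 hm ha ((Sm.const (-8)).mul (h.sm_sig.mul (h.dt hI).sm_om)) 2)
        (sm_omega0 hm ha) A)
  have hsmβ : ∀ A, Sm (dom I) (shiftFlux φ A) := fun A =>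
    (Sm.const 8).mul (Sm.sum fun B => (h.sm_beta B).mul ((h.dt hI).sm_chi B A))
  have e : ∑ A, pd A (energyFlux m a φ A t) ρ z = _ :=
    sum_pd_add (F := fun A => waveFlux m a φ A t) (G := fun A => shiftFlux φ A t)
      (fun A => (hsmω A).diffS hU hx) (fun A => (hsmβ A).diffS hU hx)
  have hp : tdot (φ.p m a) t ρ z = φ.dt.p m a t ρ z := (h.hasDerivAt_p hI hx).deriv
  have hd : tdot (φ.d m a) t ρ z = φ.dt.d m a t ρ z := (h.hasDerivAt_d hI hx).deriv
  have ev1 := hsol.evol_sig t hx.1 ρ hρ z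
  have ev2 := hsol.evol_om t hx.1 ρ hρ z
  rw [hp] at ev1
  rw [hd] at ev2
  have ev1' : lap3 (φ.sig t) ρ z = Real.exp (2 * u0 m a ρ z) / ρ ^ 2 * φ.dt.p m a t ρ z
      + 2 / eta0 m a ρ z ^ 2 * (φ.sig t ρ z * gdot (omega0 m a) (omega0 m a) ρ z
          - gdot (φ.om t) (omega0 m a) ρ z) := by linear_combination ev1
  have ev2' : lap3 (φ.om t) ρ z = Real.exp (2 * u0 m a ρ z) / ρ ^ 2 * φ.dt.d m a t ρ z
      + (4 * pd 0 (φ.om t) ρ z / ρ + 2 * gdot (φ.om t) (sigma0 m a) ρ z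
          + 2 * gdot (omega0 m a) (φ.sig t) ρ z) := by linear_combination ev2
  have hsh : ∀ A B, 2 * Real.exp (-(2 * u0 m a ρ z)) * φ.chi A B t ρ z
      = φ.confKill A B t ρ z / ρ := fun A B => by
    rw [h.shift t hx.1 ρ hρ z A B]; field_simp
  have hχ : 4 * Real.exp (-(2 * u0 m a ρ z)) * ∑ A, ∑ B, φ.chi A B t ρ z * φ.dt.chi A B t ρ z
      = 2 / ρ * ∑ A, ∑ B, φ.confKill A B t ρ z * φ.dt.chi A B t ρ z := by
    simp only [Finset.mul_sum]
    refine Finset.sum_congr rfl fun A _ => Finset.sum_congr rfl fun B _ => ?_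
    linear_combination 2 * φ.dt.chi A B t ρ z * hsh A B
  have hsym := chi_symm_dt hI hsol hx 1 0
  have htr := chi_trace_dt hI h hsol hx
  rw [Fin.sum_univ_two] at htr
  have htr' : φ.dt.chi 1 1 t ρ z = -φ.dt.chi 0 0 t ρ z := by linarith
  have f0 := pd_eta0 (z := z) hm ha hρ 0
  have f1 := pd_eta0 (z := z) hm ha hρ 1
  have ep : φ.p m a t ρ z = φ.dt.sig t ρ z - 2 * φ.beta 0 t ρ z / ρ
      - ∑ A, φ.beta A t ρ z * pd A (sigma0 m a) ρ z := rfl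
  have ed : φ.d m a t ρ z = φ.dt.om t ρ z - ∑ A, φ.beta A t ρ z * pd A (omega0 m a) ρ z := rfl
  rw [e, div_waveFlux hm ha hI h hx, div_shiftFlux hI h hx]
  simp only [momentum_dt hI h hsol hx]
  rw [eps2Form, hχ, ev1', ev2', ep, ed]
  simp only [gdot, Fin.sum_univ_two, Pert.confKill, Pert.divBeta, delta, htr', hsym, f0, f1,
    pd_rhoC_zero, pd_rhoC_one, if_true, one_ne_zero, zero_ne_one, if_false]
  field_simp
  ring
end

section
variable {m a : ℝ} {I : Set ℝ} {t₀ δ L : ℝ} {φ ψ : Pert} {E : Filter (ℝ × ℝ)}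

/-! ### Admissible fluxes -/

/-- A vector field whose divergence has a vanishing integral over the half plane, as a limit of the
integrals over half annuli: it vanishes at the axis, and is `o(r⁻¹)` at both ends. -/
structure IsFlux (I : Set ℝ) (V : Fin 2 → Field) : Prop where
  smooth : ∀ A, Sm (dom I) (V A)
  axis : ∀ t₀ ∈ I, ∀ δ > 0, ∀ L A, Bdd (nhdsAnnulus t₀ δ L) fun t ρ z => V A t ρ z / ρ
  div : ∀ t₀ ∈ I, ∀ δ > 0, ∀ L, Bdd (nhdsAnnulus t₀ δ L) fun t ρ z => ∑ A, pd A (V A t) ρ z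
  infinity : ∀ t₀ ∈ I, ∀ A, SmallFlux (𝓝 t₀ ×ˢ endInfinity) (V A)
  origin : ∀ t₀ ∈ I, ∀ A, SmallFlux (𝓝 t₀ ×ˢ endOrigin) (V A)

lemma IsRegular.bdd_eps1 (hφ : IsRegular m a I φ) (hm : 0 < m) (ha : |a| = m) (hI : IsOpen I)
    (ht : t₀ ∈ I) (hδ : 0 < δ) : Bdd (nhdsAnnulus t₀ δ L) (φ.eps1 m a) := by
  have hs := fun A => bdd_pd_sigma0 (L := L) hm ha hI ht hδ A
  have hw := fun A => bdd_domega0 (L := L) hm ha hI ht hδ A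
  have h1 := hφ.sig.bdd (L := L) hI ht hδ
  have hps := fun A => hφ.bdd_pd_sig (L := L) hI ht hδ A
  have hdt := fun A => hφ.bdd_dtw (L := L) hm ha hI ht hδ A
  refine (((Bdd.const 2).mul (Bdd.sum fun A => (((hs A).mul (hps A)).add
    ((hw A).mul (hdt A))).sub ((h1.mul (hw A)).mul (hw A)))).mul (bdd_rho hI ht)).congr ?_
  filter_upwards [eventually_nhdsAnnulus hI ht] with x hx
  have hη := eta0_pos (z := x.2.2) hm ha hx.1.2
  simp only [Pert.eps1, gdot, domega0, Pert.dtw, Fin.sum_univ_two]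
  field_simp
  ring

/-- The kinetic part of `eps2Form` is bounded up to the axis. The gauge equation for the shift
absorbs the factor `e^(-2u₀)`, which is singular there. -/
lemma IsRegular.bdd_kin (hφ : IsRegular m a I φ) (hψ : IsRegular m a I ψ) (hm : 0 < m)
    (ha : |a| = m) (hI : IsOpen I) (ht : t₀ ∈ I) (hδ : 0 < δ) :
    Bdd (nhdsAnnulus t₀ δ L) fun t ρ z =>
      (2 * (Real.exp (2 * u0 m a ρ z) / ρ ^ 2) * (φ.p m a t ρ z * ψ.p m a t ρ z)
        + 2 * (Real.exp (2 * u0 m a ρ z) / (ρ ^ 2 * eta0 m a ρ z ^ 2))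
          * (φ.d m a t ρ z * ψ.d m a t ρ z)
        + 4 * Real.exp (-(2 * u0 m a ρ z)) * ∑ A, ∑ B, φ.chi A B t ρ z * ψ.chi A B t ρ z) * ρ := by
  have hE := bdd_exp_div (L := L) hm ha hI ht hδ
  have hρ := bdd_rho (δ := δ) (L := L) hI ht
  refine ((Bdd.const 2).mul ((((hE.mul ((hφ.bdd_p hm ha hI ht hδ).mul
    (hψ.bdd_p hm ha hI ht hδ))).mul hρ).add ((hE.mul ((hφ.bdd_d_div hm ha hI ht hδ).mul
    (hψ.bdd_d_div hm ha hI ht hδ))).mul hρ)).add (Bdd.sum fun A => Bdd.sum fun B =>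
    (hφ.bdd_confKill hI ht hδ A B).mul (hψ.bdd_chi hI ht hδ A B)))).congr ?_
  filter_upwards [eventually_nhdsAnnulus hI ht] with x hx
  have hη := eta0_pos (z := x.2.2) hm ha hx.1.2
  have hρ : 0 < x.2.1 := hx.1.2
  simp only [hφ.shift _ hx.1.1 _ hρ, Fin.sum_univ_two]
  field_simp
  ring

lemma IsRegular.bdd_eps2Form (hφ : IsRegular m a I φ) (hψ : IsRegular m a I ψ) (hm : 0 < m)
    (ha : |a| = m) (hI : IsOpen I) (ht : t₀ ∈ I) (hδ : 0 < δ) :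
    Bdd (nhdsAnnulus t₀ δ L) (eps2Form m a φ ψ) := by
  have hw := fun A => bdd_domega0 (L := L) hm ha hI ht hδ A
  have h1 := hφ.sig.bdd (L := L) hI ht hδ
  have h2 := hψ.sig.bdd (L := L) hI ht hδ
  have p1 := fun A => hφ.bdd_pd_sig (L := L) hI ht hδ A
  have p2 := fun A => hψ.bdd_pd_sig (L := L) hI ht hδ A
  have d1 := fun A => hφ.bdd_dtw (L := L) hm ha hI ht hδ A
  have d2 := fun A => hψ.bdd_dtw (L := L) hm ha hI ht hδ A
  refine ((hφ.bdd_kin hψ hm ha hI ht hδ (L := L)).add ((Bdd.sum fun A =>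
    ((((Bdd.const 2).mul ((p1 A).mul (p2 A))).add ((Bdd.const 2).mul ((d1 A).mul (d2 A)))).add
      ((Bdd.const 4).mul (((hw A).mul (hw A)).mul (h1.mul h2)))).sub ((Bdd.const 4).mul
        ((((hw A).mul (d2 A)).mul h1).add (((hw A).mul (d1 A)).mul h2)))).mul
          (bdd_rho hI ht))).congr ?_
  filter_upwards [eventually_nhdsAnnulus hI ht] with x hx
  have hη := eta0_pos (z := x.2.2) hm ha hx.1.2
  simp only [eps2Form, gdot, domega0, Pert.dtw, Fin.sum_univ_two]
  field_simp
  ring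

lemma IsRegular.bdd_eps2Bar (hφ : IsRegular m a I φ) (hm : 0 < m)
    (ha : |a| = m) (hI : IsOpen I) (ht : t₀ ∈ I) (hδ : 0 < δ) :
    Bdd (nhdsAnnulus t₀ δ L) (φ.eps2Bar m a) := by
  have hw := fun A => bdd_domega0 (L := L) hm ha hI ht hδ A
  have h1 := hφ.sig.bdd (L := L) hI ht hδ
  have p1 := fun A => hφ.bdd_pd_sig (L := L) hI ht hδ A
  have d1 := fun A => hφ.bdd_dtw (L := L) hm ha hI ht hδ A
  have ht1 := hφ.bdd_tw (L := L) hm ha hI ht hδ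
  have hη := fun A => (hφ.bdd_tw_div (L := L) hm ha hI ht hδ).mul
    (bdd_rho_mul_pd_eta0 (δ := δ) (L := L) hm ha hI ht A)
  have q1 := fun A => (p1 A).add (ht1.mul (hw A))
  have q2 := fun A => ((d1 A).sub (hη A)).sub (h1.mul (hw A))
  have q3 := fun A => (h1.mul (hw A)).sub (hη A)
  refine ((hφ.bdd_kin hφ hm ha hI ht hδ (L := L)).add (((Bdd.const 2).mul (Bdd.sum fun A =>
    (((q1 A).mul (q1 A)).add ((q2 A).mul (q2 A))).add ((q3 A).mul (q3 A)))).mul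
      (bdd_rho hI ht))).congr ?_
  filter_upwards [eventually_nhdsAnnulus hI ht] with x hx
  obtain ⟨t, ρ, z⟩ := x
  have hη := eta0_pos (z := z) hm ha hx.1.2
  have hρ : 0 < ρ := hx.1.2
  have e := pd_div (Sm.diffS (isOpen_dom hI) hφ.sm_om hx.1)
    (Sm.diffS_static (sm_eta0 hm ha) hρ) hη.ne'
  simp only [Pert.eps2Bar, Pert.kin, Pert.chiSq, domega0, Pert.dtw, Pert.tw, Fin.sum_univ_two, e]
  field_simp
  ring

lemma isFlux_eps1Flux (hm : 0 < m) (ha : |a| = m) (hI : IsOpen I) (hφ : IsRegular m a I φ)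
    (hinf : IsDecaying m a I endInfinity φ) (horig : IsDecaying m a I endOrigin φ) :
    IsFlux I (eps1Flux m a φ) := by
  have hend : ∀ E ≤ 𝓟 halfPlane, IsDecaying m a I E φ → ∀ t₀ ∈ I, ∀ A,
      SmallFlux (𝓝 t₀ ×ˢ E) (eps1Flux m a φ A) := by
    intro E hE hd t₀ ht A
    refine ((((hd.sig t₀ ht).mul_sqrt (bdd_sqrt_mul_pd_sigma0 hm ha hI ht hE A)).const_mul 2).add
      (((hd.tw t₀ ht).mul_sqrt (bdd_sqrt_mul_domega0 hm ha hI ht hE A)).const_mul 2)).congr ?_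
    filter_upwards [eventually_end hI ht hE] with x hx
    have hη := eta0_pos (z := x.2.2) hm ha hx.2
    simp only [eps1Flux, Pert.tw, domega0]
    field_simp
  refine ⟨fun A => ?_, fun t₀ ht δ hδ L A => ?_, fun t₀ ht δ hδ L => ?_,
    hend _ endInfinity_le hinf, hend _ endOrigin_le horig⟩
  · exact (sm_flux_term hI ((Sm.const 2).mul hφ.sm_sig) (sm_sigma0 hm ha) A).add
      (sm_flux_term hI (sm_div_eta0 hm ha ((Sm.const 2).mul hφ.sm_om) 2) (sm_omega0 hm ha) A)
  · refine (((Bdd.const 2).mul ((hφ.sig.bdd hI ht hδ).mul (bdd_pd_sigma0 hm ha hI ht hδ A))).add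
      ((Bdd.const 2).mul ((hφ.bdd_tw hm ha hI ht hδ).mul
        (bdd_domega0 (L := L) hm ha hI ht hδ A)))).congr ?_
    filter_upwards [eventually_nhdsAnnulus hI ht] with x hx
    have hη := eta0_pos (z := x.2.2) hm ha hx.1.2
    have hρ : 0 < x.2.1 := hx.1.2
    simp only [eps1Flux, Pert.tw, domega0]
    field_simp
  · refine (hφ.bdd_eps1 hm ha hI ht hδ).congr ?_
    filter_upwards [eventually_nhdsAnnulus hI ht] with x hx
    exact (div_eps1Flux hm ha hI hφ hx.1).symm

lemma isFlux_carterFlux (hm : 0 < m) (ha : |a| = m) (hI : IsOpen I) (hφ : IsRegular m a I φ)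
    (hinf : IsDecaying m a I endInfinity φ) (horig : IsDecaying m a I endOrigin φ) :
    IsFlux I (carterFlux m a φ) := by
  have hend : ∀ E ≤ 𝓟 halfPlane, IsDecaying m a I E φ → ∀ t₀ ∈ I, ∀ A,
      SmallFlux (𝓝 t₀ ×ˢ E) (carterFlux m a φ A) := by
    intro E hE hd t₀ ht A
    have hT : Bdd (𝓝 t₀ ×ˢ E) fun _ ρ z => ρ * pd A (eta0 m a) ρ z / eta0 m a ρ z := by
      refine Bdd.of_bound 34 ?_
      filter_upwards [eventually_end hI ht hE] with x hx
      exact abs_rho_mul_pd_eta0_le hm ha hx.2 A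
    have h1 := (hd.sig t₀ ht).mul
      ((hd.tw t₀ ht).mul_bdd (bdd_rho_mul_domega0 hm ha hI ht hE A))
    have h2 := (hd.tw t₀ ht).mul ((hd.tw t₀ ht).mul_bdd hT)
    refine ((h1.const_mul 4).add (h2.const_mul (-2))).congr ?_
    filter_upwards [eventually_end hI ht hE] with x hx
    have hη := eta0_pos (z := x.2.2) hm ha hx.2
    simp only [carterFlux, Pert.tw, domega0]
    field_simp
  refine ⟨fun A => ?_, fun t₀ ht δ hδ L A => ?_, fun t₀ ht δ hδ L => ?_,
    hend _ endInfinity_le hinf, hend _ endOrigin_le horig⟩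
  · exact (sm_flux_term hI (sm_div_eta0 hm ha ((Sm.const 4).mul (hφ.sm_sig.mul hφ.sm_om)) 2)
      (sm_omega0 hm ha) A).add (sm_flux_term hI (sm_div_eta0 hm ha ((Sm.const (-2)).mul
        (hφ.sm_om.pow 2)) 3) (sm_eta0 hm ha) A)
  · refine (((Bdd.const 4).mul ((hφ.sig.bdd hI ht hδ).mul ((hφ.bdd_tw hm ha hI ht hδ).mul
      (bdd_domega0 (L := L) hm ha hI ht hδ A)))).add ((Bdd.const (-2)).mul
        (((hφ.bdd_tw hm ha hI ht hδ).mul (hφ.bdd_tw_div hm ha hI ht hδ)).mul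
          (bdd_rho_mul_pd_eta0 hm ha hI ht A)))).congr ?_
    filter_upwards [eventually_nhdsAnnulus hI ht] with x hx
    have hη := eta0_pos (z := x.2.2) hm ha hx.1.2
    have hρ : 0 < x.2.1 := hx.1.2
    simp only [carterFlux, Pert.tw, domega0]
    field_simp
  · have h := hφ.bdd_eps2Form hφ hm ha hI ht hδ (L := L)
    rw [eps2Form_self] at h
    refine ((hφ.bdd_eps2Bar hm ha hI ht hδ).sub h).congr ?_
    filter_upwards [eventually_nhdsAnnulus hI ht] with x hx
    exact (div_carterFlux hm ha hI hφ hx.1).symm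

lemma isFlux_energyFlux (hm : 0 < m) (ha : |a| = m) (hI : IsOpen I) (hφ : IsRegular m a I φ)
    (hsol : IsSolution m a I φ)
    (hinf : IsDecaying m a I endInfinity φ) (horig : IsDecaying m a I endOrigin φ)
    (hinf' : IsDecaying m a I endInfinity φ.dt) (horig' : IsDecaying m a I endOrigin φ.dt) :
    IsFlux I (energyFlux m a φ) := by
  have hψ := hφ.dt hI
  have hend : ∀ E ≤ 𝓟 halfPlane, IsDecaying m a I E φ → IsDecaying m a I E φ.dt →
      ∀ t₀ ∈ I, ∀ A, SmallFlux (𝓝 t₀ ×ˢ E) (energyFlux m a φ A) := by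
    intro E hE hd hd' t₀ ht A
    have h1 := (hd'.sig t₀ ht).mul (hd.pd_sig t₀ ht A)
    have h2 := (hd'.tw t₀ ht).mul (hd.dtw t₀ ht A)
    have h3 := (hd.sig t₀ ht).mul
      ((hd'.tw t₀ ht).mul_bdd (bdd_rho_mul_domega0 hm ha hI ht hE A))
    have h4 := fun B => (hd.beta t₀ ht B).mul (hd'.chi t₀ ht B A)
    refine (((h1.const_mul 4).add (h2.const_mul 4)).add ((h3.const_mul (-8)).add
      (((h4 0).add (h4 1)).const_mul 8))).congr ?_
    filter_upwards [eventually_end hI ht hE] with x hx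
    have hη := eta0_pos (z := x.2.2) hm ha hx.2
    simp only [energyFlux, waveFlux, shiftFlux, Pert.tw, Pert.dtw, domega0, Fin.sum_univ_two]
    field_simp
    ring
  refine ⟨fun A => ?_, fun t₀ ht δ hδ L A => ?_, fun t₀ ht δ hδ L => ?_,
    hend _ endInfinity_le hinf hinf', hend _ endOrigin_le horig horig'⟩
  · exact (((sm_flux_term hI ((Sm.const 4).mul hψ.sm_sig) hφ.sm_sig A).add
      (sm_flux_term hI (sm_div_eta0 hm ha ((Sm.const 4).mul hψ.sm_om) 2) hφ.sm_om A)).add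
      (sm_flux_term hI (sm_div_eta0 hm ha ((Sm.const (-8)).mul (hφ.sm_sig.mul hψ.sm_om)) 2)
        (sm_omega0 hm ha) A)).add
      ((Sm.const 8).mul (Sm.sum fun B => (hφ.sm_beta B).mul (hψ.sm_chi B A)))
  · have htw' := hψ.bdd_tw (L := L) hm ha hI ht hδ
    refine ((((Bdd.const 4).mul ((hψ.sig.bdd hI ht hδ).mul (hφ.bdd_pd_sig hI ht hδ A))).add
      ((Bdd.const 4).mul (htw'.mul (hφ.bdd_dtw hm ha hI ht hδ A)))).add
      (((Bdd.const (-8)).mul ((hφ.sig.bdd hI ht hδ).mul (htw'.mul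
        (bdd_domega0 hm ha hI ht hδ A)))).add ((Bdd.const 8).mul (Bdd.sum fun B =>
          ((hφ.beta B).bdd hI ht hδ).mul (hψ.bdd_chi_div hm ha hI ht hδ B A))))).congr ?_
    filter_upwards [eventually_nhdsAnnulus hI ht] with x hx
    have hη := eta0_pos (z := x.2.2) hm ha hx.1.2
    have hρ : 0 < x.2.1 := hx.1.2
    simp only [energyFlux, waveFlux, shiftFlux, Pert.tw, Pert.dtw, domega0, Fin.sum_univ_two]
    field_simp
    ring
  · refine ((Bdd.const 2).mul (hφ.bdd_eps2Form hψ hm ha hI ht hδ (L := L))).congr ?_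
    filter_upwards [eventually_nhdsAnnulus hI ht] with x hx
    exact (div_energyFlux hm ha hI hφ hsol hx.1).symm
end

section
variable {m a : ℝ} {I : Set ℝ} {t δ L : ℝ} {f : Field}

/-! ### Exhaustion by half annuli -/

/-- The filter of radii `(δ, L)` with `δ → 0` and `L → ∞`. -/
abbrev annulusEnds : Filter (ℝ × ℝ) := 𝓝[>] (0 : ℝ) ×ˢ atTop

lemma eventually_annulusEnds : ∀ᶠ y in annulusEnds, 0 < y.1 ∧ y.1 < y.2 := by
  have h1 : ∀ᶠ y in annulusEnds, y.1 ∈ Set.Ioo (0 : ℝ) 1 :=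
    tendsto_fst.eventually (Ioo_mem_nhdsGT one_pos)
  have h2 : ∀ᶠ y in annulusEnds, (1 : ℝ) ≤ y.2 := tendsto_snd.eventually (eventually_ge_atTop 1)
  filter_upwards [h1, h2] with y h1 h2 using ⟨h1.1, h1.2.trans_le h2⟩

lemma aecover_halfAnnulus :
    AECover (volume.restrict halfPlane) annulusEnds fun y => halfAnnulus y.1 y.2 := by
  refine ⟨ae_restrict_of_forall_mem measurableSet_halfPlane fun x hx => ?_,
    fun y => measurableSet_halfAnnulus _ _⟩
  have hr := rad_pos (z := x.2) hx
  have h1 : ∀ᶠ y in annulusEnds, y.1 < rad x.1 x.2 := tendsto_fst.eventually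
    (eventually_nhdsWithin_of_eventually_nhds (eventually_lt_nhds hr))
  have h2 : ∀ᶠ y in annulusEnds, rad x.1 x.2 < y.2 :=
    tendsto_snd.eventually (eventually_gt_atTop _)
  filter_upwards [h1, h2] with y h1 h2 using ⟨hx, h1, h2⟩

lemma restrict_halfAnnulus (y : ℝ × ℝ) : (volume.restrict halfPlane).restrict
    (halfAnnulus y.1 y.2) = volume.restrict (halfAnnulus y.1 y.2) :=
  Measure.restrict_restrict_of_subset halfAnnulus_subset

lemma halfAnnulus_subset_annulus : halfAnnulus δ L ⊆ annulus δ L :=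
  fun _ hx => ⟨hx.1, hx.2.1.le, hx.2.2.le⟩

/-- A bound near an annulus holds with one constant for all nearby times. -/
lemma Bdd.eventually_le (h : Bdd (nhdsAnnulus t δ L) f) :
    ∃ C, ∀ᶠ s in 𝓝 t, ∀ x ∈ annulus δ L, |f s x.1 x.2| ≤ C := by
  obtain ⟨C, hC⟩ := h.bound
  refine ⟨C, (eventually_prod_principal_iff.1 hC).mono fun s hs x hx => ?_⟩
  simpa using hs x hx

lemma Bdd.exists_le (h : Bdd (nhdsAnnulus t δ L) f) :
    ∃ C, ∀ x ∈ annulus δ L, |f t x.1 x.2| ≤ C := by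
  obtain ⟨C, hC⟩ := h.eventually_le
  exact ⟨C, hC.self_of_nhds⟩

lemma Sm.continuousOn_halfPlane (hf : Sm (dom I) f) (ht : t ∈ I) :
    ContinuousOn (fun x : ℝ × ℝ => f t x.1 x.2) halfPlane := by
  have hc : Continuous fun x : ℝ × ℝ => ((t, x) : ℝ × ℝ × ℝ) := by fun_prop
  exact (ContDiffOn.continuousOn hf).comp hc.continuousOn fun x hx => ⟨ht, hx⟩

lemma Bdd.integrableOn (h : Bdd (nhdsAnnulus t δ L) f)
    (hc : ContinuousOn (fun x : ℝ × ℝ => f t x.1 x.2) halfPlane) :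
    IntegrableOn (fun x : ℝ × ℝ => f t x.1 x.2) (halfAnnulus δ L) := by
  obtain ⟨C, hC⟩ := h.exists_le
  exact integrableOn_halfAnnulus hc fun x hx => hC x (halfAnnulus_subset_annulus hx)

/-! ### The divergence theorem for admissible fluxes -/

/-- A condition at an end that holds locally uniformly in time holds uniformly on compact sets of
times. -/
lemma eventually_forall_mem_of_isCompact {E : Filter (ℝ × ℝ)} {K : Set ℝ} (hK : IsCompact K)
    {P : ℝ × ℝ × ℝ → Prop} (h : ∀ t ∈ K, ∀ᶠ x in 𝓝 t ×ˢ E, P x) :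
    ∀ᶠ y in E, ∀ t ∈ K, P (t, y) := by
  have h1 : ∀ᶠ x in 𝓝ˢ K ×ˢ E, P x := by
    rw [hK.nhdsSet_prod_eq_biSup]
    simpa only [eventually_iSup] using h
  obtain ⟨p, hp, q, hq, hpq⟩ := eventually_prod_iff.1 h1
  exact hq.mono fun y hy t ht => hpq (hp.self_of_nhdsSet t ht) hy

lemma IsFlux.continuousOn_div (hI : IsOpen I) {V : Fin 2 → Field} (hV : IsFlux I V) (ht : t ∈ I) :
    ContinuousOn (fun x : ℝ × ℝ => ∑ A, pd A (V A t) x.1 x.2) halfPlane :=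
  Sm.continuousOn_halfPlane (f := fun t ρ z => ∑ A, pd A (V A t) ρ z)
    (Sm.sum fun A => (hV.smooth A).pd (isOpen_dom hI) A) ht

/-- The integral of the divergence of an admissible flux over half annuli tends to zero, uniformly
on compact sets of times. -/
lemma IsFlux.eventually_le (hI : IsOpen I) {V : Fin 2 → Field} (hV : IsFlux I V) {K : Set ℝ}
    (hK : IsCompact K) (hKI : K ⊆ I) {c : ℝ} (hc : 0 < c) :
    ∀ᶠ y in annulusEnds, ∀ t ∈ K,
      |∫ x in halfAnnulus y.1 y.2, ∑ A, pd A (V A t) x.1 x.2| ≤ c := by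
  have hpi := Real.pi_pos
  set b := c / (4 * Real.pi) with hb
  have hb0 : 0 < b := by positivity
  have hE : ∀ E, (∀ t ∈ I, ∀ A, SmallFlux (𝓝 t ×ˢ E) (V A)) →
      ∀ᶠ y in E, ∀ t ∈ K, ∀ A, |rad y.1 y.2 * V A t y.1 y.2| ≤ b := by
    intro E h
    refine eventually_forall_mem_of_isCompact (P := fun x => ∀ A,
      |rad x.2.1 x.2.2 * V A x.1 x.2.1 x.2.2| ≤ b) hK fun t ht => eventually_all.2 fun A => ?_
    filter_upwards [(h t (hKI ht) A).def hb0] with x hx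
    simpa using hx
  obtain ⟨R₂, h2⟩ := eventually_endInfinity.1 (hE _ hV.infinity)
  obtain ⟨R₁, hR₁, h1⟩ := eventually_endOrigin.1 (hE _ hV.origin)
  have e1 : ∀ᶠ y in annulusEnds, y.1 ≤ R₁ := tendsto_fst.eventually
    (eventually_nhdsWithin_of_eventually_nhds (eventually_le_nhds hR₁))
  have e2 : ∀ᶠ y in annulusEnds, R₂ ≤ y.2 := tendsto_snd.eventually (eventually_ge_atTop _)
  filter_upwards [eventually_annulusEnds, e1, e2] with y hy e1 e2 t ht
  obtain ⟨D, hD⟩ := (hV.div t (hKI ht) y.1 hy.1 y.2).exists_le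
  choose C hC using fun A => (hV.axis t (hKI ht) y.1 hy.1 y.2 A).exists_le
  have hsm : ∀ A, ∀ ρ > 0, ∀ z, DiffS (V A t) ρ z := fun A ρ hρ z =>
    (hV.smooth A).diffS (isOpen_dom hI) ⟨hKI ht, hρ⟩
  have key := abs_setIntegral_div_le (V := fun A => V A t) (C := max (C 0) (C 1)) (D := D)
    (bδ := b) (bL := b) hy.1 hy.2 hsm ?_ (hV.continuousOn_div hI (hKI ht))
    (fun x hx => hD x (halfAnnulus_subset_annulus hx)) ?_ ?_
  · refine key.trans (le_of_eq ?_)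
    rw [hb]; field_simp; norm_num
  · intro A ρ hρ z hr1 hr2
    have h := hC A (ρ, z) ⟨hρ, hr1, hr2⟩
    simp only [abs_div, abs_of_pos hρ, div_le_iff₀ hρ] at h
    refine h.trans ?_
    gcongr
    fin_cases A
    · exact le_max_left _ _
    · exact le_max_right _ _
  · intro A ρ hρ z hr
    have h := h1 (ρ, z) hρ (hr.le.trans e1) t ht A
    rwa [abs_mul, abs_of_pos (rad_pos hρ), hr] at h
  · intro A ρ hρ z hr
    have h := h2 (ρ, z) hρ (e2.trans hr.ge) t ht A
    rwa [abs_mul, abs_of_pos (rad_pos hρ), hr] at h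

lemma IsFlux.tendsto_zero (hI : IsOpen I) {V : Fin 2 → Field} (hV : IsFlux I V) (ht : t ∈ I) :
    Tendsto (fun y : ℝ × ℝ => ∫ x in halfAnnulus y.1 y.2, ∑ A, pd A (V A t) x.1 x.2)
      annulusEnds (𝓝 0) := by
  rw [Metric.tendsto_nhds]
  intro c hc
  filter_upwards [hV.eventually_le hI isCompact_singleton (Set.singleton_subset_iff.2 ht)
    (half_pos hc)] with y hy
  rw [Real.dist_0_eq_abs]
  linarith [hy t rfl]
end

section
variable {m a : ℝ} {I : Set ℝ} {t : ℝ} {φ ψ : Pert} {e : Scal}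

/-! ### Masses of energy densities -/

lemma lintegral_ne_top_of_posMass (h : posMass e ≠ ⊤) :
    ∫⁻ x in halfPlane, ENNReal.ofReal (e x.1 x.2) ≠ ⊤ := fun h0 => h <| by
  rw [posMass, h0, ENNReal.mul_top]
  simp

lemma integrableOn_of_posMass_ne_top (h : posMass e ≠ ⊤)
    (hc : ContinuousOn (fun x : ℝ × ℝ => e x.1 x.2) halfPlane)
    (h0 : ∀ ρ > 0, ∀ z, 0 ≤ e ρ z) :
    IntegrableOn (fun x : ℝ × ℝ => e x.1 x.2) halfPlane := by
  refine ⟨hc.aestronglyMeasurable measurableSet_halfPlane, ?_⟩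
  rw [hasFiniteIntegral_iff_ofReal
    (ae_restrict_of_forall_mem measurableSet_halfPlane fun x hx => h0 _ hx _)]
  exact (lintegral_ne_top_of_posMass h).lt_top

lemma toReal_posMass (hc : ContinuousOn (fun x : ℝ × ℝ => e x.1 x.2) halfPlane)
    (h0 : ∀ ρ > 0, ∀ z, 0 ≤ e ρ z) : (posMass e).toReal = mass e := by
  rw [mass, posMass, ENNReal.toReal_mul, ENNReal.toReal_ofReal (by norm_num),
    integral_eq_lintegral_of_nonneg_ae
    (ae_restrict_of_forall_mem measurableSet_halfPlane fun x hx => h0 _ hx _)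
    (hc.aestronglyMeasurable measurableSet_halfPlane)]

/-- The improper mass of an integrable density is its mass. -/
lemma HasMass.eq_mass {M : EReal} (hM : HasMass e M)
    (he : IntegrableOn (fun x : ℝ × ℝ => e x.1 x.2) halfPlane) : M = mass e := by
  refine tendsto_nhds_unique hM.2 ?_
  have h := (aecover_halfAnnulus.integral_tendsto_of_countably_generated he).const_mul (1 / 16)
  simp only [restrict_halfAnnulus] at h
  exact (continuous_coe_real_ereal.tendsto _).comp h

lemma tendsto_ereal_add_coe {α : Type*} {l : Filter α} {u : α → EReal} {v : α → ℝ} {M : EReal}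
    (hu : Tendsto u l (𝓝 M)) (hv : Tendsto v l (𝓝 0)) :
    Tendsto (fun y => u y + (v y : EReal)) l (𝓝 M) := by
  have h2 := (continuous_coe_real_ereal.tendsto 0).comp hv
  have hc : ContinuousAt (fun p : EReal × EReal => p.1 + p.2) (M, ((0 : ℝ) : EReal)) :=
    EReal.continuousAt_add (Or.inr (EReal.coe_ne_bot _)) (Or.inr (EReal.coe_ne_top _))
  have h := hc.tendsto.comp (hu.prodMk_nhds h2)
  rw [EReal.coe_zero, add_zero] at h
  exact h

/-- The extended mass of a non-negative density `e` is the improper mass of every density `e'` such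
that the integrals of `e - e'` over half annuli tend to zero. -/
lemma hasMass_posMass {e' : Scal}
    (hi : ∀ δ L : ℝ, 0 < δ → δ < L → IntegrableOn (fun x : ℝ × ℝ => e x.1 x.2) (halfAnnulus δ L))
    (hi' : ∀ δ L : ℝ, 0 < δ → δ < L →
      IntegrableOn (fun x : ℝ × ℝ => e' x.1 x.2) (halfAnnulus δ L))
    (hc : ContinuousOn (fun x : ℝ × ℝ => e x.1 x.2) halfPlane)
    (h0 : ∀ ρ > 0, ∀ z, 0 ≤ e ρ z)
    (hd : Tendsto (fun y : ℝ × ℝ => ∫ x in halfAnnulus y.1 y.2, (e x.1 x.2 - e' x.1 x.2))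
      annulusEnds (𝓝 0)) :
    HasMass e' (posMass e) := by
  refine ⟨hi', ?_⟩
  have h1 := aecover_halfAnnulus.lintegral_tendsto_of_countably_generated
    (hc.aestronglyMeasurable measurableSet_halfPlane).aemeasurable.ennreal_ofReal
  have h2 := (continuous_coe_ennreal_ereal.tendsto _).comp
    (ENNReal.Tendsto.const_mul (a := ENNReal.ofReal (1 / 16)) h1 (Or.inr ENNReal.ofReal_ne_top))
  have h3 := tendsto_ereal_add_coe h2 (by simpa using hd.const_mul (-(1 / 16)))
  refine h3.congr' ?_
  filter_upwards [eventually_annulusEnds] with y hy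
  have hi1 := hi y.1 y.2 hy.1 hy.2
  have hi2 := hi' y.1 y.2 hy.1 hy.2
  have hnn : 0 ≤ᵐ[volume.restrict (halfAnnulus y.1 y.2)] fun x : ℝ × ℝ => e x.1 x.2 :=
    ae_restrict_of_forall_mem (measurableSet_halfAnnulus _ _) fun x hx => h0 _ hx.1 _
  simp only [Function.comp_apply, restrict_halfAnnulus]
  rw [← ofReal_integral_eq_lintegral_ofReal hi1 hnn, ← ENNReal.ofReal_mul (by norm_num),
    EReal.coe_ennreal_ofReal, max_eq_left (mul_nonneg (by norm_num) (integral_nonneg_of_ae hnn)),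
    ← EReal.coe_add, integral_sub hi1 hi2]
  congr 1
  ring

/-! ### Smoothness of the energy densities -/

lemma Sm.gdot {U : Set (ℝ × ℝ × ℝ)} {f g : Field} (hU : IsOpen U) (hf : Sm U f) (hg : Sm U g) :
    Sm U fun t ρ z => gdot (f t) (g t) ρ z :=
  Sm.sum fun A => (hf.pd hU A).mul (hg.pd hU A)

lemma IsRegular.sm_eps2Form (hm : 0 < m) (ha : |a| = m) (hI : IsOpen I) (hφ : IsRegular m a I φ)
    (hψ : IsRegular m a I ψ) : Sm (dom I) (eps2Form m a φ ψ) := by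
  have hU := isOpen_dom hI
  have hE := sm_exp_two_u0 (I := I) hm ha
  have hη := (sm_eta0 (I := I) hm ha).pow 2
  have hη0 : ∀ x ∈ dom I, eta0 m a x.2.1 x.2.2 ^ 2 ≠ 0 := fun x hx =>
    (pow_pos (eta0_pos hm ha hx.2) 2).ne'
  have hρ0 : ∀ x ∈ dom I, x.2.1 ^ 2 ≠ 0 := fun x hx => (pow_pos hx.2 2).ne'
  have hE' : Sm (dom I) fun _ ρ z => Real.exp (-(2 * u0 m a ρ z)) :=
    ((Sm.const 1).div hE fun x _ => (Real.exp_pos _).ne').congr fun x _ => by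
      simp [Real.exp_neg]
  have hw := sm_omega0 (I := I) hm ha
  have s1 := hφ.sm_sig
  have s2 := hψ.sm_sig
  have o1 := hφ.sm_om
  have o2 := hψ.sm_om
  refine Sm.mul (Sm.sub (Sm.add (Sm.add (Sm.add (Sm.add (Sm.add ?_ ?_) ?_) ?_) ?_) ?_) ?_) Sm.rho
  · exact ((Sm.const 2).mul (hE.div (Sm.rho.pow 2) hρ0)).mul
      ((hφ.sm_p hm ha hI).mul (hψ.sm_p hm ha hI))
  · exact ((Sm.const 2).mul (hE.div ((Sm.rho.pow 2).mul hη) fun x hx =>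
      mul_ne_zero (hρ0 x hx) (hη0 x hx))).mul ((hφ.sm_d hm ha hI).mul (hψ.sm_d hm ha hI))
  · exact ((Sm.const 4).mul hE').mul (Sm.sum fun A => Sm.sum fun B =>
      (hφ.sm_chi A B).mul (hψ.sm_chi A B))
  · exact (Sm.const 2).mul (Sm.gdot hU s1 s2)
  · exact ((Sm.const 2).mul (Sm.gdot hU o1 o2)).div hη hη0
  · exact ((Sm.const 4).mul ((Sm.gdot hU hw hw).div hη hη0)).mul (s1.mul s2)
  · exact ((Sm.const 4).mul (((Sm.gdot hU hw o2).mul s1).add ((Sm.gdot hU hw o1).mul s2))).div hη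
      hη0

lemma IsRegular.continuousOn_eps2 (hm : 0 < m) (ha : |a| = m) (hI : IsOpen I) (ht : t ∈ I)
    (hφ : IsRegular m a I φ) :
    ContinuousOn (fun x : ℝ × ℝ => φ.eps2 m a t x.1 x.2) halfPlane := by
  rw [← eps2Form_self]
  exact (IsRegular.sm_eps2Form hm ha hI hφ hφ).continuousOn_halfPlane ht

lemma IsRegular.integrableOn_eps2 (hm : 0 < m) (ha : |a| = m) (hI : IsOpen I) (ht : t ∈ I)
    (hφ : IsRegular m a I φ) {δ : ℝ} (hδ : 0 < δ) (L : ℝ) :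
    IntegrableOn (fun x : ℝ × ℝ => φ.eps2 m a t x.1 x.2) (halfAnnulus δ L) := by
  have h := hφ.bdd_eps2Form hφ hm ha hI ht hδ (L := L)
  rw [eps2Form_self] at h
  exact h.integrableOn (hφ.continuousOn_eps2 hm ha hI ht)

lemma IsRegular.continuousOn_eps2Bar (hm : 0 < m) (ha : |a| = m) (hI : IsOpen I) (ht : t ∈ I)
    (hφ : IsRegular m a I φ) (hV : IsFlux I (carterFlux m a φ)) :
    ContinuousOn (fun x : ℝ × ℝ => φ.eps2Bar m a t x.1 x.2) halfPlane := by
  refine ((hφ.continuousOn_eps2 hm ha hI ht).add (hV.continuousOn_div hI ht)).congr fun x hx => ?_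
  simp only [Pi.add_apply, div_carterFlux hm ha hI hφ (show (t, x.1, x.2) ∈ dom I from ⟨ht, hx⟩)]
  ring

lemma eps2Bar_nonneg (hm : 0 < m) (ha : |a| = m) {ρ z : ℝ} (h : 0 < ρ) :
    0 ≤ φ.eps2Bar m a t ρ z := by
  have hη := eta0_pos (z := z) hm ha h
  unfold Pert.eps2Bar Pert.kin Pert.chiSq
  positivity

/-- Carter's identity in integrated form. -/
lemma hasMass_eps2 (hm : 0 < m) (ha : |a| = m) (hI : IsOpen I) (ht : t ∈ I)
    (hφ : IsRegular m a I φ) (hV : IsFlux I (carterFlux m a φ)) :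
    HasMass (φ.eps2 m a t) (posMass (φ.eps2Bar m a t)) := by
  have hc := hφ.continuousOn_eps2Bar hm ha hI ht hV
  refine hasMass_posMass
    (fun δ L hδ _ => (hφ.bdd_eps2Bar hm ha hI ht hδ).integrableOn hc)
    (fun δ L hδ _ => hφ.integrableOn_eps2 hm ha hI ht hδ L) hc
    (fun ρ hρ z => eps2Bar_nonneg hm ha hρ) ?_
  refine (hV.tendsto_zero hI ht).congr fun y => ?_
  refine setIntegral_congr_fun (measurableSet_halfAnnulus _ _) fun x hx => ?_
  exact div_carterFlux hm ha hI hφ ⟨ht, hx.1⟩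

/-! ### The first order mass -/

/-- The integral of `1 / (r^(3/2) (r + m))` over the plane converges at both ends; here `r` is
replaced by the sup norm, which is smaller. -/
lemma integrable_radial (hm : 0 < m) :
    Integrable fun x : ℝ × ℝ => 1 / (√‖x‖ * ‖x‖ * (‖x‖ + m)) := by
  have h := integrable_fun_norm_addHaar (volume : Measure (ℝ × ℝ))
    (f := fun r => 1 / (√r * r * (r + m)))
  refine h.2 ?_
  have hd : Module.finrank ℝ (ℝ × ℝ) - 1 = 1 := by simp
  rw [hd]
  have hmeas : Measurable fun r : ℝ => r ^ 1 • (1 / (√r * r * (r + m))) := by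
    simp only [smul_eq_mul]
    fun_prop
  rw [← Set.Ioc_union_Ioi_eq_Ioi (zero_le_one' ℝ)]
  refine IntegrableOn.union ?_ ?_
  · have h1 : IntegrableOn (fun r : ℝ => 1 / m * r ^ (-1 / 2 : ℝ)) (Set.Ioc 0 1) :=
      ((intervalIntegrable_iff_integrableOn_Ioc_of_le zero_le_one).1
        (intervalIntegral.intervalIntegrable_rpow' (by norm_num))).const_mul _
    refine h1.mono' hmeas.aestronglyMeasurable
      (ae_restrict_of_forall_mem measurableSet_Ioc fun r hr => ?_)
    have hr0 : 0 < r := hr.1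
    have hs := Real.sqrt_pos.2 hr0
    have hp : r ^ (-1 / 2 : ℝ) = 1 / √r := by
      rw [eq_div_iff hs.ne', mul_comm]; exact sqrt_mul_rpow hr0
    rw [hp, smul_eq_mul, Real.norm_of_nonneg (by positivity)]
    calc _ = 1 / (r + m) * (1 / √r) := by field_simp
      _ ≤ _ := by gcongr; linarith
  · have h1 : IntegrableOn (fun r : ℝ => r ^ (-3 / 2 : ℝ)) (Set.Ioi 1) :=
      integrableOn_Ioi_rpow_of_lt (by norm_num) one_pos
    refine h1.mono' hmeas.aestronglyMeasurable
      (ae_restrict_of_forall_mem measurableSet_Ioi fun r hr => ?_)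
    have hr0 : 0 < r := one_pos.trans hr
    have hs := Real.sqrt_pos.2 hr0
    have hp : r ^ (-3 / 2 : ℝ) = 1 / √r / r := by
      have e : (-3 / 2 : ℝ) = -1 / 2 - 1 := by norm_num
      have := sqrt_mul_rpow hr0
      rw [e, Real.rpow_sub_one hr0.ne']
      congr 1
      rw [eq_div_iff hs.ne', mul_comm]; exact this
    rw [hp, smul_eq_mul, Real.norm_of_nonneg (by positivity)]
    calc _ = 1 / √r / (r + m) := by field_simp
      _ ≤ _ := by gcongr; linarith

lemma IsDecaying.small_eps1 (hm : 0 < m) (ha : |a| = m) (hI : IsOpen I) (ht : t ∈ I)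
    {E : Filter (ℝ × ℝ)} (hE : E ≤ 𝓟 halfPlane) (hd : IsDecaying m a I E φ) :
    Small (𝓝 t ×ˢ E) fun t ρ z => rad ρ z * (rad ρ z + m) * φ.eps1 m a t ρ z := by
  have hs : ∀ A, Bdd (𝓝 t ×ˢ E) fun _ ρ z =>
      2 * (rad ρ z * (rad ρ z + m) * pd A (sigma0 m a) ρ z) := by
    intro A
    refine (Bdd.const 2).mul (Bdd.of_bound (32 * m) ?_)
    filter_upwards [eventually_end hI ht hE] with x hx
    have hr := rad_pos (z := x.2.2) hx.2
    rw [abs_mul, abs_of_pos (by positivity), mul_comm, ← le_div_iff₀ (by positivity)]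
    exact abs_pd_sigma0_le hm ha hx.2 A
  have hw : ∀ A, Bdd (𝓝 t ×ˢ E) fun _ ρ z =>
      2 * (rad ρ z * (rad ρ z + m) * domega0 m a A ρ z) := by
    intro A
    refine (Bdd.const 2).mul (Bdd.of_bound (56 * m) ?_)
    filter_upwards [eventually_end hI ht hE] with x hx
    have hr := rad_pos (z := x.2.2) hx.2
    have hl := left_le_rad (ρ := x.2.1) (z := x.2.2)
    rw [abs_mul, abs_of_pos (by positivity), mul_comm, ← le_div_iff₀ (by positivity)]
    refine (abs_pd_omega0_div_eta0_le hm ha hx.2 A).trans ?_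
    calc _ ≤ 56 * (m * (rad x.2.1 x.2.2 + m)) * rad x.2.1 x.2.2
          / (rad x.2.1 x.2.2 ^ 2 * (rad x.2.1 x.2.2 + m) ^ 2) := by
          have hρ : 0 < x.2.1 := hx.2
          gcongr; nlinarith
      _ = _ := by field_simp
  have h1 := fun A => ((hd.pd_sig t ht A).mul_bdd (hs A)).add (((hd.dtw t ht A).mul_bdd (hw A)).add
    ((hd.sig t ht).mul_bdd (((hw A).mul (bdd_rho_mul_domega0 hm ha hI ht hE A)).mul
      (Bdd.const (-1)))))
  refine ((h1 0).add (h1 1)).congr ?_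
  filter_upwards [eventually_end hI ht hE] with x hx
  have hη := eta0_pos (z := x.2.2) hm ha hx.2
  simp only [Pert.eps1, gdot, domega0, Pert.dtw, Fin.sum_univ_two]
  field_simp
  ring

lemma integrableOn_eps1 (hm : 0 < m) (ha : |a| = m) (hI : IsOpen I) (ht : t ∈ I)
    (hφ : IsRegular m a I φ) (hinf : IsDecaying m a I endInfinity φ)
    (horig : IsDecaying m a I endOrigin φ) (hV : IsFlux I (eps1Flux m a φ)) :
    IntegrableOn (fun x : ℝ × ℝ => φ.eps1 m a t x.1 x.2) halfPlane := by
  have hc : ContinuousOn (fun x : ℝ × ℝ => φ.eps1 m a t x.1 x.2) halfPlane :=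
    (hV.continuousOn_div hI ht).congr fun x hx =>
      (div_eps1Flux hm ha hI hφ (show (t, x.1, x.2) ∈ dom I from ⟨ht, hx⟩)).symm
  have hE : ∀ E, Small (𝓝 t ×ˢ E) (fun t ρ z => rad ρ z * (rad ρ z + m) * φ.eps1 m a t ρ z) →
      ∀ᶠ y in E, √(rad y.1 y.2) * (rad y.1 y.2 * (rad y.1 y.2 + m)) * |φ.eps1 m a t y.1 y.2| ≤ 1
      := by
    intro E h
    have h1 := eventually_forall_mem_of_isCompact (isCompact_singleton (x := t))
      (P := fun x => ‖√(rad x.2.1 x.2.2) * (rad x.2.1 x.2.2 * (rad x.2.1 x.2.2 + m)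
        * φ.eps1 m a x.1 x.2.1 x.2.2)‖ ≤ 1 * ‖(1 : ℝ)‖) (E := E)
      fun s hs => by rw [Set.mem_singleton_iff.1 hs]; exact h.def one_pos
    filter_upwards [h1] with y hy
    have hr : 0 ≤ rad y.1 y.2 := rad_nonneg
    have h2 := hy t rfl
    rwa [norm_one, mul_one, Real.norm_eq_abs, abs_mul, abs_mul, abs_of_nonneg (Real.sqrt_nonneg _),
      abs_of_nonneg (by positivity), ← mul_assoc] at h2
  obtain ⟨R₂, h2⟩ := eventually_endInfinity.1 (hE _ (hinf.small_eps1 hm ha hI ht endInfinity_le))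
  obtain ⟨R₁, hR₁, h1⟩ := eventually_endOrigin.1
    (hE _ (horig.small_eps1 hm ha hI ht endOrigin_le))
  obtain ⟨C, hC⟩ := (hφ.bdd_eps1 hm ha hI ht hR₁ (L := R₂)).exists_le
  -- in the middle range the density is bounded
  set D := max 1 (√R₂ * (R₂ * (R₂ + m)) * C) with hD
  have hbound : ∀ x ∈ halfPlane,
      √(rad x.1 x.2) * (rad x.1 x.2 * (rad x.1 x.2 + m)) * |φ.eps1 m a t x.1 x.2| ≤ D := by
    intro x hx
    have hr := rad_pos (z := x.2) hx
    rcases le_total (rad x.1 x.2) R₁ with hr1 | hr1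
    · exact (h1 x hx hr1).trans (le_max_left _ _)
    rcases le_total R₂ (rad x.1 x.2) with hr2 | hr2
    · exact (h2 x hx hr2).trans (le_max_left _ _)
    · refine le_trans ?_ (le_max_right _ _)
      have hR₂ : 0 < R₂ := hr.trans_le hr2
      gcongr
      exact hC x ⟨hx, hr1, hr2⟩
  refine ((integrable_radial hm).const_mul D).integrableOn.mono'
    (hc.aestronglyMeasurable measurableSet_halfPlane)
    (ae_restrict_of_forall_mem measurableSet_halfPlane fun x hx => ?_)
  have hr := rad_pos (z := x.2) hx
  have hn : ‖x‖ ≤ rad x.1 x.2 := max_le abs_left_le_rad abs_right_le_rad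
  have hn0 : 0 < ‖x‖ := norm_pos_iff.2 fun h => by
    have h0 : 0 < x.1 := hx
    rw [h] at h0; exact lt_irrefl _ h0
  have h := hbound x hx
  rw [mul_one_div, le_div_iff₀ (by positivity), Real.norm_eq_abs]
  refine le_trans ?_ h
  rw [mul_comm, mul_assoc (√‖x‖)]
  gcongr

lemma mass_eps1_eq_zero (hm : 0 < m) (ha : |a| = m) (hI : IsOpen I) (ht : t ∈ I)
    (hφ : IsRegular m a I φ) (hV : IsFlux I (eps1Flux m a φ))
    (hi : IntegrableOn (fun x : ℝ × ℝ => φ.eps1 m a t x.1 x.2) halfPlane) :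
    mass (φ.eps1 m a t) = 0 := by
  have h := aecover_halfAnnulus.integral_tendsto_of_countably_generated hi
  simp only [restrict_halfAnnulus] at h
  rw [mass, tendsto_nhds_unique h ((hV.tendsto_zero hI ht).congr fun y =>
    setIntegral_congr_fun (measurableSet_halfAnnulus _ _) fun x hx =>
      div_eps1Flux hm ha hI hφ ⟨ht, hx.1⟩), mul_zero]
end

section
variable {m a : ℝ} {I : Set ℝ} {t : ℝ} {φ : Pert}

/-! ### Positive definiteness -/

/-- If `ε̄₂` vanishes, then the kinetic data vanish and `σ₁² + (ω₁/η₀)²` is constant, because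
`∂σ₁ = -(ω₁/η₀) ∂ω₀/η₀` and `∂(ω₁/η₀) = σ₁ ∂ω₀/η₀`. It tends to zero at infinity. -/
lemma vanishesAt_of_eps2Bar_eq_zero (hm : 0 < m) (ha : |a| = m) (hI : IsOpen I) (ht : t ∈ I)
    (hφ : IsRegular m a I φ) (hinf : IsDecaying m a I endInfinity φ)
    (h0 : ∀ ρ > 0, ∀ z, φ.eps2Bar m a t ρ z = 0) : VanishesAt m a φ t := by
  have hpoint : ∀ ρ > 0, ∀ z, (φ.p m a t ρ z = 0 ∧ φ.d m a t ρ z = 0 ∧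
      ∀ A B, φ.chi A B t ρ z = 0) ∧
      pd 1 (φ.sig t) ρ z = -(φ.tw m a t ρ z * domega0 m a 1 ρ z) ∧
      pd 1 (φ.tw m a t) ρ z = φ.sig t ρ z * domega0 m a 1 ρ z := by
    intro ρ hρ z
    have hη := eta0_pos (z := z) hm ha hρ
    have h := h0 ρ hρ z
    have hE := Real.exp_pos (2 * u0 m a ρ z)
    have hE' := Real.exp_pos (-(2 * u0 m a ρ z))
    rw [Pert.eps2Bar, mul_eq_zero, or_iff_left hρ.ne', Pert.kin, Pert.chiSq] at h
    have hnn : ∀ f : Fin 2 → ℝ, 0 ≤ ∑ A, f A ^ 2 := fun f =>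
      Finset.sum_nonneg fun A _ => sq_nonneg _
    have n1 := hnn fun A => pd A (φ.sig t) ρ z
        + φ.om t ρ z / eta0 m a ρ z ^ 2 * pd A (omega0 m a) ρ z
    have n2 := hnn fun A => pd A (fun ρ' z' => φ.om t ρ' z' / eta0 m a ρ' z') ρ z
        - φ.sig t ρ z / eta0 m a ρ z * pd A (omega0 m a) ρ z
    have n3 := hnn fun A => φ.sig t ρ z / eta0 m a ρ z * pd A (omega0 m a) ρ z
        - φ.om t ρ z / eta0 m a ρ z ^ 2 * pd A (eta0 m a) ρ z
    have k1 : 0 ≤ 2 * (Real.exp (2 * u0 m a ρ z) / ρ ^ 2) * φ.p m a t ρ z ^ 2 := by positivity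
    have k2 : 0 ≤ 2 * (Real.exp (2 * u0 m a ρ z) / (ρ ^ 2 * eta0 m a ρ z ^ 2))
      * φ.d m a t ρ z ^ 2 := by positivity
    have k3 : 0 ≤ 4 * Real.exp (-(2 * u0 m a ρ z)) * ∑ A, ∑ B, φ.chi A B t ρ z ^ 2 := by
      positivity
    have hz : ∀ {f : Fin 2 → ℝ}, ∑ A, f A ^ 2 = 0 → ∀ A, f A = 0 := fun {f} hf A => by
      have := (Finset.sum_eq_zero_iff_of_nonneg fun A _ => sq_nonneg (f A)).1 hf A
        (Finset.mem_univ _)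
      exact pow_eq_zero_iff two_ne_zero |>.1 this
    refine ⟨⟨?_, ?_, ?_⟩, ?_, ?_⟩
    · have e : 2 * (Real.exp (2 * u0 m a ρ z) / ρ ^ 2) * φ.p m a t ρ z ^ 2 = 0 := by linarith
      exact pow_eq_zero_iff two_ne_zero |>.1 ((mul_eq_zero.1 e).resolve_left (by positivity))
    · have e : 2 * (Real.exp (2 * u0 m a ρ z) / (ρ ^ 2 * eta0 m a ρ z ^ 2))
        * φ.d m a t ρ z ^ 2 = 0 := by linarith
      exact pow_eq_zero_iff two_ne_zero |>.1 ((mul_eq_zero.1 e).resolve_left (by positivity))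
    · have e : 4 * Real.exp (-(2 * u0 m a ρ z)) * ∑ A, ∑ B, φ.chi A B t ρ z ^ 2 = 0 := by linarith
      have e1 := (mul_eq_zero.1 e).resolve_left (by positivity)
      intro A
      exact hz ((Finset.sum_eq_zero_iff_of_nonneg fun A _ =>
        Finset.sum_nonneg fun B _ => sq_nonneg (φ.chi A B t ρ z)).1 e1 A (Finset.mem_univ _))
    · have e := hz (le_antisymm (by linarith) n1) 1
      rw [Pert.tw, domega0]
      linear_combination (norm := (field_simp; ring)) e
    · have e := hz (le_antisymm (by linarith) n2) 1
      have e' : pd 1 (φ.tw m a t) ρ z = pd 1 (fun ρ' z' => φ.om t ρ' z' / eta0 m a ρ' z') ρ z := rfl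
      rw [e', domega0]
      linear_combination (norm := (field_simp; ring)) e
  have htw : Sm (dom I) (φ.tw m a) := by
    have h := sm_div_eta0 hm ha hφ.sm_om 1
    simp only [pow_one] at h
    exact h
  have hzero : ∀ ρ > 0, ∀ z, φ.sig t ρ z ^ 2 + φ.tw m a t ρ z ^ 2 = 0 := by
    intro ρ hρ z
    have hder : ∀ s, HasDerivAt (fun s => φ.sig t ρ s ^ 2 + φ.tw m a t ρ s ^ 2) 0 s := by
      intro s
      have d1 := (Sm.diffS (isOpen_dom hI) hφ.sm_sig
        (show (t, ρ, s) ∈ dom I from ⟨ht, hρ⟩)).slice1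
      have d2 := (Sm.diffS (isOpen_dom hI) htw (show (t, ρ, s) ∈ dom I from ⟨ht, hρ⟩)).slice1
      refine ((d1.fun_pow 2).add (d2.fun_pow 2)).congr_deriv ?_
      obtain ⟨_, q1, q2⟩ := hpoint ρ hρ s
      rw [q1, q2]
      push_cast
      ring
    have hconst : ∀ s, φ.sig t ρ s ^ 2 + φ.tw m a t ρ s ^ 2
        = φ.sig t ρ z ^ 2 + φ.tw m a t ρ z ^ 2 := fun s =>
      is_const_of_deriv_eq_zero (fun s => (hder s).differentiableAt) (fun s => (hder s).deriv) s z
    -- it suffices to go to infinity in the direction of `z`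
    have hlim : ∀ f : Field, Small (𝓝 t ×ˢ endInfinity) f →
        Tendsto (fun s => f t ρ s) atTop (𝓝 0) := by
      intro f hf
      rw [Metric.tendsto_nhds]
      intro c hc
      have h1 := eventually_forall_mem_of_isCompact (isCompact_singleton (x := t))
        (P := fun x => ‖√(rad x.2.1 x.2.2) * f x.1 x.2.1 x.2.2‖ ≤ c / 2 * ‖(1 : ℝ)‖)
        (E := endInfinity) fun s hs => by
          rw [Set.mem_singleton_iff.1 hs]; exact hf.def (half_pos hc)
      obtain ⟨R, hR⟩ := eventually_endInfinity.1 h1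
      filter_upwards [eventually_ge_atTop (max R 1)] with s hs
      have hrs : s ≤ rad ρ s := (le_abs_self s).trans abs_right_le_rad
      have h2 := hR (ρ, s) hρ ((le_max_left _ _).trans (hs.trans hrs)) t rfl
      have h3 : 1 ≤ √(rad ρ s) := Real.one_le_sqrt.2 ((le_max_right _ _).trans (hs.trans hrs))
      rw [norm_one, mul_one, norm_mul, Real.norm_of_nonneg (Real.sqrt_nonneg _)] at h2
      rw [dist_zero_right]
      nlinarith [norm_nonneg (f t ρ s)]
    have h1 := ((hlim _ (hinf.sig t ht)).pow 2).add ((hlim _ (hinf.tw t ht)).pow 2)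
    have h2 := tendsto_nhds_unique (h1.congr hconst) tendsto_const_nhds
    rw [← h2]; norm_num
  intro ρ hρ z
  have hη := eta0_pos (z := z) hm ha hρ
  obtain ⟨⟨hp, hd, hχ⟩, -, -⟩ := hpoint ρ hρ z
  have h := hzero ρ hρ z
  have hs : φ.sig t ρ z = 0 := by nlinarith [sq_nonneg (φ.sig t ρ z), sq_nonneg (φ.tw m a t ρ z)]
  have hw : φ.tw m a t ρ z = 0 := by
    nlinarith [sq_nonneg (φ.sig t ρ z), sq_nonneg (φ.tw m a t ρ z)]
  exact ⟨hs, (div_eq_zero_iff.1 hw).resolve_right hη.ne', hp, hd, hχ⟩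

lemma VanishesAt.eps2Bar_eq_zero (h : VanishesAt m a φ t) {ρ z : ℝ} (hρ : 0 < ρ) :
    φ.eps2Bar m a t ρ z = 0 := by
  obtain ⟨hs, hw, hp, hd, hχ⟩ := h ρ hρ z
  have hpd : ∀ f : Scal, (∀ ρ > 0, ∀ z, f ρ z = 0) → ∀ A, pd A f ρ z = 0 := by
    intro f hf A
    rw [pd_congr_halfPlane (g := fun _ _ => 0) hf hρ A]
    fin_cases A <;> simp [pd]
  have h1 := hpd (φ.sig t) fun ρ hρ z => (h ρ hρ z).1
  have h2 := hpd (fun ρ z => φ.om t ρ z / eta0 m a ρ z) fun ρ hρ z => by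
    simp [(h ρ hρ z).2.1]
  simp [Pert.eps2Bar, Pert.kin, Pert.chiSq, hs, hw, hp, hd, hχ, h1, h2]

lemma posMass_eps2Bar_eq_zero_iff (hm : 0 < m) (ha : |a| = m) (hI : IsOpen I) (ht : t ∈ I)
    (hφ : IsRegular m a I φ) (hinf : IsDecaying m a I endInfinity φ)
    (hV : IsFlux I (carterFlux m a φ)) :
    posMass (φ.eps2Bar m a t) = 0 ↔ VanishesAt m a φ t := by
  have hc := hφ.continuousOn_eps2Bar hm ha hI ht hV
  constructor
  · intro h
    have h1 : ∫⁻ x in halfPlane, ENNReal.ofReal (φ.eps2Bar m a t x.1 x.2) = 0 :=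
      (mul_eq_zero.1 h).resolve_left (by simp)
    rw [lintegral_eq_zero_iff' (hc.aestronglyMeasurable
      measurableSet_halfPlane).aemeasurable.ennreal_ofReal] at h1
    have h2 : (fun x : ℝ × ℝ => φ.eps2Bar m a t x.1 x.2)
        =ᵐ[volume.restrict halfPlane] fun _ => 0 := by
      filter_upwards [h1, ae_restrict_mem measurableSet_halfPlane] with x hx hx'
      exact le_antisymm (ENNReal.ofReal_eq_zero.1 hx) (eps2Bar_nonneg hm ha hx')
    have h3 := Measure.eqOn_open_of_ae_eq h2 isOpen_halfPlane hc continuousOn_const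
    refine vanishesAt_of_eps2Bar_eq_zero hm ha hI ht hφ hinf fun ρ hρ z => ?_
    have h4 := h3 (x := (ρ, z)) hρ
    exact h4
  · intro h
    have h1 : ∫⁻ x in halfPlane, ENNReal.ofReal (φ.eps2Bar m a t x.1 x.2)
        = ∫⁻ _ in halfPlane, 0 :=
      setLIntegral_congr_fun measurableSet_halfPlane fun x hx => by
        rw [h.eps2Bar_eq_zero hx, ENNReal.ofReal_zero]
    rw [posMass, h1, lintegral_zero, mul_zero]

/-! ### Conservation -/

lemma hasDerivAt_setIntegral_eps2 (hm : 0 < m) (ha : |a| = m) (hI : IsOpen I) (ht : t ∈ I)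
    (hφ : IsRegular m a I φ) (hsol : IsSolution m a I φ) {δ : ℝ} (hδ : 0 < δ) (L : ℝ) :
    HasDerivAt (fun s => ∫ x in halfAnnulus δ L, φ.eps2 m a s x.1 x.2)
      (∫ x in halfAnnulus δ L, ∑ A, pd A (energyFlux m a φ A t) x.1 x.2) t := by
  have hψ := hφ.dt hI
  obtain ⟨C, hC⟩ := ((Bdd.const 2).mul
    (hφ.bdd_eps2Form hψ hm ha hI ht hδ (L := L))).eventually_le
  have hc : ContinuousOn (fun x : ℝ × ℝ => 2 * eps2Form m a φ φ.dt t x.1 x.2) halfPlane :=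
    ((IsRegular.sm_eps2Form hm ha hI hφ hψ).continuousOn_halfPlane ht).const_smul (2 : ℝ)
  have key := hasDerivAt_integral_of_dominated_loc_of_deriv_le (μ := volume.restrict
    (halfAnnulus δ L)) (F := fun s x => φ.eps2 m a s x.1 x.2)
    (F' := fun s x => 2 * eps2Form m a φ φ.dt s x.1 x.2) (bound := fun _ => C)
    (inter_mem (hI.mem_nhds ht) hC)
    (eventually_of_mem (hI.mem_nhds ht) fun s hs =>
      (hφ.integrableOn_eps2 hm ha hI hs hδ L).aestronglyMeasurable)
    (hφ.integrableOn_eps2 hm ha hI ht hδ L)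
    ((hc.mono halfAnnulus_subset).aestronglyMeasurable (measurableSet_halfAnnulus δ L))
    (ae_restrict_of_forall_mem (measurableSet_halfAnnulus δ L) fun x hx s hs =>
      hs.2 x (halfAnnulus_subset_annulus hx))
    (integrableOn_const (volume_halfAnnulus_lt_top δ L).ne)
    (ae_restrict_of_forall_mem (measurableSet_halfAnnulus δ L) fun x hx s hs =>
      hφ.hasDerivAt_eps2 hI ⟨hs.1, hx.1⟩)
  refine key.2.congr_deriv (setIntegral_congr_fun (measurableSet_halfAnnulus δ L) fun x hx => ?_)
  exact (div_energyFlux hm ha hI hφ hsol ⟨ht, hx.1⟩).symm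

/-- The integrals of `ε₂` over half annuli at two times differ by a quantity that tends to zero. -/
lemma tendsto_eps2_sub (hm : 0 < m) (ha : |a| = m) (hI : IsOpen I) (hI' : I.OrdConnected)
    (hφ : IsRegular m a I φ) (hsol : IsSolution m a I φ) (hV : IsFlux I (energyFlux m a φ))
    {s : ℝ} (hs : s ∈ I) (ht : t ∈ I) :
    Tendsto (fun y : ℝ × ℝ => (∫ x in halfAnnulus y.1 y.2, φ.eps2 m a t x.1 x.2)
      - ∫ x in halfAnnulus y.1 y.2, φ.eps2 m a s x.1 x.2) annulusEnds (𝓝 0) := by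
  have hK : Set.uIcc s t ⊆ I := hI'.uIcc_subset hs ht
  rw [Metric.tendsto_nhds]
  intro c hc
  have hc' : 0 < c / (|t - s| + 1) := by positivity
  filter_upwards [hV.eventually_le hI isCompact_uIcc hK hc', eventually_annulusEnds] with y hy hy'
  have h := Convex.norm_image_sub_le_of_norm_hasDerivWithin_le (𝕜 := ℝ)
    (f := fun s => ∫ x in halfAnnulus y.1 y.2, φ.eps2 m a s x.1 x.2)
    (fun τ hτ => (hasDerivAt_setIntegral_eps2 hm ha hI (hK hτ) hφ hsol hy'.1
      y.2).hasDerivWithinAt) hy (convex_uIcc s t) Set.left_mem_uIcc Set.right_mem_uIcc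
  rw [dist_zero_right]
  refine h.trans_lt ?_
  rw [Real.norm_eq_abs, div_mul_eq_mul_div, div_lt_iff₀ (by positivity)]
  nlinarith

lemma HasMass.of_tendsto_sub {e e' : Scal} {M : EReal} (h : HasMass e M)
    (hi : ∀ δ L : ℝ, 0 < δ → δ < L →
      IntegrableOn (fun x : ℝ × ℝ => e' x.1 x.2) (halfAnnulus δ L))
    (hd : Tendsto (fun y : ℝ × ℝ => (∫ x in halfAnnulus y.1 y.2, e' x.1 x.2)
      - ∫ x in halfAnnulus y.1 y.2, e x.1 x.2) annulusEnds (𝓝 0)) : HasMass e' M := by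
  refine ⟨hi, (tendsto_ereal_add_coe h.2 (by simpa using hd.const_mul (1 / 16))).congr fun y => ?_⟩
  rw [← EReal.coe_add]
  congr 1
  ring

lemma hasMass_eps2_of_mem (hm : 0 < m) (ha : |a| = m) (hI : IsOpen I) (hI' : I.OrdConnected)
    (hφ : IsRegular m a I φ) (hsol : IsSolution m a I φ) (hV : IsFlux I (energyFlux m a φ))
    {s : ℝ} (hs : s ∈ I) (ht : t ∈ I) {M : EReal} (h : HasMass (φ.eps2 m a s) M) :
    HasMass (φ.eps2 m a t) M :=
  h.of_tendsto_sub (fun _ L hδ _ => hφ.integrableOn_eps2 hm ha hI ht hδ L)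
    (tendsto_eps2_sub hm ha hI hI' hφ hsol hV hs ht)

/-! ### The hypotheses -/

lemma isRegular_of_isSolution (hm : 0 < m) (ha : |a| = m) (hI : IsOpen I)
    (hsmooth : IsSmooth I φ) (hsol : IsSolution m a I φ) (hparity : HasParity I φ)
    (htwist : TwistConditions m a I φ) : IsRegular m a I φ where
  sig := hsmooth.sig
  om := hsmooth.om
  beta := hsmooth.beta
  chi := hsmooth.chi
  om_flat := flat_of_bigO1Axis hm ha hI hsmooth.om hparity.om htwist.axis
  beta_flat := flat_of_odd hparity.beta_rho
  shift := hsol.shift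

lemma omBar_dt : φ.dt.omBar m a = tdot (φ.omBar m a) := by
  funext t ρ z
  simp only [Pert.omBar, Pert.dt, tdot, deriv_div_const]
end

end KerrPert

open KerrPert
theorem theorem2 (m a : ℝ) (hm : 0 < m) (ha : |a| = m)
    (I : Set ℝ) (hI : IsOpen I) (hI' : I.OrdConnected)
    (φ : KerrPert.Pert)
    (hsmooth : IsSmooth I φ) (hsol : IsSolution m a I φ) (hparity : HasParity I φ)
    (hinfinity : HasFallOff I endInfinity φ) (horigin : HasFallOff I endOrigin φ)
    (htwist : TwistConditions m a I φ) :
    -- (i) the first order mass vanishes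
    (∀ t ∈ I, IntegrableOn (fun x : ℝ × ℝ => φ.eps1 m a t x.1 x.2) halfPlane ∧
      mass (φ.eps1 m a t) = 0) ∧
    -- the second order mass is the integral of the sum of squares
    (∀ t ∈ I, HasMass (φ.eps2 m a t) (posMass (φ.eps2Bar m a t) : EReal)) ∧
    (∀ t ∈ I, IntegrableOn (fun x : ℝ × ℝ => φ.eps2 m a t x.1 x.2) halfPlane →
      IntegrableOn (fun x : ℝ × ℝ => φ.eps2Bar m a t x.1 x.2) halfPlane ∧
      mass (φ.eps2 m a t) = mass (φ.eps2Bar m a t)) ∧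
    -- and it is positive definite
    (∀ t ∈ I, ∀ ρ > 0, ∀ z, 0 ≤ φ.eps2Bar m a t ρ z) ∧
    (∀ t ∈ I, posMass (φ.eps2Bar m a t) = 0 ↔ VanishesAt m a φ t) ∧
    (∀ t ∈ I, IntegrableOn (fun x : ℝ × ℝ => φ.eps2 m a t x.1 x.2) halfPlane →
      0 ≤ mass (φ.eps2 m a t) ∧ (mass (φ.eps2 m a t) = 0 ↔ VanishesAt m a φ t)) ∧
    -- (ii) the second order mass is conserved
    (∃ M : ℝ≥0∞, ∀ t ∈ I, HasMass (φ.eps2 m a t) (M : EReal)) ∧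
    (∀ s ∈ I, ∀ t ∈ I, IntegrableOn (fun x : ℝ × ℝ => φ.eps2 m a s x.1 x.2) halfPlane →
      IntegrableOn (fun x : ℝ × ℝ => φ.eps2 m a t x.1 x.2) halfPlane →
      mass (φ.eps2 m a s) = mass (φ.eps2 m a t)) := by
  have hφ := isRegular_of_isSolution hm ha hI hsmooth hsol hparity htwist
  have hψ := hφ.dt hI
  have hinf : IsDecaying m a I endInfinity φ :=
    IsDecaying.of_littleO1 hm ha hI endInfinity_le hφ.om (weight_infinity hm ha)
      hinfinity.sig hinfinity.beta hinfinity.chi htwist.infinity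
  have horig : IsDecaying m a I endOrigin φ :=
    IsDecaying.of_littleO1 hm ha hI endOrigin_le hφ.om (weight_origin hm ha)
      horigin.sig horigin.beta horigin.chi htwist.origin
  have hinf' : IsDecaying m a I endInfinity φ.dt :=
    IsDecaying.of_littleO1 hm ha hI endInfinity_le hψ.om (weight_infinity hm ha)
      hinfinity.sig_dot hinfinity.beta_dot hinfinity.chi_dot (omBar_dt ▸ htwist.infinity_dot)
  have horig' : IsDecaying m a I endOrigin φ.dt :=
    IsDecaying.of_littleO1 hm ha hI endOrigin_le hψ.om (weight_origin hm ha)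
      horigin.sig_dot horigin.beta_dot horigin.chi_dot (omBar_dt ▸ htwist.origin_dot)
  have hV1 := isFlux_eps1Flux hm ha hI hφ hinf horig
  have hVC := isFlux_carterFlux hm ha hI hφ hinf horig
  have hVE := isFlux_energyFlux hm ha hI hφ hsol hinf horig hinf' horig'
  have hmass : ∀ t ∈ I, HasMass (φ.eps2 m a t) (posMass (φ.eps2Bar m a t) : EReal) :=
    fun t ht => hasMass_eps2 hm ha hI ht hφ hVC
  have hnn : ∀ t ∈ I, ∀ ρ > 0, ∀ z, 0 ≤ φ.eps2Bar m a t ρ z :=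
    fun t _ ρ hρ z => eps2Bar_nonneg hm ha hρ
  have hzero : ∀ t ∈ I, posMass (φ.eps2Bar m a t) = 0 ↔ VanishesAt m a φ t :=
    fun t ht => posMass_eps2Bar_eq_zero_iff hm ha hI ht hφ hinf hVC
  -- an improper mass that is an ordinary integral is finite
  have hfin : ∀ t ∈ I, IntegrableOn (fun x : ℝ × ℝ => φ.eps2 m a t x.1 x.2) halfPlane →
      posMass (φ.eps2Bar m a t) ≠ ⊤ ∧
      mass (φ.eps2 m a t) = (posMass (φ.eps2Bar m a t)).toReal := by
    intro t ht hi
    have h := (hmass t ht).eq_mass hi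
    have hne : posMass (φ.eps2Bar m a t) ≠ ⊤ := fun h0 => by
      rw [h0, EReal.coe_ennreal_top] at h
      exact EReal.coe_ne_top _ h.symm
    rw [← EReal.coe_ennreal_toReal hne] at h
    exact ⟨hne, (EReal.coe_injective h).symm⟩
  refine ⟨fun t ht => ?_, hmass, fun t ht hi => ?_, hnn, hzero, fun t ht hi => ?_, ?_,
    fun s hs t ht his hit => ?_⟩
  · have hi := integrableOn_eps1 hm ha hI ht hφ hinf horig hV1
    exact ⟨hi, mass_eps1_eq_zero hm ha hI ht hφ hV1 hi⟩
  · obtain ⟨hne, h⟩ := hfin t ht hi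
    have hc := hφ.continuousOn_eps2Bar hm ha hI ht hVC
    exact ⟨integrableOn_of_posMass_ne_top hne hc (hnn t ht),
      h.trans (toReal_posMass hc (hnn t ht))⟩
  · obtain ⟨hne, h⟩ := hfin t ht hi
    rw [h, ENNReal.toReal_eq_zero_iff, or_iff_left hne]
    exact ⟨ENNReal.toReal_nonneg, hzero t ht⟩
  · rcases I.eq_empty_or_nonempty with rfl | ⟨s, hs⟩
    · exact ⟨0, fun t ht => ht.elim⟩
    · exact ⟨posMass (φ.eps2Bar m a s), fun t ht =>
        hasMass_eps2_of_mem hm ha hI hI' hφ hsol hVE hs ht (hmass s hs)⟩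
  · have h1 := hasMass_eps2_of_mem hm ha hI hI' hφ hsol hVE hs ht (hmass s hs)
    have h2 := ((hmass s hs).eq_mass his).symm.trans (h1.eq_mass hit)
    exact EReal.coe_injective h2
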